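/- Let $\mathcal G$ be a connected compact metric graph: finitely many vertices and finitely many edges $e$, each identified with an interval $[0,l_e]$, $l_e>0$ (loops and multiple edges allowed; a loop counts twice in the degree). Let $p>1$, let $v_1$ be a vertex of degree $1$, and let $I_1=[0,l_1]$ be the edge ending at $v_1$, with $v_1$ corresponding to the coordinate $0$. A function on $\mathcal G$ is a family $u=(u_e)_e$ with $u_e:[0,l_e]\to\mathbb R$, and $H^1(\mathcal G)$ is the set of functions that are continuous on $\mathcal G$ with $u_e\in H^1(0,l_e)$ for all $e$. For $\lambda>0$ put $\|u\|_\lambda^2=\int_{\mathcal G}|u'|^2\,dx+\lambda\int_{\mathcal G}|u|^2\,dx$. Let $$U(x)=\Big(\frac{p+1}{2}\Big)^{\frac1{p-1}}\Big[\cosh\Big(\frac{p-1}{2}x\Big)\Big]^{-\frac{2}{p-1}},$$ the even positive $H^1$ solution of $-U''+U=U^p$ on $\mathbb R$. Let $0<l<l_1$, let $\chi$ be a smooth cut-off function with $\chi=1$ on $[0,l/2]$ and $\chi=0$ on $[l,\infty)$, and set $$W_\lambda(x)=\chi(x)\,\lambda^{\frac1{p-1}}U(\sqrt\lambda\,x)\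 \text{ on } I_1,\qquad W_\lambda=0\ \text{ on }\mathcal G\setminus I_1 .$$ Then there is $\lambda_0>0$ such that for every $\lambda>\lambda_0$ there are $\rho=\rho(\lambda)>0$, $\phi=\phi_\lambda\in H^1(\mathcal G)$ and $u_\lambda=W_\lambda+\phi_\lambda$ such that $u_\lambda\in H^1(\mathcal G)$ is strictly positive on $\mathcal G$, is $C^2$ on every (closed) edge, and solves $$-u''+\lambda u=|u|^{p-1}u\ \text{ on every edge},\qquad \sum_{e\prec v}\frac{du_e}{dx}(v)=0\ \text{ for every vertex } v,\qquad |u|_{L^2(\mathcal G)}=\rho,$$ where the sum runs over the edge ends at $v$ and the derivatives are taken in the direction leaving $v$. Moreover $u_\lambda$ has a single peak at $v_1$: its maximum over $\mathcal G$ is attained at $v_1$ and only there. The family $(\phi_\lambda)$ satisfies, as $\lambda\to\infty$, $$\|\phi_\lambda\|_\lambda=O(\lambda^{-\alpha})\quad\text{for every }\alpha>0,$$ and the masses satisfy $$\rho(\lambda)^2=C\,\lambda^{\frac{5-p}{2(p-1)}}+o\Big(\lambda^{\frac{5-p}{2(p-1)}}\Big),\qquad C=\int_0^\infty U(x)^2\,dx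 .$$ -/

import Mathlib

open MeasureTheory Filter Set
open scoped ContDiff

noncomputable section

/-- A metric graph with vertex set `V` and edge set `E` (loops and multiple edges are allowed).
The edge `e` is identified with the interval `[0, len e]`, the coordinate `0` being glued to the
vertex `src e` and the coordinate `len e` to the vertex `tgt e`.
The graph is compact when `V` and `E` are finite. -/
structure MetricGraph (V E : Type*) where
  src : E → V
  tgt : E → V
  len : E → ℝ
  len_pos : ∀ e, 0 < len e

/-- `g` is a weak derivative of `f` on the interval `(0, l)`. -/
def IsWeakDeriv (l : ℝ) (f g : ℝ → ℝ) : Prop :=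
  ∀ ψ : ℝ → ℝ, ContDiff ℝ ∞ ψ → HasCompactSupport ψ → tsupport ψ ⊆ Ioo 0 l →
    ∫ x in Ioo 0 l, f x * deriv ψ x = -∫ x in Ioo 0 l, g x * ψ x

/-- `g` is a square-integrable weak derivative of `f` on `(0, l)`. -/
def IsWeakDerivL2 (l : ℝ) (f g : ℝ → ℝ) : Prop :=
  MemLp g 2 (volume.restrict (Ioo 0 l)) ∧ IsWeakDeriv l f g

/-- The Sobolev space `H¹(0, l)`. -/
def MemH1Interval (l : ℝ) (f : ℝ → ℝ) : Prop :=
  MemLp f 2 (volume.restrict (Ioo 0 l)) ∧ ∃ g, IsWeakDerivL2 l f g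

open Classical in
/-- A weak derivative of `f` on `(0, l)` (unique almost everywhere if `f` is in `H¹(0, l)`). -/
def weakDeriv (l : ℝ) (f : ℝ → ℝ) : ℝ → ℝ :=
  if h : ∃ g, IsWeakDerivL2 l f g then h.choose else 0

/-- The soliton: the even positive `H¹` solution of `-U'' + U = U ^ p` on `ℝ`. -/
def soliton (p x : ℝ) : ℝ :=
  ((p + 1) / 2) ^ (1 / (p - 1)) * (Real.cosh ((p - 1) / 2 * x)) ^ (-(2 / (p - 1)))

open Classical in
/-- The rescaled soliton on the edge `e₁`, extended by `0` to the other edges. -/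
def rescaledSoliton {E : Type*} (p lam : ℝ) (e₁ e : E) (x : ℝ) : ℝ :=
  if e = e₁ then lam ^ (1 / (p - 1)) * soliton p (Real.sqrt lam * x) else 0

/-- The rescaled soliton multiplied by the function `χ` of the coordinate of `e₁`. -/
def cutoffSoliton {E : Type*} (p lam : ℝ) (χ : ℝ → ℝ) (e₁ e : E) (x : ℝ) : ℝ :=
  χ x * rescaledSoliton p lam e₁ e x

/-- `χ` is a smooth cut-off function on `[0, ∞)`, equal to `1` on `[0, l / 2]` and to `0` on
`[l, ∞)`. -/
structure IsCutoff (l : ℝ) (χ : ℝ → ℝ) : Prop where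
  smooth : ContDiff ℝ ∞ χ
  eq_one : ∀ x, 0 ≤ x → x ≤ l / 2 → χ x = 1
  eq_zero : ∀ x, l ≤ x → χ x = 0

namespace MetricGraph

variable {V E : Type*} (G : MetricGraph V E)

/-- The interval `[0, len e]` identified with the edge `e`. -/
def edge (e : E) : Set ℝ := Icc 0 (G.len e)

/-- The degree of a vertex: the number of edge ends at it (a loop counts twice). -/
def degree (v : V) : ℕ := {e | G.src e = v}.ncard + {e | G.tgt e = v}.ncard

/-- Any two vertices are joined by a path of edges. -/
def IsConnected : Prop :=
  (SimpleGraph.fromRel fun v w => ∃ e, G.src e = v ∧ G.tgt e = w).Connected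

/-- Continuous functions on the graph; a function on the graph is a family `u = (u e)`, of which
only the values on the intervals `[0, len e]` matter. -/
def IsContinuous (u : E → ℝ → ℝ) : Prop :=
  (∀ e, ContinuousOn (u e) (G.edge e)) ∧
    ∃ val : V → ℝ, ∀ e, u e 0 = val (G.src e) ∧ u e (G.len e) = val (G.tgt e)

/-- The Sobolev space `H¹` of the graph. -/
def MemH1 (u : E → ℝ → ℝ) : Prop :=
  G.IsContinuous u ∧ ∀ e, MemH1Interval (G.len e) (u e)

/-- The outgoing derivative of `u` along the edge `e` at its initial point. -/
def outDerivSrc (u : E → ℝ → ℝ) (e : E) : ℝ := derivWithin (u e) (G.edge e) 0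

/-- The outgoing derivative of `u` along the edge `e` at its final point. -/
def outDerivTgt (u : E → ℝ → ℝ) (e : E) : ℝ := -derivWithin (u e) (G.edge e) (G.len e)

variable [Fintype E]

/-- The `L²` norm on the graph. -/
def l2Norm (u : E → ℝ → ℝ) : ℝ :=
  Real.sqrt (∑ e, ∫ x in Ioo 0 (G.len e), u e x ^ 2)

/-- The norm `‖u‖_lam`, where `‖u‖_lam² = ∫ u'² + lam ∫ u²`. -/
def lamNorm (lam : ℝ) (u : E → ℝ → ℝ) : ℝ :=
  Real.sqrt ((∑ e, ∫ x in Ioo 0 (G.len e), weakDeriv (G.len e) (u e) x ^ 2) +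
    lam * ∑ e, ∫ x in Ioo 0 (G.len e), u e x ^ 2)

open Classical in
/-- The Kirchhoff condition at the vertex `v`. -/
def KirchhoffAt (u : E → ℝ → ℝ) (v : V) : Prop :=
  (∑ e with G.src e = v, G.outDerivSrc u e) + (∑ e with G.tgt e = v, G.outDerivTgt u e) = 0

/-- `u` is a positive (classical) solution of `-u'' + lam u = |u|^(p-1) u` on the graph, with
Kirchhoff conditions at all vertices and `L²` norm equal to `ρ`. -/
structure IsPositiveSolution (p lam ρ : ℝ) (u : E → ℝ → ℝ) : Prop where
  memH1 : G.MemH1 u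
  contDiffOn : ∀ e, ContDiffOn ℝ 2 (u e) (G.edge e)
  equation : ∀ e, ∀ x ∈ G.edge e,
    -iteratedDerivWithin 2 (u e) (G.edge e) x + lam * u e x = |u e x| ^ (p - 1) * u e x
  kirchhoff : ∀ v, G.KirchhoffAt u v
  l2Norm_eq : G.l2Norm u = ρ
  pos : ∀ e, ∀ x ∈ G.edge e, 0 < u e x

end MetricGraph

end

noncomputable section

open scoped Topology BoundedContinuousFunction

/-! Put `s = √lam` and `u(x) = lam ^ (1 / (p - 1)) * v(s x)`. The problem becomes `v'' = v - v ^ p`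
on the graph whose lengths are multiplied by `s`, so large `lam` means long edges. The function
equal to the soliton `U` on `e₁` and to `0` elsewhere solves this equation on every edge and
satisfies the Neumann condition at the pendant vertex, since `U'(0) = 0`. It violates the vertex
conditions only at the far end of `e₁`, by an amount of order `exp (-s * len e₁)`.

The correction comes from a contraction, without any Lyapunov-Schmidt reduction. On the half line
the bounded solutions of the equation linearised at `U` are the multiples of `U'`, and `U''(0) ≠ 0`
makes the Neumann condition exclude them. The linearised equation has explicit solutions: on `e₁` a
decaying one proportional to `U'` and a growing one with zero slope at `0`; on the other edges `exp
(-x)` and `exp x`. Variation of parameters turns the problem into a fixed-point equation for the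
amplitudes of these solutions and the correction itself. The Kirchhoff conditions determine the
vertex values, the two ends of an edge interact only through factors `exp (-length)`, and the
nonlinear remainder has a small Lipschitz constant near `0` (`exists_transmission_solution`,
`exists_solution_near_soliton`).

The nonlinearity is taken as `(max v 0) ^ p`, so a maximum principle gives `0 ≤ v`, and propagation
of zeros through the connected graph gives `0 < v`. Near the pendant vertex `v > 1`, hence `v'' < 0`
and `v` decreases from its zero slope; everywhere else closeness to `U` keeps `v` below its value at
that vertex (`exists_peak_threshold`). The error is exponentially small in `√lam`, which yields both
the estimate on `φ` and the mass asymptotics. -/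

/-! ### Explicit solutions of the equation linearised at the soliton. -/

/-- The growth profile `cosh (c x) ^ (1 / c)`, comparable to `exp |x|`. -/
def coshRoot (c x : ℝ) : ℝ := Real.cosh (c * x) ^ (1 / c)

/-- The primitive of `coshRoot c ^ 2` vanishing at `0`. -/
def coshRootInt (c x : ℝ) : ℝ := ∫ t in (0 : ℝ)..x, coshRoot c t ^ 2

theorem coshRoot_pos (c x : ℝ) : 0 < coshRoot c x :=
  Real.rpow_pos_of_pos (Real.cosh_pos _) _

theorem hasDerivAt_tanh_mul (c x : ℝ) :
    HasDerivAt (fun y => Real.tanh (c * y)) (c * (1 - Real.tanh (c * x) ^ 2)) x := by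
  have hlin : HasDerivAt (fun y : ℝ => c * y) c x := by
    simpa using (hasDerivAt_id x).const_mul c
  have hC := Real.cosh_pos (c * x)
  have h := (hlin.sinh).div hlin.cosh hC.ne'
  have heq : (fun y => Real.tanh (c * y)) = fun y => Real.sinh (c * y) / Real.cosh (c * y) := by
    funext y; exact Real.tanh_eq_sinh_div_cosh _
  rw [heq]
  refine h.congr_deriv ?_
  rw [Real.tanh_eq_sinh_div_cosh]
  field_simp

theorem hasDerivAt_coshRoot {c : ℝ} (hc : 0 < c) (x : ℝ) :
    HasDerivAt (coshRoot c) (Real.tanh (c * x) * coshRoot c x) x := by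
  have hlin : HasDerivAt (fun y : ℝ => c * y) c x := by
    simpa using (hasDerivAt_id x).const_mul c
  have hC := Real.cosh_pos (c * x)
  have h := hlin.cosh.rpow_const (p := 1 / c) (Or.inl hC.ne')
  refine h.congr_deriv ?_
  rw [Real.rpow_sub_one hC.ne', Real.tanh_eq_sinh_div_cosh]
  unfold coshRoot
  field_simp

theorem continuous_coshRoot {c : ℝ} (hc : 0 < c) : Continuous (coshRoot c) :=
  continuous_iff_continuousAt.2 fun x => (hasDerivAt_coshRoot hc x).continuousAt

theorem hasDerivAt_coshRootInt {c : ℝ} (hc : 0 < c) (x : ℝ) :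
    HasDerivAt (coshRootInt c) (coshRoot c x ^ 2) x :=
  ((continuous_coshRoot hc).pow 2).integral_hasStrictDerivAt 0 x |>.hasDerivAt

theorem coshRoot_le_exp {c : ℝ} (hc : 0 < c) {x : ℝ} (hx : 0 ≤ x) :
    coshRoot c x ≤ Real.exp x := by
  have hcx : 0 ≤ c * x := by positivity
  have h1 : Real.cosh (c * x) ≤ Real.exp (c * x) := by
    rw [Real.cosh_eq]
    have := Real.exp_le_exp.2 (show -(c * x) ≤ c * x by linarith)
    linarith
  calc coshRoot c x ≤ Real.exp (c * x) ^ (1 / c) :=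
        Real.rpow_le_rpow (Real.cosh_pos _).le h1 (by positivity)
    _ = Real.exp x := by
        rw [← Real.exp_mul]; congr 1; field_simp

theorem exp_le_coshRoot {c : ℝ} (hc : 0 < c) (x : ℝ) :
    Real.exp x ≤ 2 ^ (1 / c) * coshRoot c x := by
  have h1 : Real.exp (c * x) ≤ 2 * Real.cosh (c * x) := by
    rw [Real.cosh_eq]
    have := Real.exp_pos (-(c * x))
    linarith
  calc Real.exp x = Real.exp (c * x) ^ (1 / c) := by
        rw [← Real.exp_mul]; congr 1; field_simp
    _ ≤ (2 * Real.cosh (c * x)) ^ (1 / c) :=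
        Real.rpow_le_rpow (Real.exp_pos _).le h1 (by positivity)
    _ = _ := Real.mul_rpow (by norm_num) (Real.cosh_pos _).le

theorem one_sub_tanh_le (y : ℝ) : 1 - Real.tanh y ≤ 2 * Real.exp (-(2 * y)) := by
  rw [Real.tanh_eq]
  have h1 := Real.exp_pos y
  have h2 := Real.exp_pos (-y)
  have h3 : Real.exp (-(2 * y)) * Real.exp y = Real.exp (-y) := by
    rw [← Real.exp_add]; congr 1; ring
  have h4 := Real.exp_pos (-(2 * y))
  rw [sub_le_iff_le_add, ← sub_le_iff_le_add', le_div_iff₀ (by positivity)]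
  nlinarith [mul_pos h4 h2]

theorem abs_tanh_le_one (y : ℝ) : |Real.tanh y| ≤ 1 := (Real.abs_tanh_lt_one y).le

theorem coshRootInt_nonneg {c x : ℝ} (hx : 0 ≤ x) : 0 ≤ coshRootInt c x :=
  intervalIntegral.integral_nonneg hx fun _ _ => sq_nonneg _

theorem antitone_on_Ici_aux {f f' : ℝ → ℝ} (hf : ∀ x, HasDerivAt f (f' x) x)
    (hf' : ∀ x, 0 ≤ x → f' x ≤ 0) {x : ℝ} (hx : 0 ≤ x) : f x ≤ f 0 := by
  have : AntitoneOn f (Ici 0) := by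
    refine antitoneOn_of_deriv_nonpos (convex_Ici 0)
      (fun y _ => (hf y).continuousAt.continuousWithinAt)
      (fun y _ => (hf y).differentiableAt.differentiableWithinAt) fun y hy => ?_
    rw [interior_Ici] at hy
    rw [(hf y).deriv]
    exact hf' y (le_of_lt hy)
  exact this (by simp) hx hx

/-- The primitive of `coshRoot c ^ 2` is half of `coshRoot c ^ 2` up to lower order. -/
theorem abs_coshRootInt_sub_le {c : ℝ} (hc : 0 < c) :
    ∃ σ > 0, σ ≤ 1 ∧ ∀ x, 0 ≤ x →
      |coshRootInt c x - coshRoot c x ^ 2 / 2| ≤ 3 * Real.exp ((2 - σ) * x) := by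
  -- The difference has derivative `(1 - tanh (c x)) * coshRoot c x ^ 2`, of order `exp ((2 - 2 * c)
  -- * x)`. Capping `σ` at `1` keeps the exponent `2 - σ` at least `1`, so that `2 * exp ((2 - σ) *
  -- x)` grows fast enough to dominate for every `c`.
  refine ⟨min (2 * c) 1, by positivity, min_le_right _ _, fun x hx => ?_⟩
  set σ := min (2 * c) 1 with hσ
  have hσ1 : σ ≤ 1 := min_le_right _ _
  have hσ2 : σ ≤ 2 * c := min_le_left _ _
  have hD : ∀ x, HasDerivAt (fun x => coshRootInt c x - coshRoot c x ^ 2 / 2)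
      ((1 - Real.tanh (c * x)) * coshRoot c x ^ 2) x := fun x => by
    refine ((hasDerivAt_coshRootInt hc x).sub
      (((hasDerivAt_coshRoot hc x).pow 2).div_const 2)).congr_deriv ?_
    simp; ring
  have h0 : coshRootInt c 0 - coshRoot c 0 ^ 2 / 2 = -1 / 2 := by
    simp [coshRootInt, coshRoot]; norm_num
  have hlow := antitone_on_Ici_aux (fun x => (hD x).neg) (fun x _ => by
    have := (Real.tanh_lt_one (c * x)).le
    nlinarith [sq_nonneg (coshRoot c x)]) hx
  have hE : ∀ x, HasDerivAt (fun x => 2 * Real.exp ((2 - σ) * x))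
      (2 * (Real.exp ((2 - σ) * x) * (2 - σ))) x := fun x => by
    have : HasDerivAt (fun y : ℝ => (2 - σ) * y) (2 - σ) x := by
      simpa using (hasDerivAt_id x).const_mul (2 - σ)
    exact this.exp.const_mul 2
  have hup := antitone_on_Ici_aux (fun x => (hD x).sub (hE x)) (fun x hx => by
    have h1 := one_sub_tanh_le (c * x)
    have h2 := coshRoot_le_exp hc hx
    have h3 := coshRoot_pos c x
    have h4 : coshRoot c x ^ 2 ≤ Real.exp (2 * x) := by
      have : Real.exp (2 * x) = Real.exp x ^ 2 := by rw [← Real.exp_nat_mul]; norm_num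
      rw [this]; gcongr
    have h5 : (1 - Real.tanh (c * x)) * coshRoot c x ^ 2
        ≤ 2 * Real.exp (-(2 * (c * x))) * Real.exp (2 * x) :=
      mul_le_mul h1 h4 (by positivity) (by positivity)
    have h6 : Real.exp (-(2 * (c * x))) * Real.exp (2 * x) ≤ Real.exp ((2 - σ) * x) := by
      rw [← Real.exp_add]; apply Real.exp_le_exp.2
      nlinarith
    have h7 := Real.exp_pos ((2 - σ) * x)
    nlinarith) hx
  simp only [Pi.sub_apply, Pi.neg_apply, h0, mul_zero, Real.exp_zero] at hlow hup
  have h8 : 1 ≤ Real.exp ((2 - σ) * x) := Real.one_le_exp (by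
    have : 0 ≤ 2 - σ := by linarith
    positivity)
  rw [abs_le]; constructor <;> linarith

/-- The decaying solution of the equation linearised at the soliton. -/
def decaySol (c x : ℝ) : ℝ := Real.tanh (c * x) / coshRoot c x

/-- The derivative of `decaySol`. -/
def decaySolDeriv (c x : ℝ) : ℝ := (c - (c + 1) * Real.tanh (c * x) ^ 2) / coshRoot c x

/-- The growing solution, with zero slope at `0`, of the equation linearised at the soliton. -/
def growSol (c x : ℝ) : ℝ := (c + 2) * decaySol c x * coshRootInt c x - coshRoot c x

/-- The derivative of `growSol`. -/
def growSolDeriv (c x : ℝ) : ℝ :=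
  (c + 2) * decaySolDeriv c x * coshRootInt c x + (c + 1) * Real.tanh (c * x) * coshRoot c x

/-- The potential of the equation linearised at the soliton. -/
def solitonPotential (c x : ℝ) : ℝ := 1 - (2 * c + 1) * (c + 1) * (1 - Real.tanh (c * x) ^ 2)

theorem hasDerivAt_decaySol {c : ℝ} (hc : 0 < c) (x : ℝ) :
    HasDerivAt (decaySol c) (decaySolDeriv c x) x := by
  have hR := (coshRoot_pos c x).ne'
  refine ((hasDerivAt_tanh_mul c x).div (hasDerivAt_coshRoot hc x) hR).congr_deriv ?_
  unfold decaySolDeriv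
  field_simp
  ring

/-- Translation invariance: `decaySol` is a constant multiple of the derivative of the soliton,
which solves the linearised equation. -/
theorem hasDerivAt_decaySolDeriv {c : ℝ} (hc : 0 < c) (x : ℝ) :
    HasDerivAt (decaySolDeriv c) (solitonPotential c x * decaySol c x) x := by
  have hR := (coshRoot_pos c x).ne'
  refine (((((hasDerivAt_tanh_mul c x).pow 2).const_mul (c + 1)).const_sub c).div
    (hasDerivAt_coshRoot hc x) hR).congr_deriv ?_
  unfold solitonPotential decaySol
  field_simp
  simp
  ring

theorem hasDerivAt_growSol {c : ℝ} (hc : 0 < c) (x : ℝ) :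
    HasDerivAt (growSol c) (growSolDeriv c x) x := by
  have hR := (coshRoot_pos c x).ne'
  refine ((((hasDerivAt_decaySol hc x).const_mul (c + 2)).mul
    (hasDerivAt_coshRootInt hc x)).sub (hasDerivAt_coshRoot hc x)).congr_deriv ?_
  unfold growSolDeriv decaySol
  field_simp
  ring

/-- Reduction of order gives the second solution `c P ∫ P⁻²` with `P = decaySol c`, but `P` vanishes
at `0`. Integrating by parts through `(coth (c x) * R ^ 2)' = (c + 2) * R ^ 2 - c * coth (c x) ^ 2 *
R ^ 2`, where `R = coshRoot c`, removes the pole and leaves the formula of `growSol`. The factor `c`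
is the Wronskian. -/
theorem hasDerivAt_growSolDeriv {c : ℝ} (hc : 0 < c) (x : ℝ) :
    HasDerivAt (growSolDeriv c) (solitonPotential c x * growSol c x) x := by
  have hR := (coshRoot_pos c x).ne'
  refine ((((hasDerivAt_decaySolDeriv hc x).const_mul (c + 2)).mul
    (hasDerivAt_coshRootInt hc x)).add (((hasDerivAt_tanh_mul c x).const_mul (c + 1)).mul
    (hasDerivAt_coshRoot hc x))).congr_deriv ?_
  unfold growSol solitonPotential decaySol decaySolDeriv
  field_simp
  ring

theorem growSol_wronskian {c : ℝ} (x : ℝ) :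
    growSolDeriv c x * decaySol c x - growSol c x * decaySolDeriv c x = c := by
  have hR := (coshRoot_pos c x).ne'
  unfold growSol growSolDeriv decaySol decaySolDeriv
  field_simp
  ring

theorem abs_decaySol_le {c : ℝ} (hc : 0 < c) (x : ℝ) :
    |decaySol c x| ≤ 2 ^ (1 / c) * Real.exp (-x) := by
  have hR := coshRoot_pos c x
  rw [decaySol, abs_div, abs_of_pos hR, div_le_iff₀ hR, Real.exp_neg]
  have h1 := exp_le_coshRoot hc x
  have h2 := abs_tanh_le_one (c * x)
  have h3 := Real.exp_pos x
  calc |Real.tanh (c * x)| ≤ 1 := h2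
    _ ≤ 2 ^ (1 / c) * coshRoot c x / Real.exp x := by rwa [one_le_div h3]
    _ = _ := by ring

theorem abs_decaySolDeriv_le {c : ℝ} (hc : 0 < c) (x : ℝ) :
    |decaySolDeriv c x| ≤ (c + 1) * 2 ^ (1 / c) * Real.exp (-x) := by
  have hR := coshRoot_pos c x
  rw [decaySolDeriv, abs_div, abs_of_pos hR, div_le_iff₀ hR, Real.exp_neg]
  have h1 := exp_le_coshRoot hc x
  have h2 := (Real.tanh_sq_lt_one (c * x)).le
  have h2' := sq_nonneg (Real.tanh (c * x))
  have h3 := Real.exp_pos x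
  calc |c - (c + 1) * Real.tanh (c * x) ^ 2| ≤ (c + 1) * 1 := by
        rw [abs_le]; constructor <;> nlinarith
    _ ≤ (c + 1) * (2 ^ (1 / c) * coshRoot c x / Real.exp x) := by
        gcongr; rwa [one_le_div h3]
    _ = _ := by ring

theorem coshRootInt_le {c : ℝ} (hc : 0 < c) {x : ℝ} (hx : 0 ≤ x) :
    coshRootInt c x ≤ 4 * Real.exp (2 * x) := by
  obtain ⟨σ, hσ, -, h⟩ := abs_coshRootInt_sub_le hc
  have h1 := (abs_le.1 (h x hx)).2
  have h2 := coshRoot_le_exp hc hx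
  have h3 := coshRoot_pos c x
  have h4 : coshRoot c x ^ 2 ≤ Real.exp (2 * x) := by
    have : Real.exp (2 * x) = Real.exp x ^ 2 := by rw [← Real.exp_nat_mul]; norm_num
    rw [this]; gcongr
  have h5 : Real.exp ((2 - σ) * x) ≤ Real.exp (2 * x) := Real.exp_le_exp.2 (by nlinarith)
  linarith [Real.exp_pos (2 * x)]

theorem exists_growSol_bounds {c : ℝ} (hc : 0 < c) :
    ∃ K > 0, ∀ x, 0 ≤ x → |growSol c x| ≤ K * Real.exp x ∧ |growSolDeriv c x| ≤ K * Real.exp x := by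
  refine ⟨(c + 2) * ((c + 1) * 2 ^ (1 / c)) * 4 + (c + 1), by positivity, fun x hx => ?_⟩
  have hJ := coshRootInt_le hc hx
  have hJ0 := coshRootInt_nonneg (c := c) hx
  have hR := coshRoot_le_exp hc hx
  have hR0 := coshRoot_pos c x
  have hE : Real.exp (-x) * Real.exp (2 * x) = Real.exp x := by
    rw [← Real.exp_add]; congr 1; ring
  have key : ∀ y, |y| ≤ (c + 1) * 2 ^ (1 / c) * Real.exp (-x) →
      |(c + 2) * y * coshRootInt c x| ≤ (c + 2) * ((c + 1) * 2 ^ (1 / c)) * 4 * Real.exp x := by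
    intro y hy
    rw [abs_mul, abs_mul, abs_of_pos (by linarith : 0 < c + 2), abs_of_nonneg hJ0]
    calc (c + 2) * |y| * coshRootInt c x
        ≤ (c + 2) * ((c + 1) * 2 ^ (1 / c) * Real.exp (-x)) * (4 * Real.exp (2 * x)) := by gcongr
      _ = (c + 2) * ((c + 1) * 2 ^ (1 / c)) * 4 * (Real.exp (-x) * Real.exp (2 * x)) := by ring
      _ = _ := by rw [hE]
  have hP : |decaySol c x| ≤ (c + 1) * 2 ^ (1 / c) * Real.exp (-x) := by
    refine (abs_decaySol_le hc x).trans ?_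
    have : (0 : ℝ) ≤ 2 ^ (1 / c) * Real.exp (-x) := by positivity
    nlinarith
  constructor
  · rw [growSol]
    refine (abs_sub _ _).trans ?_
    have := key _ hP
    rw [abs_of_pos hR0]
    nlinarith [Real.exp_pos x]
  · rw [growSolDeriv]
    refine (abs_add_le _ _).trans ?_
    have := key _ (abs_decaySolDeriv_le hc x)
    have h2 : |(c + 1) * Real.tanh (c * x) * coshRoot c x| ≤ (c + 1) * Real.exp x := by
      rw [abs_mul, abs_mul, abs_of_pos hR0, abs_of_pos (by linarith : 0 < c + 1)]
      calc _ ≤ (c + 1) * 1 * Real.exp x := by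
            gcongr; exact abs_tanh_le_one _
        _ = _ := by ring
    linarith

theorem tendsto_coshRootInt_div {c : ℝ} (hc : 0 < c) :
    Tendsto (fun x => coshRootInt c x / coshRoot c x ^ 2) atTop (𝓝 (1 / 2)) := by
  obtain ⟨σ, hσ, -, h⟩ := abs_coshRootInt_sub_le hc
  have hlim : Tendsto (fun x : ℝ => 3 * (2 ^ (1 / c)) ^ 2 * Real.exp (-(σ * x))) atTop (𝓝 0) := by
    have : Tendsto (fun x : ℝ => Real.exp (-(σ * x))) atTop (𝓝 0) :=
      Real.tendsto_exp_neg_atTop_nhds_zero.comp (tendsto_id.const_mul_atTop hσ)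
    simpa using this.const_mul (3 * (2 ^ (1 / c) : ℝ) ^ 2)
  rw [tendsto_iff_dist_tendsto_zero]
  refine squeeze_zero' (Eventually.of_forall fun _ => dist_nonneg) ?_ hlim
  filter_upwards [eventually_ge_atTop 0] with x hx
  have hR := coshRoot_pos c x
  rw [Real.dist_eq]
  have e1 : coshRootInt c x / coshRoot c x ^ 2 - 1 / 2
      = (coshRootInt c x - coshRoot c x ^ 2 / 2) / coshRoot c x ^ 2 := by field_simp
  rw [e1, abs_div, abs_of_pos (by positivity : 0 < coshRoot c x ^ 2), div_le_iff₀ (by positivity)]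
  refine (h x hx).trans ?_
  have h1 := exp_le_coshRoot hc x
  have h2 : Real.exp x ^ 2 ≤ (2 ^ (1 / c) * coshRoot c x) ^ 2 := by
    have := Real.exp_pos x
    gcongr
  have e2 : Real.exp ((2 - σ) * x) = Real.exp (-(σ * x)) * Real.exp x ^ 2 := by
    rw [← Real.exp_nat_mul, ← Real.exp_add]; congr 1; push_cast; ring
  rw [e2]
  calc 3 * (Real.exp (-(σ * x)) * Real.exp x ^ 2)
      ≤ 3 * (Real.exp (-(σ * x)) * (2 ^ (1 / c) * coshRoot c x) ^ 2) := by gcongr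
    _ = _ := by ring

theorem tendsto_tanh_mul {c : ℝ} (hc : 0 < c) :
    Tendsto (fun x => Real.tanh (c * x)) atTop (𝓝 1) := by
  have hlim : Tendsto (fun x : ℝ => 1 - 2 * Real.exp (-(2 * (c * x)))) atTop (𝓝 1) := by
    have : Tendsto (fun x : ℝ => Real.exp (-(2 * (c * x)))) atTop (𝓝 0) :=
      Real.tendsto_exp_neg_atTop_nhds_zero.comp
        ((tendsto_id.const_mul_atTop hc).const_mul_atTop two_pos)
    simpa using (this.const_mul 2).const_sub 1
  refine tendsto_of_tendsto_of_tendsto_of_le_of_le hlim tendsto_const_nhds (fun x => ?_)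
    fun x => (Real.tanh_lt_one _).le
  have := one_sub_tanh_le (c * x)
  simp only
  linarith

/-- The two terms of `growSol` are both of order `coshRoot`; their coefficients `(c + 2) / 2` and
`1` do not cancel. The positive limit, shared with `growSolDeriv`, makes the growing solution and
its slope positive and comparable to `exp x` far out. -/
theorem tendsto_growSol_div {c : ℝ} (hc : 0 < c) :
    Tendsto (fun x => growSol c x / coshRoot c x) atTop (𝓝 (c / 2)) := by
  have h := (((tendsto_tanh_mul hc).mul (tendsto_coshRootInt_div hc)).const_mul (c + 2)).sub_const 1
  have e : (c + 2) * (1 * (1 / 2)) - 1 = c / 2 := by ring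
  rw [e] at h
  refine h.congr fun x => ?_
  have hR := (coshRoot_pos c x).ne'
  unfold growSol decaySol
  field_simp

theorem tendsto_growSolDeriv_div {c : ℝ} (hc : 0 < c) :
    Tendsto (fun x => growSolDeriv c x / coshRoot c x) atTop (𝓝 (c / 2)) := by
  have h := (((((tendsto_tanh_mul hc).pow 2).const_mul (c + 1)).const_sub c).mul
    (tendsto_coshRootInt_div hc)).const_mul (c + 2) |>.add
    ((tendsto_tanh_mul hc).const_mul (c + 1))
  have e : (c + 2) * ((c - (c + 1) * 1 ^ 2) * (1 / 2)) + (c + 1) * 1 = c / 2 := by ring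
  rw [e] at h
  refine h.congr fun x => ?_
  have hR := (coshRoot_pos c x).ne'
  unfold growSolDeriv decaySolDeriv
  field_simp

/-- This is the nondegeneracy of the half-line problem: the growing solution already meets the
Neumann condition, so that condition only forces the amplitude of `decaySol` to vanish. -/
theorem growSolDeriv_zero (c : ℝ) : growSolDeriv c 0 = 0 := by
  simp [growSolDeriv, coshRootInt]

/-! ### The soliton -/

theorem soliton_eq (p x : ℝ) : soliton p x =
    ((p + 1) / 2) ^ (1 / (p - 1)) / coshRoot ((p - 1) / 2) x := by
  unfold soliton coshRoot
  rw [Real.rpow_neg (Real.cosh_pos _).le, one_div_div]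
  rfl

/-- The derivative of the soliton. -/
def solitonDeriv (p x : ℝ) : ℝ := -(Real.tanh ((p - 1) / 2 * x) * soliton p x)

theorem soliton_pos {p : ℝ} (hp : 1 < p) (x : ℝ) : 0 < soliton p x := by
  rw [soliton_eq]
  exact div_pos (Real.rpow_pos_of_pos (by linarith) _) (coshRoot_pos _ _)

theorem soliton_rpow {p : ℝ} (hp : 1 < p) (x : ℝ) :
    soliton p x ^ (p - 1) = (p + 1) / 2 * (1 - Real.tanh ((p - 1) / 2 * x) ^ 2) := by
  have hC := Real.cosh_pos ((p - 1) / 2 * x)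
  have hp1 : p - 1 ≠ 0 := by linarith
  unfold soliton
  rw [Real.mul_rpow (Real.rpow_nonneg (by linarith) _) (Real.rpow_nonneg hC.le _),
    ← Real.rpow_mul (by linarith), ← Real.rpow_mul hC.le]
  have e1 : 1 / (p - 1) * (p - 1) = 1 := by field_simp
  have e2 : -(2 / (p - 1)) * (p - 1) = -2 := by field_simp
  rw [e1, e2, Real.rpow_one]
  congr 1
  rw [Real.rpow_neg hC.le, Real.rpow_two, Real.tanh_eq_sinh_div_cosh]
  have := Real.cosh_sq ((p - 1) / 2 * x)
  generalize (p - 1) / 2 * x = y at *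
  field_simp
  linarith

theorem hasDerivAt_soliton {p : ℝ} (hp : 1 < p) (x : ℝ) :
    HasDerivAt (soliton p) (solitonDeriv p x) x := by
  have hc : 0 < (p - 1) / 2 := by linarith
  have hR := (coshRoot_pos ((p - 1) / 2) x).ne'
  have h := ((hasDerivAt_coshRoot hc x).inv hR).const_mul (((p + 1) / 2) ^ (1 / (p - 1)))
  have heq : soliton p = fun x => ((p + 1) / 2) ^ (1 / (p - 1)) * (coshRoot ((p - 1) / 2) x)⁻¹ := by
    funext y; rw [soliton_eq, div_eq_mul_inv]
  rw [solitonDeriv, heq]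
  refine h.congr_deriv ?_
  field_simp

theorem hasDerivAt_solitonDeriv {p : ℝ} (hp : 1 < p) (x : ℝ) :
    HasDerivAt (solitonDeriv p) (soliton p x - soliton p x ^ p) x := by
  refine (((hasDerivAt_tanh_mul ((p - 1) / 2) x).mul (hasDerivAt_soliton hp x)).neg).congr_deriv ?_
  have h : soliton p x ^ p = soliton p x ^ (p - 1) * soliton p x := by
    rw [Real.rpow_sub_one (soliton_pos hp x).ne']
    field_simp [(soliton_pos hp x).ne']
  rw [h, soliton_rpow hp, solitonDeriv]
  ring

theorem solitonDeriv_zero (p : ℝ) : solitonDeriv p 0 = 0 := by simp [solitonDeriv]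

theorem continuous_soliton {p : ℝ} (hp : 1 < p) : Continuous (soliton p) :=
  continuous_iff_continuousAt.2 fun x => (hasDerivAt_soliton hp x).continuousAt

theorem solitonPotential_eq {p : ℝ} (hp : 1 < p) (x : ℝ) :
    solitonPotential ((p - 1) / 2) x = 1 - p * soliton p x ^ (p - 1) := by
  rw [soliton_rpow hp, solitonPotential]; ring

theorem exists_soliton_bound {p : ℝ} (hp : 1 < p) :
    ∃ K > 0, ∀ x, soliton p x ≤ K * Real.exp (-x) ∧ |solitonDeriv p x| ≤ K * Real.exp (-x) := by
  have hc : 0 < (p - 1) / 2 := by linarith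
  have hA : 0 < ((p + 1) / 2) ^ (1 / (p - 1)) := Real.rpow_pos_of_pos (by linarith) _
  refine ⟨((p + 1) / 2) ^ (1 / (p - 1)) * 2 ^ (1 / ((p - 1) / 2)), by positivity, fun x => ?_⟩
  have h1 : soliton p x ≤ ((p + 1) / 2) ^ (1 / (p - 1)) * 2 ^ (1 / ((p - 1) / 2)) *
      Real.exp (-x) := by
    rw [soliton_eq, mul_assoc, div_eq_mul_inv, Real.exp_neg]
    gcongr
    rw [inv_le_iff_one_le_mul₀ (coshRoot_pos _ _)]
    have := exp_le_coshRoot hc x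
    have h3 := Real.exp_pos x
    calc 1 ≤ 2 ^ (1 / ((p - 1) / 2)) * coshRoot ((p - 1) / 2) x / Real.exp x := by
          rwa [one_le_div h3]
      _ = _ := by ring
  refine ⟨h1, ?_⟩
  rw [solitonDeriv, abs_neg, abs_mul, abs_of_pos (soliton_pos hp x)]
  refine le_trans ?_ h1
  exact mul_le_of_le_one_left (soliton_pos hp x).le (abs_tanh_le_one _)

theorem soliton_strictAntiOn {p : ℝ} (hp : 1 < p) : StrictAntiOn (soliton p) (Ici 0) := by
  refine strictAntiOn_of_deriv_neg (convex_Ici 0) (continuous_soliton hp).continuousOn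
    fun y hy => ?_
  rw [interior_Ici] at hy
  rw [(hasDerivAt_soliton hp y).deriv, solitonDeriv, neg_lt_zero]
  have : 0 < Real.tanh ((p - 1) / 2 * y) := by
    rw [Real.tanh_eq_sinh_div_cosh]
    have : 0 < (p - 1) / 2 * y := mul_pos (by linarith) hy
    exact div_pos (Real.sinh_pos_iff.2 this) (Real.cosh_pos _)
  exact mul_pos this (soliton_pos hp y)

theorem soliton_le_soliton_zero {p : ℝ} (hp : 1 < p) (x : ℝ) : soliton p x ≤ soliton p 0 := by
  unfold soliton
  rw [mul_zero, Real.cosh_zero, Real.one_rpow]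
  have : 0 ≤ 2 / (p - 1) := div_nonneg two_pos.le (by linarith)
  have h := Real.rpow_le_one_of_one_le_of_nonpos (Real.one_le_cosh ((p - 1) / 2 * x))
    (neg_nonpos.2 this)
  gcongr

/-- Above the level `1` the equation gives concavity, since `t - t ^ p < 0` for `t > 1`; this
governs the shape of the peak. -/
theorem one_lt_soliton_zero {p : ℝ} (hp : 1 < p) : 1 < soliton p 0 := by
  simp only [soliton, mul_zero, Real.cosh_zero, Real.one_rpow, mul_one]
  exact Real.one_lt_rpow (by linarith) (by simp; linarith)

/-! ### The nonlinearity -/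

theorem hasDerivAt_posPart_rpow {p : ℝ} (hp : 1 < p) (x : ℝ) :
    HasDerivAt (fun y : ℝ => max y 0 ^ p) (p * max x 0 ^ (p - 1)) x := by
  have hp0 : p ≠ 0 := by linarith
  have hp1 : p - 1 ≠ 0 := by linarith
  rcases lt_trichotomy x 0 with hx | hx | hx
  · rw [max_eq_right hx.le, Real.zero_rpow hp1, mul_zero]
    refine (hasDerivAt_const x (0 : ℝ)).congr_of_eventuallyEq ?_
    filter_upwards [eventually_lt_nhds hx] with y hy
    rw [max_eq_right hy.le, Real.zero_rpow hp0]
  · subst hx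
    rw [max_self, Real.zero_rpow hp1, mul_zero]
    have h1 : HasDerivWithinAt (fun y : ℝ => max y 0 ^ p) 0 (Ici 0) 0 := by
      have := (Real.hasDerivAt_rpow_const (x := 0) (p := p) (Or.inr hp.le)).hasDerivWithinAt
        (s := Ici 0)
      rw [Real.zero_rpow hp1, mul_zero] at this
      exact this.congr (fun y hy => by rw [max_eq_left hy]) (by simp)
    have h2 : HasDerivWithinAt (fun y : ℝ => max y 0 ^ p) 0 (Iic 0) 0 :=
      (hasDerivWithinAt_const (0 : ℝ) (Iic 0) (0 : ℝ)).congr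
        (fun y hy => by rw [max_eq_right hy, Real.zero_rpow hp0])
        (by rw [max_self, Real.zero_rpow hp0])
    have := h1.union h2
    rwa [Ici_union_Iic, hasDerivWithinAt_univ] at this
  · rw [max_eq_left hx.le]
    refine (Real.hasDerivAt_rpow_const (Or.inl hx.ne')).congr_of_eventuallyEq ?_
    filter_upwards [eventually_gt_nhds hx] with y hy
    rw [max_eq_left hy.le]

/-- The superlinear remainder of `y ↦ (max y 0) ^ p` at `b`. -/
def powRemainder (p b t : ℝ) : ℝ := max (b + t) 0 ^ p - b ^ p - p * b ^ (p - 1) * t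

theorem powRemainder_zero {p b : ℝ} (hb : 0 ≤ b) : powRemainder p b 0 = 0 := by
  simp [powRemainder, max_eq_left hb]

/-- The remainder has a small Lipschitz constant near `0`, uniformly for `b` in a bounded set. -/
theorem exists_powRemainder_lipschitz {p : ℝ} (hp : 1 < p) (A : ℝ) {ε : ℝ} (hε : 0 < ε) :
    ∃ δ > 0, ∀ b, 0 ≤ b → b ≤ A → ∀ s ∈ Icc (-δ) δ, ∀ t ∈ Icc (-δ) δ,
      |powRemainder p b s - powRemainder p b t| ≤ ε * |s - t| := by
  -- For `p < 2` the second derivative of the power is unbounded near `0`. Uniform continuity of its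
  -- first derivative is enough, as only a small Lipschitz constant is needed and no quadratic
  -- bound.
  have hcont : Continuous fun x : ℝ => max x 0 ^ (p - 1) :=
    (continuous_id.max continuous_const).rpow_const fun _ => Or.inr (by linarith)
  have huc := (isCompact_Icc (a := (-1 : ℝ)) (b := A + 1)).uniformContinuousOn_of_continuous
    hcont.continuousOn
  rw [Metric.uniformContinuousOn_iff] at huc
  obtain ⟨η, hη, h⟩ := huc (ε / p) (div_pos hε (by linarith))
  refine ⟨min (η / 2) 1, by positivity, fun b hb hbA s hs t ht => ?_⟩
  have hd : ∀ y, HasDerivAt (powRemainder p b)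
      (p * max (b + y) 0 ^ (p - 1) - p * b ^ (p - 1)) y := fun y => by
    have h1 := (hasDerivAt_posPart_rpow hp (b + y)).comp y ((hasDerivAt_id y).const_add b)
    refine ((h1.sub_const (b ^ p)).sub
      ((hasDerivAt_id y).const_mul (p * b ^ (p - 1)))).congr_deriv ?_
    simp
  have := (convex_Icc (-(min (η / 2) 1)) (min (η / 2) 1)).norm_image_sub_le_of_norm_hasDerivWithin_le
    (f := powRemainder p b) (C := ε) (fun y _ => (hd y).hasDerivWithinAt) (fun y hy => ?_) ht hs
  · simpa using this
  · have hy1 : |y| ≤ η / 2 := (abs_le.2 hy).trans (min_le_left _ _)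
    have hy2 : |y| ≤ 1 := (abs_le.2 hy).trans (min_le_right _ _)
    have hy3 := abs_le.1 hy2
    have := h (b + y) ⟨by linarith, by linarith⟩ b ⟨by linarith, by linarith⟩ (by
      rw [Real.dist_eq]; simp; linarith)
    rw [Real.dist_eq, max_eq_left hb] at this
    rw [← mul_sub, Real.norm_eq_abs, abs_mul, abs_of_pos (by linarith : 0 < p)]
    have hp0 : 0 < p := by linarith
    rw [lt_div_iff₀ hp0] at this
    linarith

theorem continuous_powRemainder {X : Type*} [TopologicalSpace X] {p : ℝ} (hp : 1 < p)
    {b t : X → ℝ} (hb : Continuous b) (ht : Continuous t) :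
    Continuous fun x => powRemainder p (b x) (t x) := by
  have h1 : Continuous fun x => max (b x + t x) 0 ^ p :=
    ((hb.add ht).max continuous_const).rpow_const fun _ => Or.inr (by linarith)
  have h2 : Continuous fun x => b x ^ p := hb.rpow_const fun _ => Or.inr (by linarith)
  have h3 : Continuous fun x => b x ^ (p - 1) := hb.rpow_const fun _ => Or.inr (by linarith)
  exact (h1.sub h2).sub ((continuous_const.mul h3).mul ht)

/-- Truncation of a real number to `[-δ, δ]`. -/
def truncate (δ t : ℝ) : ℝ := max (-δ) (min δ t)

theorem truncate_mem {δ : ℝ} (hδ : 0 ≤ δ) (t : ℝ) : truncate δ t ∈ Icc (-δ) δ :=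
  ⟨le_max_left _ _, max_le (by linarith) (min_le_left _ _)⟩

theorem truncate_eq {δ t : ℝ} (ht : |t| ≤ δ) : truncate δ t = t := by
  rw [truncate, min_eq_right (abs_le.1 ht).2, max_eq_right (abs_le.1 ht).1]

theorem abs_truncate_sub_le (δ s t : ℝ) : |truncate δ s - truncate δ t| ≤ |s - t| := by
  unfold truncate
  have h1 := abs_max_sub_max_le_abs (min δ s) (min δ t) (-δ)
  have h2 := abs_min_sub_min_le_max δ s δ t
  rw [max_comm (-δ), max_comm (-δ)]
  refine h1.trans (h2.trans ?_)
  simp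

theorem continuous_truncate (δ : ℝ) : Continuous (truncate δ) :=
  continuous_const.max (continuous_const.min continuous_id)

/-! ### Fundamental systems of linear second order equations -/

/-- A pair of solutions `P` (decaying) and `Q` (growing) of `z'' = q z` with constant
Wronskian `w` and exponential bounds with constant `K`. -/
structure FundamentalSystem (K L₀ : ℝ) where
  q : ℝ → ℝ
  P : ℝ → ℝ
  P' : ℝ → ℝ
  Q : ℝ → ℝ
  Q' : ℝ → ℝ
  w : ℝ
  continuous_q : Continuous q
  hasDerivAt_P : ∀ x, HasDerivAt P (P' x) x
  hasDerivAt_P' : ∀ x, HasDerivAt P' (q x * P x) x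
  hasDerivAt_Q : ∀ x, HasDerivAt Q (Q' x) x
  hasDerivAt_Q' : ∀ x, HasDerivAt Q' (q x * Q x) x
  wronskian : ∀ x, Q' x * P x - Q x * P' x = w
  w_pos : 0 < w
  inv_w_le : w⁻¹ ≤ K
  abs_P_le : ∀ x, 0 ≤ x → |P x| ≤ K * Real.exp (-x)
  abs_P'_le : ∀ x, 0 ≤ x → |P' x| ≤ K * Real.exp (-x)
  abs_Q_le : ∀ x, 0 ≤ x → |Q x| ≤ K * Real.exp x
  abs_Q'_le : ∀ x, 0 ≤ x → |Q' x| ≤ K * Real.exp x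
  exp_le_Q : ∀ x, L₀ ≤ x → Real.exp x ≤ K * Q x
  Q_le_Q' : ∀ x, L₀ ≤ x → Q x ≤ K * Q' x

/-- The fundamental system `exp (-x)`, `exp x` of `z'' = z`. -/
def expSystem {K : ℝ} (hK : 1 ≤ K) (L₀ : ℝ) : FundamentalSystem K L₀ where
  q _ := 1
  P x := Real.exp (-x)
  P' x := -Real.exp (-x)
  Q x := Real.exp x
  Q' x := Real.exp x
  w := 2
  continuous_q := continuous_const
  hasDerivAt_P x := by simpa using (hasDerivAt_id x).neg.exp
  hasDerivAt_P' x := by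
    have h := (hasDerivAt_id x).fun_neg.exp.fun_neg
    simpa using h
  hasDerivAt_Q x := Real.hasDerivAt_exp x
  hasDerivAt_Q' x := by simpa using Real.hasDerivAt_exp x
  wronskian x := by
    have : Real.exp x * Real.exp (-x) = 1 := by rw [← Real.exp_add]; simp
    linarith
  w_pos := two_pos
  inv_w_le := by norm_num; linarith
  abs_P_le x _ := by
    rw [abs_of_pos (Real.exp_pos _)]; nlinarith [Real.exp_pos (-x)]
  abs_P'_le x _ := by
    rw [abs_neg, abs_of_pos (Real.exp_pos _)]; nlinarith [Real.exp_pos (-x)]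
  abs_Q_le x _ := by
    rw [abs_of_pos (Real.exp_pos _)]; nlinarith [Real.exp_pos x]
  abs_Q'_le x _ := by
    rw [abs_of_pos (Real.exp_pos _)]; nlinarith [Real.exp_pos x]
  exp_le_Q x _ := by nlinarith [Real.exp_pos x]
  Q_le_Q' x _ := by nlinarith [Real.exp_pos x]

/-- The equation linearised at the soliton has a fundamental system whose growing solution has
zero slope at `0`. -/
theorem exists_solitonSystem {c : ℝ} (hc : 0 < c) : ∃ K₀ L₀ : ℝ, ∀ K, K₀ ≤ K →
    ∃ D : FundamentalSystem K L₀, D.q = solitonPotential c ∧ D.Q' 0 = 0 := by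
  obtain ⟨K₁, hK₁, hQ⟩ := exists_growSol_bounds hc
  have h1 := (tendsto_growSol_div hc).eventually (Ioo_mem_nhds
    (show c / 4 < c / 2 by linarith) (show c / 2 < c by linarith))
  have h2 := (tendsto_growSolDeriv_div hc).eventually (lt_mem_nhds
    (show c / 4 < c / 2 by linarith))
  obtain ⟨L₀, hL₀⟩ := eventually_atTop.1 (h1.and h2)
  set M := (c + 1) * (2 : ℝ) ^ (1 / c) with hM
  have hM0 : (0 : ℝ) < 2 ^ (1 / c) := by positivity
  have hMle : (2 : ℝ) ^ (1 / c) ≤ M := by nlinarith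
  -- Each summand pays for one field: `K₁` for the growing solution, `M` for the decaying one, `c⁻¹`
  -- for the Wronskian, the next for `exp_le_Q`. The `4` serves `Q_le_Q'`: beyond `L₀` one has `Q <
  -- c * R` and `Q' > c / 4 * R`, where `R = coshRoot c`.
  refine ⟨K₁ + M + c⁻¹ + 4 / c * 2 ^ (1 / c) + 4, L₀, fun K hK => ?_⟩
  have hci : 0 < c⁻¹ := inv_pos.2 hc
  have hci' : 0 < 4 / c * 2 ^ (1 / c) := by positivity
  have hKM : M ≤ K := by linarith
  have hKK : K₁ ≤ K := by linarith
  have hK0 : 0 ≤ K := by linarith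
  have hKe : 4 / c * 2 ^ (1 / c) ≤ K := by linarith
  refine ⟨{ q := solitonPotential c, P := decaySol c, P' := decaySolDeriv c, Q := growSol c
            Q' := growSolDeriv c, w := c
            continuous_q := ?_
            hasDerivAt_P := hasDerivAt_decaySol hc
            hasDerivAt_P' := hasDerivAt_decaySolDeriv hc
            hasDerivAt_Q := hasDerivAt_growSol hc
            hasDerivAt_Q' := hasDerivAt_growSolDeriv hc
            wronskian := growSol_wronskian
            w_pos := hc
            inv_w_le := by linarith
            abs_P_le := fun x _ => (abs_decaySol_le hc x).trans
              (mul_le_mul_of_nonneg_right (hMle.trans hKM) (Real.exp_pos _).le)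
            abs_P'_le := fun x _ => (abs_decaySolDeriv_le hc x).trans
              (mul_le_mul_of_nonneg_right hKM (Real.exp_pos _).le)
            abs_Q_le := fun x hx => (hQ x hx).1.trans
              (mul_le_mul_of_nonneg_right hKK (Real.exp_pos _).le)
            abs_Q'_le := fun x hx => (hQ x hx).2.trans
              (mul_le_mul_of_nonneg_right hKK (Real.exp_pos _).le)
            exp_le_Q := ?_
            Q_le_Q' := ?_ }, rfl, growSolDeriv_zero c⟩
  · have : Continuous fun x => Real.tanh (c * x) :=
      continuous_iff_continuousAt.2 fun x => (hasDerivAt_tanh_mul c x).continuousAt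
    unfold solitonPotential
    fun_prop
  · intro x hx
    obtain ⟨⟨h3, -⟩, -⟩ := hL₀ x hx
    have hR := coshRoot_pos c x
    rw [lt_div_iff₀ hR] at h3
    have h4 := exp_le_coshRoot hc x
    have hG : 0 < growSol c x := lt_trans (by positivity) h3
    calc Real.exp x ≤ 2 ^ (1 / c) * coshRoot c x := h4
      _ = 4 / c * 2 ^ (1 / c) * (c / 4 * coshRoot c x) := by field_simp
      _ ≤ K * growSol c x := by gcongr
  · intro x hx
    obtain ⟨⟨-, h3⟩, h4⟩ := hL₀ x hx
    have hR := coshRoot_pos c x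
    rw [div_lt_iff₀ hR] at h3
    rw [lt_div_iff₀ hR] at h4
    have : 0 < growSolDeriv c x := lt_trans (by positivity) h4
    nlinarith

namespace FundamentalSystem

variable {K L₀ : ℝ} (D : FundamentalSystem K L₀)

theorem continuous_P : Continuous D.P :=
  continuous_iff_continuousAt.2 fun x => (D.hasDerivAt_P x).continuousAt

theorem continuous_Q : Continuous D.Q :=
  continuous_iff_continuousAt.2 fun x => (D.hasDerivAt_Q x).continuousAt

theorem K_pos (D : FundamentalSystem K L₀) : 0 < K := (inv_pos.2 D.w_pos).trans_le D.inv_w_le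

theorem Q_pos {x : ℝ} (hx : L₀ ≤ x) : 0 < D.Q x :=
  pos_of_mul_pos_right ((Real.exp_pos x).trans_le (D.exp_le_Q x hx)) D.K_pos.le

theorem Q'_pos {x : ℝ} (hx : L₀ ≤ x) : 0 < D.Q' x :=
  pos_of_mul_pos_right ((D.Q_pos hx).trans_le (D.Q_le_Q' x hx)) D.K_pos.le

/-- The integral `(1 / w) ∫ Q f` over `[0, x]`. -/
def intQ (f : ℝ → ℝ) (x : ℝ) : ℝ := D.w⁻¹ * ∫ y in (0 : ℝ)..x, D.Q y * f y

/-- The integral `(1 / w) ∫ P f` over `[x, L]`. -/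
def intP (L : ℝ) (f : ℝ → ℝ) (x : ℝ) : ℝ := D.w⁻¹ * ∫ y in x..L, D.P y * f y

/-- The solution of `z'' = q z - f` on `[0, L]` with amplitudes `a` and `b`. -/
def sol (L a b : ℝ) (f : ℝ → ℝ) (x : ℝ) : ℝ :=
  (a + D.intQ f x) * D.P x + (b / D.Q L + D.intP L f x) * D.Q x

/-- The derivative of `sol`. -/
def solDeriv (L a b : ℝ) (f : ℝ → ℝ) (x : ℝ) : ℝ :=
  (a + D.intQ f x) * D.P' x + (b / D.Q L + D.intP L f x) * D.Q' x

variable {f g : ℝ → ℝ} {L : ℝ}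

theorem hasDerivAt_intQ (hf : Continuous f) (x : ℝ) :
    HasDerivAt (D.intQ f) (D.w⁻¹ * (D.Q x * f x)) x :=
  ((D.continuous_Q.mul hf).integral_hasStrictDerivAt 0 x).hasDerivAt.const_mul _

theorem hasDerivAt_intP (hf : Continuous f) (x : ℝ) :
    HasDerivAt (D.intP L f) (-(D.w⁻¹ * (D.P x * f x))) x := by
  have h := intervalIntegral.integral_hasDerivAt_left (a := x) (b := L)
    ((D.continuous_P.mul hf).intervalIntegrable _ _)
    (D.continuous_P.mul hf).aestronglyMeasurable.stronglyMeasurableAtFilter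
    (D.continuous_P.mul hf).continuousAt
  exact (h.const_mul D.w⁻¹).congr_deriv (by simp)

/-- Variation of parameters: the derivatives of the two coefficients cancel in the first derivative,
and the Wronskian turns them into `-f` in the second. Dividing `b` by `Q L` makes it the value of
the growing part at the far end, so it stays of order one however long the edge is. -/
theorem hasDerivAt_sol (hf : Continuous f) (a b x : ℝ) :
    HasDerivAt (D.sol L a b f) (D.solDeriv L a b f x) x := by
  refine ((((D.hasDerivAt_intQ hf x).const_add a).mul (D.hasDerivAt_P x)).add
    (((D.hasDerivAt_intP (L := L) hf x).const_add (b / D.Q L)).mul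
      (D.hasDerivAt_Q x))).congr_deriv ?_
  unfold solDeriv
  ring

theorem hasDerivAt_solDeriv (hf : Continuous f) (a b x : ℝ) :
    HasDerivAt (D.solDeriv L a b f) (D.q x * D.sol L a b f x - f x) x := by
  refine ((((D.hasDerivAt_intQ hf x).const_add a).mul (D.hasDerivAt_P' x)).add
    (((D.hasDerivAt_intP (L := L) hf x).const_add (b / D.Q L)).mul
      (D.hasDerivAt_Q' x))).congr_deriv ?_
  have hw : D.w⁻¹ * (D.Q' x * D.P x - D.Q x * D.P' x) = 1 := by
    rw [D.wronskian, inv_mul_cancel₀ D.w_pos.ne']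
  unfold sol
  linear_combination (-f x) * hw

theorem continuous_sol (hf : Continuous f) (a b : ℝ) : Continuous (D.sol L a b f) :=
  continuous_iff_continuousAt.2 fun x => (D.hasDerivAt_sol hf a b x).continuousAt

theorem intQ_sub (hf : Continuous f) (hg : Continuous g) (x : ℝ) :
    D.intQ (fun y => f y - g y) x = D.intQ f x - D.intQ g x := by
  unfold intQ
  have h := intervalIntegral.integral_sub (μ := volume) (a := 0) (b := x)
    ((D.continuous_Q.mul hf).intervalIntegrable _ _)
    ((D.continuous_Q.mul hg).intervalIntegrable _ _)
  simp only [Pi.mul_apply] at h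
  simp only [mul_sub, h]

theorem intP_sub (hf : Continuous f) (hg : Continuous g) (x : ℝ) :
    D.intP L (fun y => f y - g y) x = D.intP L f x - D.intP L g x := by
  unfold intP
  have h := intervalIntegral.integral_sub (μ := volume) (a := x) (b := L)
    ((D.continuous_P.mul hf).intervalIntegrable _ _)
    ((D.continuous_P.mul hg).intervalIntegrable _ _)
  simp only [Pi.mul_apply] at h
  simp only [mul_sub, h]

theorem sol_sub (hf : Continuous f) (hg : Continuous g) (a b a' b' x : ℝ) :
    D.sol L (a - a') (b - b') (fun y => f y - g y) x = D.sol L a b f x - D.sol L a' b' g x := by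
  unfold sol
  rw [D.intQ_sub hf hg, D.intP_sub hf hg]
  ring

theorem abs_intQ_le {M x : ℝ} (hf : ∀ y, |f y| ≤ M) (hx : 0 ≤ x) :
    |D.intQ f x| ≤ K ^ 2 * M * Real.exp x := by
  have hK := D.K_pos
  have hM : 0 ≤ M := (abs_nonneg _).trans (hf 0)
  have h1 : ‖∫ y in (0 : ℝ)..x, D.Q y * f y‖ ≤ ∫ y in (0 : ℝ)..x, K * M * Real.exp y := by
    refine intervalIntegral.norm_integral_le_of_norm_le hx (.of_forall fun y hy => ?_)
      ((continuous_const.mul Real.continuous_exp).intervalIntegrable _ _)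
    rw [norm_mul, Real.norm_eq_abs, Real.norm_eq_abs]
    calc |D.Q y| * |f y| ≤ (K * Real.exp y) * M :=
          mul_le_mul (D.abs_Q_le y hy.1.le) (hf y) (abs_nonneg _) (by positivity)
      _ = _ := by ring
  rw [intervalIntegral.integral_const_mul, integral_exp, Real.exp_zero] at h1
  rw [intQ, abs_mul, abs_of_pos (inv_pos.2 D.w_pos)]
  calc D.w⁻¹ * |∫ y in (0 : ℝ)..x, D.Q y * f y| ≤ K * (K * M * (Real.exp x - 1)) :=
        mul_le_mul D.inv_w_le h1 (abs_nonneg _) hK.le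
    _ ≤ K * (K * M * Real.exp x) := by gcongr; linarith
    _ = _ := by ring

theorem abs_intP_le {M x : ℝ} (hf : ∀ y, |f y| ≤ M) (hx : 0 ≤ x) (hxL : x ≤ L) :
    |D.intP L f x| ≤ K ^ 2 * M * Real.exp (-x) := by
  have hK := D.K_pos
  have hM : 0 ≤ M := (abs_nonneg _).trans (hf 0)
  have h1 : ‖∫ y in x..L, D.P y * f y‖ ≤ ∫ y in x..L, K * M * Real.exp (-y) := by
    refine intervalIntegral.norm_integral_le_of_norm_le hxL (.of_forall fun y hy => ?_)
      ((continuous_const.mul (Real.continuous_exp.comp continuous_neg)).intervalIntegrable _ _)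
    rw [norm_mul, Real.norm_eq_abs, Real.norm_eq_abs]
    calc |D.P y| * |f y| ≤ (K * Real.exp (-y)) * M :=
          mul_le_mul (D.abs_P_le y (hx.trans hy.1.le)) (hf y) (abs_nonneg _) (by positivity)
      _ = _ := by ring
  have h2 : ∫ y in x..L, Real.exp (-y) = Real.exp (-x) - Real.exp (-L) := by
    rw [intervalIntegral.integral_comp_neg (fun y => Real.exp y), integral_exp]
  rw [intervalIntegral.integral_const_mul, h2] at h1
  rw [intP, abs_mul, abs_of_pos (inv_pos.2 D.w_pos)]
  calc D.w⁻¹ * |∫ y in x..L, D.P y * f y| ≤ K * (K * M * (Real.exp (-x) - Real.exp (-L))) :=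
        mul_le_mul D.inv_w_le h1 (abs_nonneg _) hK.le
    _ ≤ K * (K * M * Real.exp (-x)) := by
        gcongr; linarith [Real.exp_pos (-L)]
    _ = _ := by ring

/-- Integrating `Q f` from `0` and `P f` up to `L` pairs each growth `exp x` with a decay `exp
(-x)`, so the bound does not depend on `L`. General `u` and `v` cover the solution and its
derivative at once. -/
theorem abs_combination_le {M a b x u v : ℝ} (hf : ∀ y, |f y| ≤ M) (hL : L₀ ≤ L)
    (hx : 0 ≤ x) (hxL : x ≤ L) (hu : |u| ≤ K * Real.exp (-x)) (hv : |v| ≤ K * Real.exp x) :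
    |(a + D.intQ f x) * u + (b / D.Q L + D.intP L f x) * v| ≤
      K * |a| + K ^ 2 * |b| + 2 * K ^ 3 * M := by
  have hK := D.K_pos
  have hM : 0 ≤ M := (abs_nonneg _).trans (hf 0)
  have hE : Real.exp x * Real.exp (-x) = 1 := by rw [← Real.exp_add]; simp
  have hE1 : Real.exp (-x) ≤ 1 := Real.exp_le_one_iff.2 (by linarith)
  have hQL := D.Q_pos hL
  have h1 : |(a + D.intQ f x) * u| ≤ K * |a| + K ^ 3 * M := by
    rw [abs_mul]
    calc |a + D.intQ f x| * |u| ≤ (|a| + K ^ 2 * M * Real.exp x) * (K * Real.exp (-x)) := by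
          gcongr
          exact (abs_add_le _ _).trans (add_le_add le_rfl (D.abs_intQ_le hf hx))
      _ = K * |a| * Real.exp (-x) + K ^ 3 * M * (Real.exp x * Real.exp (-x)) := by ring
      _ ≤ K * |a| * 1 + K ^ 3 * M * 1 := by rw [hE]; gcongr
      _ = _ := by ring
  have h2 : |b / D.Q L| ≤ K * |b| * Real.exp (-x) := by
    rw [abs_div, abs_of_pos hQL, div_le_iff₀ hQL]
    have h3 : Real.exp x ≤ K * D.Q L := (Real.exp_le_exp.2 hxL).trans (D.exp_le_Q L hL)
    calc |b| = |b| * (Real.exp x * Real.exp (-x)) := by rw [hE, mul_one]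
      _ ≤ |b| * (K * D.Q L * Real.exp (-x)) := by gcongr
      _ = _ := by ring
  have h3 : |(b / D.Q L + D.intP L f x) * v| ≤ K ^ 2 * |b| + K ^ 3 * M := by
    rw [abs_mul]
    calc |b / D.Q L + D.intP L f x| * |v|
        ≤ (K * |b| * Real.exp (-x) + K ^ 2 * M * Real.exp (-x)) * (K * Real.exp x) := by
          gcongr
          exact (abs_add_le _ _).trans (add_le_add h2 (D.abs_intP_le hf hx hxL))
      _ = (K ^ 2 * |b| + K ^ 3 * M) * (Real.exp x * Real.exp (-x)) := by ring
      _ = _ := by rw [hE, mul_one]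
  refine (abs_add_le _ _).trans ?_
  linarith

theorem abs_sol_le {M a b x : ℝ} (hf : ∀ y, |f y| ≤ M) (hL : L₀ ≤ L) (hx : 0 ≤ x) (hxL : x ≤ L) :
    |D.sol L a b f x| ≤ K * |a| + K ^ 2 * |b| + 2 * K ^ 3 * M :=
  D.abs_combination_le hf hL hx hxL (D.abs_P_le x hx) (D.abs_Q_le x hx)

theorem abs_solDeriv_le {M a b x : ℝ} (hf : ∀ y, |f y| ≤ M) (hL : L₀ ≤ L) (hx : 0 ≤ x)
    (hxL : x ≤ L) : |D.solDeriv L a b f x| ≤ K * |a| + K ^ 2 * |b| + 2 * K ^ 3 * M :=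
  D.abs_combination_le hf hL hx hxL (D.abs_P'_le x hx) (D.abs_Q'_le x hx)

end FundamentalSystem

namespace FundamentalSystem

variable {K L₀ : ℝ} (D : FundamentalSystem K L₀)

theorem abs_div_Q_le {L b : ℝ} (hL : L₀ ≤ L) : |b / D.Q L| ≤ K * |b| * Real.exp (-L) := by
  have hQL := D.Q_pos hL
  have hE : Real.exp L * Real.exp (-L) = 1 := by rw [← Real.exp_add]; simp
  rw [abs_div, abs_of_pos hQL, div_le_iff₀ hQL]
  calc |b| = |b| * (Real.exp L * Real.exp (-L)) := by rw [hE, mul_one]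
    _ ≤ |b| * (K * D.Q L * Real.exp (-L)) := by gcongr; exact D.exp_le_Q L hL
    _ = _ := by ring

/-- The logarithmic derivative of the growing solution. -/
def slope (L : ℝ) : ℝ := D.Q' L / D.Q L

theorem slope_pos {L : ℝ} (hL : L₀ ≤ L) : 0 < D.slope L := div_pos (D.Q'_pos hL) (D.Q_pos hL)

theorem one_le_mul_slope {L : ℝ} (hL : L₀ ≤ L) : 1 ≤ K * D.slope L := by
  rw [slope, ← mul_div_assoc, one_le_div (D.Q_pos hL)]
  exact D.Q_le_Q' L hL

end FundamentalSystem

/-! ### Coupling of the edges through the vertex conditions. -/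

namespace MetricGraph

variable {V E : Type*} (G : MetricGraph V E) {K L₀ : ℝ} (D : E → FundamentalSystem K L₀)

/-- The amplitude of the growing solution at the initial point of `e`. -/
def srcAmp (b : E → ℝ) (f : E → ℝ → ℝ) (e : E) : ℝ :=
  b e / (D e).Q (G.len e) + (D e).intP (G.len e) (f e) 0

/-- The amplitude of the decaying solution at the final point of `e`. -/
def tgtAmp (a : E → ℝ) (f : E → ℝ → ℝ) (e : E) : ℝ := a e + (D e).intQ (f e) (G.len e)

/-- The value carried by the decaying solution to the final point of `e`, plus an offset. -/
def tgtVal (a : E → ℝ) (f : E → ℝ → ℝ) (o : E → ℝ) (e : E) : ℝ :=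
  G.tgtAmp D a f e * (D e).P (G.len e) + o e

/-- The outgoing slope carried by the decaying solution to the final point of `e`, plus an
offset. -/
def tgtDer (a : E → ℝ) (f : E → ℝ → ℝ) (o' : E → ℝ) (e : E) : ℝ :=
  -(G.tgtAmp D a f e * (D e).P' (G.len e)) + o' e

section Vertex

variable [Fintype E]

open Classical in
/-- The sum of the weights of the edge ends at `v`. -/
def vertexWeight (v : V) : ℝ :=
  (∑ e with G.src e = v, 1) + ∑ e with G.tgt e = v, (D e).slope (G.len e)

open Classical in
/-- The sum of the contributions of the edge ends at `v` to the vertex value. -/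
def vertexSum (a b : E → ℝ) (f : E → ℝ → ℝ) (o o' : E → ℝ) (v : V) : ℝ :=
  (∑ e with G.src e = v, 2 * G.srcAmp D b f e) +
    ∑ e with G.tgt e = v, ((D e).slope (G.len e) * G.tgtVal D a f o e + G.tgtDer D a f o' e)

/-- The vertex value determined by the Kirchhoff condition. -/
def vertexVal (a b : E → ℝ) (f : E → ℝ → ℝ) (o o' : E → ℝ) (v : V) : ℝ :=
  G.vertexSum D a b f o o' v / G.vertexWeight D v

open Classical in
/-- The amplitude of the decaying solution determined by the initial vertex. -/
def newSrc (e₁ : E) (a b : E → ℝ) (f : E → ℝ → ℝ) (o o' : E → ℝ) (e : E) : ℝ :=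
  if e = e₁ then 0 else G.vertexVal D a b f o o' (G.src e) - G.srcAmp D b f e

/-- The amplitude of the growing solution determined by the final vertex. -/
def newTgt (a b : E → ℝ) (f : E → ℝ → ℝ) (o o' : E → ℝ) (e : E) : ℝ :=
  G.vertexVal D a b f o o' (G.tgt e) - G.tgtVal D a f o e

end Vertex

variable {G} {D} {a a' b b' o₁ o₂ o₁' o₂' : E → ℝ} {f g : E → ℝ → ℝ}

/-- This and the following identities express that everything is jointly linear in amplitudes,
source and offsets. Size bounds applied to differences, where the offsets cancel, then serve as
Lipschitz bounds. -/
theorem srcAmp_sub (hf : ∀ e, Continuous (f e)) (hg : ∀ e, Continuous (g e)) (e : E) :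
    G.srcAmp D (b - b') (fun e x => f e x - g e x) e = G.srcAmp D b f e - G.srcAmp D b' g e := by
  simp only [srcAmp, (D e).intP_sub (hf e) (hg e), Pi.sub_apply]; ring

theorem tgtAmp_sub (hf : ∀ e, Continuous (f e)) (hg : ∀ e, Continuous (g e)) (e : E) :
    G.tgtAmp D (a - a') (fun e x => f e x - g e x) e = G.tgtAmp D a f e - G.tgtAmp D a' g e := by
  simp only [tgtAmp, (D e).intQ_sub (hf e) (hg e), Pi.sub_apply]; ring

theorem tgtVal_sub (hf : ∀ e, Continuous (f e)) (hg : ∀ e, Continuous (g e)) (e : E) :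
    G.tgtVal D (a - a') (fun e x => f e x - g e x) (o₁ - o₂) e =
      G.tgtVal D a f o₁ e - G.tgtVal D a' g o₂ e := by
  simp only [tgtVal, tgtAmp_sub hf hg, Pi.sub_apply]; ring

theorem tgtDer_sub (hf : ∀ e, Continuous (f e)) (hg : ∀ e, Continuous (g e)) (e : E) :
    G.tgtDer D (a - a') (fun e x => f e x - g e x) (o₁ - o₂) e =
      G.tgtDer D a f o₁ e - G.tgtDer D a' g o₂ e := by
  simp only [tgtDer, tgtAmp_sub hf hg, Pi.sub_apply]; ring

section Bounds

variable {A M O : ℝ}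

/-- An amplitude sent from the opposite end of an edge arrives damped by the factor `exp (-ℓ)`. This
weak coupling is one of the two sources of contraction, the other being a small `M`. -/
theorem abs_srcAmp_le (hK : 1 ≤ K) {ℓ : ℝ} (hℓ : ∀ e, ℓ ≤ G.len e) (hL : ∀ e, L₀ ≤ G.len e)
    (hb : ∀ e, |b e| ≤ A) (hf : ∀ e x, |f e x| ≤ M) (e : E) :
    |G.srcAmp D b f e| ≤ K * A * Real.exp (-ℓ) + K ^ 3 * M := by
  have hM : 0 ≤ M := (abs_nonneg _).trans (hf e 0)
  have hA : 0 ≤ A := (abs_nonneg _).trans (hb e)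
  refine (abs_add_le _ _).trans (add_le_add ?_ ?_)
  · refine ((D e).abs_div_Q_le (hL e)).trans ?_
    gcongr
    · exact hb e
    · exact hℓ e
  · refine ((D e).abs_intP_le (hf e) le_rfl (G.len_pos e).le).trans ?_
    rw [neg_zero, Real.exp_zero, mul_one]
    have : K ^ 2 ≤ K ^ 3 := pow_le_pow_right₀ hK (by norm_num)
    gcongr

theorem abs_tgtAmp_mul_le (hK : 1 ≤ K) {ℓ : ℝ} (hℓ : ∀ e, ℓ ≤ G.len e)
    (ha : ∀ e, |a e| ≤ A) (hf : ∀ e x, |f e x| ≤ M) (e : E) {u : ℝ}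
    (hu : |u| ≤ K * Real.exp (-G.len e)) :
    |G.tgtAmp D a f e * u| ≤ K * A * Real.exp (-ℓ) + K ^ 3 * M := by
  have hM : 0 ≤ M := (abs_nonneg _).trans (hf e 0)
  have hA : 0 ≤ A := (abs_nonneg _).trans (ha e)
  have hE : Real.exp (G.len e) * Real.exp (-G.len e) = 1 := by rw [← Real.exp_add]; simp
  have h1 : |G.tgtAmp D a f e| ≤ A + K ^ 2 * M * Real.exp (G.len e) :=
    (abs_add_le _ _).trans (add_le_add (ha e) ((D e).abs_intQ_le (hf e) (G.len_pos e).le))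
  rw [abs_mul]
  calc |G.tgtAmp D a f e| * |u|
      ≤ (A + K ^ 2 * M * Real.exp (G.len e)) * (K * Real.exp (-G.len e)) := by gcongr
    _ = K * A * Real.exp (-G.len e) + K ^ 3 * M * (Real.exp (G.len e) * Real.exp (-G.len e)) := by
        ring
    _ ≤ K * A * Real.exp (-ℓ) + K ^ 3 * M := by
        rw [hE, mul_one]; gcongr; exact hℓ e

theorem abs_tgtVal_le (hK : 1 ≤ K) {ℓ : ℝ} (hℓ : ∀ e, ℓ ≤ G.len e)
    (ha : ∀ e, |a e| ≤ A) (hf : ∀ e x, |f e x| ≤ M) (ho : ∀ e, |o₁ e| ≤ O) (e : E) :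
    |G.tgtVal D a f o₁ e| ≤ K * A * Real.exp (-ℓ) + K ^ 3 * M + O :=
  (abs_add_le _ _).trans (add_le_add
    (abs_tgtAmp_mul_le hK hℓ ha hf e ((D e).abs_P_le _ (G.len_pos e).le)) (ho e))

theorem abs_tgtDer_le (hK : 1 ≤ K) {ℓ : ℝ} (hℓ : ∀ e, ℓ ≤ G.len e)
    (ha : ∀ e, |a e| ≤ A) (hf : ∀ e x, |f e x| ≤ M) (ho : ∀ e, |o₁ e| ≤ O) (e : E) :
    |G.tgtDer D a f o₁ e| ≤ K * A * Real.exp (-ℓ) + K ^ 3 * M + O := by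
  refine (abs_add_le _ _).trans (add_le_add ?_ (ho e))
  rw [abs_neg]
  exact abs_tgtAmp_mul_le hK hℓ ha hf e ((D e).abs_P'_le _ (G.len_pos e).le)

end Bounds

variable [Fintype E]

theorem vertexVal_sub (hf : ∀ e, Continuous (f e)) (hg : ∀ e, Continuous (g e)) (v : V) :
    G.vertexVal D (a - a') (b - b') (fun e x => f e x - g e x) (o₁ - o₂) (o₁' - o₂') v =
      G.vertexVal D a b f o₁ o₁' v - G.vertexVal D a' b' g o₂ o₂' v := by
  simp only [vertexVal, vertexSum, srcAmp_sub hf hg, tgtVal_sub hf hg, tgtDer_sub hf hg]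
  rw [← sub_div]
  congr 1
  simp only [mul_sub, Finset.sum_sub_distrib, Finset.sum_add_distrib]
  ring

theorem newSrc_sub (hf : ∀ e, Continuous (f e)) (hg : ∀ e, Continuous (g e)) (e₁ e : E) :
    G.newSrc D e₁ (a - a') (b - b') (fun e x => f e x - g e x) (o₁ - o₂) (o₁' - o₂') e =
      G.newSrc D e₁ a b f o₁ o₁' e - G.newSrc D e₁ a' b' g o₂ o₂' e := by
  simp only [newSrc, vertexVal_sub hf hg, srcAmp_sub hf hg]
  split_ifs <;> ring

theorem newTgt_sub (hf : ∀ e, Continuous (f e)) (hg : ∀ e, Continuous (g e)) (e : E) :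
    G.newTgt D (a - a') (b - b') (fun e x => f e x - g e x) (o₁ - o₂) (o₁' - o₂') e =
      G.newTgt D a b f o₁ o₁' e - G.newTgt D a' b' g o₂ o₂' e := by
  simp only [newTgt, vertexVal_sub hf hg, tgtVal_sub hf hg]
  ring

theorem vertexWeight_nonneg (hL : ∀ e, L₀ ≤ G.len e) (v : V) : 0 ≤ G.vertexWeight D v :=
  add_nonneg (Finset.sum_nonneg fun _ _ => zero_le_one)
    (Finset.sum_nonneg fun e _ => ((D e).slope_pos (hL e)).le)

section Bounds

variable {A M O ℓ : ℝ} (hK : 1 ≤ K) (hℓ : ∀ e, ℓ ≤ G.len e) (hL : ∀ e, L₀ ≤ G.len e)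
  (hM : 0 ≤ M) (hA : 0 ≤ A) (hO : 0 ≤ O)
  (ha : ∀ e, |a e| ≤ A) (hb : ∀ e, |b e| ≤ A) (hf : ∀ e x, |f e x| ≤ M)
  (ho : ∀ e, |o₁ e| ≤ O) (ho' : ∀ e, |o₁' e| ≤ O)
include hK hℓ hL hM hA hO ha hb hf ho ho'

/-- Each edge end contributes at most a multiple of its own weight; the slope term is absorbed by `1
≤ K * slope`. The quotient `vertexVal` is therefore bounded independently of the degree of the
vertex. -/
theorem abs_vertexSum_le (v : V) : |G.vertexSum D a b f o₁ o₁' v| ≤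
    (K + 1) * (K * A * Real.exp (-ℓ) + K ^ 3 * M + O) * G.vertexWeight D v := by
  set m := K * A * Real.exp (-ℓ) + K ^ 3 * M + O with hm
  have hm0 : 0 ≤ m := by positivity
  rw [vertexSum, vertexWeight, mul_add, Finset.mul_sum, Finset.mul_sum]
  refine (abs_add_le _ _).trans (add_le_add
    ((Finset.abs_sum_le_sum_abs _ _).trans (Finset.sum_le_sum fun e _ => ?_))
    ((Finset.abs_sum_le_sum_abs _ _).trans (Finset.sum_le_sum fun e _ => ?_)))
  · have h1 : |G.srcAmp D b f e| ≤ m := (abs_srcAmp_le hK hℓ hL hb hf e).trans (by linarith)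
    rw [abs_mul, abs_two]
    nlinarith
  · have h1 : |G.tgtVal D a f o₁ e| ≤ m := abs_tgtVal_le hK hℓ ha hf ho e
    have h2 : |G.tgtDer D a f o₁' e| ≤ m := abs_tgtDer_le hK hℓ ha hf ho' e
    have hs := (D e).slope_pos (hL e)
    have hs' := (D e).one_le_mul_slope (hL e)
    refine (abs_add_le _ _).trans ?_
    rw [abs_mul, abs_of_pos hs]
    calc _ ≤ (D e).slope (G.len e) * m + K * (D e).slope (G.len e) * m := by
          gcongr
          exact h2.trans (le_mul_of_one_le_left hm0 hs')
      _ = _ := by ring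

theorem abs_vertexVal_le (v : V) : |G.vertexVal D a b f o₁ o₁' v| ≤
    (K + 1) * (K * A * Real.exp (-ℓ) + K ^ 3 * M + O) := by
  have h := abs_vertexSum_le (D := D) hK hℓ hL hM hA hO ha hb hf ho ho' v
  rw [vertexVal, abs_div, abs_of_nonneg (vertexWeight_nonneg hL v)]
  exact div_le_of_le_mul₀ (vertexWeight_nonneg hL v) (by positivity) h

theorem abs_newSrc_le (e₁ e : E) : |G.newSrc D e₁ a b f o₁ o₁' e| ≤
    (K + 2) * (K * A * Real.exp (-ℓ) + K ^ 3 * M + O) := by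
  have h := abs_vertexVal_le (D := D) hK hℓ hL hM hA hO ha hb hf ho ho' (G.src e)
  have h1 := abs_srcAmp_le (D := D) hK hℓ hL hb hf e
  rw [newSrc]
  split_ifs
  · rw [abs_zero]; positivity
  · refine (abs_sub _ _).trans ?_
    linarith

theorem abs_newTgt_le (e : E) : |G.newTgt D a b f o₁ o₁' e| ≤
    (K + 2) * (K * A * Real.exp (-ℓ) + K ^ 3 * M + O) := by
  have h := abs_vertexVal_le (D := D) hK hℓ hL hM hA hO ha hb hf ho ho' (G.tgt e)
  have h1 := abs_tgtVal_le (D := D) hK hℓ ha hf ho e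
  rw [newTgt]
  refine (abs_sub _ _).trans ?_
  linarith

end Bounds

/-- Amplitudes determined by the vertices give a function with the right final values. -/
theorem sol_len_of_newTgt (hL : ∀ e, L₀ ≤ G.len e) {e : E}
    (hb : b e = G.newTgt D a b f o₁ o₁' e) :
    (D e).sol (G.len e) (a e) (b e) (f e) (G.len e) + o₁ e =
      G.vertexVal D a b f o₁ o₁' (G.tgt e) := by
  have hQ := ((D e).Q_pos (hL e)).ne'
  have h1 : (D e).intP (G.len e) (f e) (G.len e) = 0 := by simp [FundamentalSystem.intP]
  rw [FundamentalSystem.sol, h1, add_zero, div_mul_cancel₀ _ hQ, hb]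
  unfold newTgt tgtVal tgtAmp
  ring

theorem sol_zero_of_newSrc {e e₁ : E} (he : e ≠ e₁) (hP : (D e).P 0 = 1) (hQ : (D e).Q 0 = 1)
    (ha : a e = G.newSrc D e₁ a b f o₁ o₁' e) :
    (D e).sol (G.len e) (a e) (b e) (f e) 0 = G.vertexVal D a b f o₁ o₁' (G.src e) := by
  have h1 : (D e).intQ (f e) 0 = 0 := by simp [FundamentalSystem.intQ]
  rw [FundamentalSystem.sol, h1, hP, hQ, ha, newSrc, if_neg he]
  unfold srcAmp
  ring

open Classical in
/-- Amplitudes determined by the vertices give a function satisfying the Kirchhoff condition. -/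
theorem kirchhoff_of_new (hL : ∀ e, L₀ ≤ G.len e) {e₁ : E} {v : V} (hv : v ≠ G.src e₁)
    (hP : ∀ e, e ≠ e₁ → (D e).P' 0 = -1) (hQ : ∀ e, e ≠ e₁ → (D e).Q' 0 = 1)
    (ha : ∀ e, a e = G.newSrc D e₁ a b f o₁ o₁' e)
    (hb : ∀ e, b e = G.newTgt D a b f o₁ o₁' e) :
    (∑ e with G.src e = v, (D e).solDeriv (G.len e) (a e) (b e) (f e) 0) +
      ∑ e with G.tgt e = v,
        (-(D e).solDeriv (G.len e) (a e) (b e) (f e) (G.len e) + o₁' e) = 0 := by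
  -- At an initial end the slope is `-a + srcAmp`, and `a + srcAmp` is the vertex value, so the
  -- slope is an affine function of that value. Final ends behave alike with weight `slope`; summing
  -- shows that Kirchhoff's condition is the definition of `vertexVal`.
  have hsrc : ∀ e ∈ Finset.univ.filter (fun e => G.src e = v),
      (D e).solDeriv (G.len e) (a e) (b e) (f e) 0 =
        2 * G.srcAmp D b f e - G.vertexVal D a b f o₁ o₁' v * 1 := by
    intro e he
    have he' : G.src e = v := (Finset.mem_filter.1 he).2
    have hne : e ≠ e₁ := fun h => hv (by rw [← he', h])
    have h1 : (D e).intQ (f e) 0 = 0 := by simp [FundamentalSystem.intQ]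
    rw [FundamentalSystem.solDeriv, h1, hP e hne, hQ e hne, ha e, newSrc, if_neg hne, he']
    unfold srcAmp
    ring
  have htgt : ∀ e ∈ Finset.univ.filter (fun e => G.tgt e = v),
      -(D e).solDeriv (G.len e) (a e) (b e) (f e) (G.len e) + o₁' e =
        ((D e).slope (G.len e) * G.tgtVal D a f o₁ e + G.tgtDer D a f o₁' e) -
          G.vertexVal D a b f o₁ o₁' v * (D e).slope (G.len e) := by
    intro e he
    have he' : G.tgt e = v := (Finset.mem_filter.1 he).2
    have hQ := ((D e).Q_pos (hL e)).ne'
    have h1 : (D e).intP (G.len e) (f e) (G.len e) = 0 := by simp [FundamentalSystem.intP]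
    have h2 : b e / (D e).Q (G.len e) * (D e).Q' (G.len e) = b e * (D e).slope (G.len e) := by
      unfold FundamentalSystem.slope; ring
    rw [FundamentalSystem.solDeriv, h1, add_zero, h2, hb e, newTgt, he']
    unfold tgtDer tgtAmp
    ring
  rw [Finset.sum_congr rfl hsrc, Finset.sum_congr rfl htgt, Finset.sum_sub_distrib,
    Finset.sum_sub_distrib]
  simp only [← Finset.mul_sum]
  have key : G.vertexVal D a b f o₁ o₁' v * G.vertexWeight D v = G.vertexSum D a b f o₁ o₁' v := by
    rw [vertexVal]
    -- If the weight is `0`, the division defining `vertexVal` is by zero; but then no edge ends at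
    -- `v`, and all the sums are empty.
    rcases (vertexWeight_nonneg (D := D) hL v).eq_or_lt with h0 | h0
    · have h1 : (0 : ℝ) ≤ ∑ e with G.src e = v, (1 : ℝ) := Finset.sum_nonneg fun _ _ => zero_le_one
      have h2 : 0 ≤ ∑ e with G.tgt e = v, (D e).slope (G.len e) :=
        Finset.sum_nonneg fun e _ => ((D e).slope_pos (hL e)).le
      rw [vertexWeight] at h0
      have h3 : ∀ e, G.src e ≠ v := fun e he => by
        have := (Finset.sum_eq_zero_iff_of_nonneg fun _ _ => zero_le_one).1
          (show ∑ e with G.src e = v, (1 : ℝ) = 0 by linarith) e (by simp [he])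
        exact one_ne_zero this
      have h4 : ∀ e, G.tgt e ≠ v := fun e he => by
        have := (Finset.sum_eq_zero_iff_of_nonneg fun e _ => ((D e).slope_pos (hL e)).le).1
          (show ∑ e with G.tgt e = v, (D e).slope (G.len e) = 0 by linarith) e (by simp [he])
        exact ((D e).slope_pos (hL e)).ne' this
      simp [vertexSum, vertexWeight, h3, h4]
    · exact div_mul_cancel₀ _ h0.ne'
  simp only [vertexWeight, vertexSum, ← Finset.mul_sum] at key
  linarith

end MetricGraph

/-! ### The contraction argument for long edges and small nonlinearities. -/

/-- The retraction of `ℝ` onto `[0, L]`. -/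
def clamp (L x : ℝ) : ℝ := max 0 (min L x)

theorem clamp_mem {L : ℝ} (hL : 0 ≤ L) (x : ℝ) : clamp L x ∈ Icc 0 L :=
  ⟨le_max_left _ _, max_le hL (min_le_left _ _)⟩

theorem clamp_eq {L x : ℝ} (hx : x ∈ Icc 0 L) : clamp L x = x := by
  rw [clamp, min_eq_right hx.2, max_eq_right hx.1]

theorem continuous_clamp (L : ℝ) : Continuous (clamp L) :=
  continuous_const.max (continuous_const.min continuous_id)

namespace MetricGraph

variable {V E : Type*} [Fintype E] (G : MetricGraph V E) {K L₀ : ℝ}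
  (D : E → FundamentalSystem K L₀)

/-- A nonlinear transmission problem with small Lipschitz nonlinearity on a graph with long edges
has a small solution. -/
theorem exists_transmission_solution (hK : 1 ≤ K) {ℓ : ℝ} (hℓ : ∀ e, ℓ ≤ G.len e)
    (hL : ∀ e, L₀ ≤ G.len e) {ε : ℝ} (hε : 0 ≤ ε)
    (hsmall : 16 * K ^ 6 * (Real.exp (-ℓ) + ε) ≤ 1)
    (F : E → ℝ → ℝ → ℝ)
    (hFc : ∀ e (ψ : ℝ → ℝ), Continuous ψ → Continuous fun x => F e x (ψ x))
    (hF0 : ∀ e x, F e x 0 = 0)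
    (hFL : ∀ e x s t, |F e x s - F e x t| ≤ ε * |s - t|)
    (e₁ : E) {o o' : E → ℝ} {O : ℝ} (hO : 0 ≤ O) (ho : ∀ e, |o e| ≤ O) (ho' : ∀ e, |o' e| ≤ O) :
    ∃ (a b : E → ℝ) (f : E → ℝ → ℝ), (∀ e, Continuous (f e)) ∧
      (∀ e, a e = G.newSrc D e₁ a b f o o' e) ∧ (∀ e, b e = G.newTgt D a b f o o' e) ∧
      (∀ e, ∀ x ∈ Icc 0 (G.len e),
        f e x = F e x ((D e).sol (G.len e) (a e) (b e) (f e) x)) ∧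
      (∀ e, ∀ x ∈ Icc 0 (G.len e), |(D e).sol (G.len e) (a e) (b e) (f e) x| ≤ 12 * K ^ 3 * O) ∧
      ∀ e, ∀ x ∈ Icc 0 (G.len e),
        |(D e).solDeriv (G.len e) (a e) (b e) (f e) x| ≤ 36 * K ^ 5 * O := by
  have hK0 : 0 < K := by linarith
  -- The amplitudes are unknowns alongside the functions, so that one iteration step is explicit;
  -- the vertex conditions and the equation hold only at the fixed point.
  let X := (E → ℝ) × (E → ℝ) × (E → ℝ →ᵇ ℝ)
  have hFb : ∀ e x t, |F e x t| ≤ ε * |t| := fun e x t => by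
    simpa [hF0] using hFL e x t 0
  let N : X → E → ℝ → ℝ := fun z e x => F e x (z.2.2 e x)
  have hNc : ∀ z e, Continuous (N z e) := fun z e => hFc e _ (z.2.2 e).continuous
  have hNb : ∀ z e x, |N z e x| ≤ ε * ‖z.2.2‖ := fun z e x =>
    (hFb e x _).trans (mul_le_mul_of_nonneg_left
      (((z.2.2 e).norm_coe_le_norm x).trans (norm_le_pi_norm z.2.2 e)) hε)
  let A : X → E → ℝ := fun z => G.newSrc D e₁ z.1 z.2.1 (N z) o o'
  let B : X → E → ℝ := fun z => G.newTgt D z.1 z.2.1 (N z) o o'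
  -- Composition with `clamp` extends the solution from the edge to a bounded function on `ℝ`, as
  -- `sol` itself is controlled only on `[0, len]`.
  let S : X → E → ℝ →ᵇ ℝ := fun z e => BoundedContinuousFunction.ofNormedAddCommGroup
    (fun x => (D e).sol (G.len e) (A z e) (B z e) (N z e) (clamp (G.len e) x))
    (((D e).continuous_sol (hNc z e) _ _).comp (continuous_clamp _))
    (K * |A z e| + K ^ 2 * |B z e| + 2 * K ^ 3 * (ε * ‖z.2.2‖))
    (fun x => (D e).abs_sol_le (hNb z e) (hL e) (clamp_mem (G.len_pos e).le x).1
      (clamp_mem (G.len_pos e).le x).2)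
  let T : X → X := fun z => (A z, B z, S z)
  have hKp : ∀ m n : ℕ, m ≤ n → K ^ m ≤ K ^ n := fun m n h => pow_le_pow_right₀ hK h
  have hcomb : ∀ m μ u v : ℝ, |u| ≤ 3 * K * m → |v| ≤ 3 * K * m →
      K * |u| + K ^ 2 * |v| + 2 * K ^ 3 * μ ≤ 6 * K ^ 3 * m + 2 * K ^ 3 * μ := by
    intro m μ u v hu hv
    have hm : 0 ≤ 3 * K * m := (abs_nonneg _).trans hu
    have hm' : 0 ≤ m := by
      by_contra h; push Not at h; nlinarith
    have h1 : K * |u| ≤ K * (3 * K * m) := by gcongr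
    have h2 : K ^ 2 * |v| ≤ K ^ 2 * (3 * K * m) := by gcongr
    have h3 : K ^ 2 * m ≤ K ^ 3 * m := mul_le_mul_of_nonneg_right (hKp 2 3 (by norm_num)) hm'
    nlinarith
  have hTlip : LipschitzWith (1 / 2) T := by
    refine LipschitzWith.of_dist_le_mul fun z w => ?_
    set d := dist z w with hd
    have hd0 : 0 ≤ d := dist_nonneg
    have hd1 : ∀ e, |(z.1 - w.1) e| ≤ d := fun e => by
      rw [Pi.sub_apply, ← Real.dist_eq]
      exact (dist_le_pi_dist z.1 w.1 e).trans (le_max_left _ _)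
    have hd2 : ∀ e, |(z.2.1 - w.2.1) e| ≤ d := fun e => by
      rw [Pi.sub_apply, ← Real.dist_eq]
      exact (dist_le_pi_dist z.2.1 w.2.1 e).trans ((le_max_left _ _).trans (le_max_right _ _))
    have hd3 : ∀ e x, |N z e x - N w e x| ≤ ε * d := fun e x => by
      refine (hFL e x _ _).trans (mul_le_mul_of_nonneg_left ?_ hε)
      rw [← Real.dist_eq]
      exact (((z.2.2 e).dist_coe_le_dist x).trans (dist_le_pi_dist z.2.2 w.2.2 e)).trans
        ((le_max_right _ _).trans (le_max_right _ _))
    set m := K * d * Real.exp (-ℓ) + K ^ 3 * (ε * d) + 0 with hm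
    have hm0 : 0 ≤ m := by positivity
    have hz : ∀ e, |(o - o) e| ≤ (0 : ℝ) := fun e => by simp
    have hz' : ∀ e, |(o' - o') e| ≤ (0 : ℝ) := fun e => by simp
    have hA : ∀ e, |A z e - A w e| ≤ 3 * K * m := fun e => by
      have := abs_newSrc_le (G := G) (D := D) hK hℓ hL (by positivity) hd0 le_rfl hd1 hd2 hd3
        hz hz' e₁ e
      rw [newSrc_sub (hNc z) (hNc w)] at this
      refine this.trans ?_
      gcongr; linarith
    have hB : ∀ e, |B z e - B w e| ≤ 3 * K * m := fun e => by
      have := abs_newTgt_le (G := G) (D := D) hK hℓ hL (by positivity) hd0 le_rfl hd1 hd2 hd3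
        hz hz' e
      rw [newTgt_sub (hNc z) (hNc w)] at this
      refine this.trans ?_
      gcongr; linarith
    have hmd : m ≤ K ^ 3 * (Real.exp (-ℓ) + ε) * d := by
      have : K * (d * Real.exp (-ℓ)) ≤ K ^ 3 * (d * Real.exp (-ℓ)) :=
        mul_le_mul_of_nonneg_right (by simpa using hKp 1 3 (by norm_num)) (by positivity)
      rw [hm]; linarith
    have hE := Real.exp_pos (-ℓ)
    -- With `m ≤ K ^ 3 * (exp (-ℓ) + ε) * d` the left side is at most `8 * K ^ 6 * (exp (-ℓ) + ε) *
    -- d`; the constant `16` in `hsmall` makes this half of `d`.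
    have hfin : 6 * K ^ 3 * m + 2 * K ^ 3 * (ε * d) ≤ 1 / 2 * d := by
      have h1 : 6 * K ^ 3 * m ≤ 6 * K ^ 3 * (K ^ 3 * (Real.exp (-ℓ) + ε) * d) := by gcongr
      have h2 : K ^ 3 * (ε * d) ≤ K ^ 6 * (ε * d) :=
        mul_le_mul_of_nonneg_right (hKp 3 6 (by norm_num)) (by positivity)
      have h3 : 0 ≤ K ^ 6 * (Real.exp (-ℓ) * d) := by positivity
      have h4 := mul_le_mul_of_nonneg_right hsmall hd0
      nlinarith
    have hfin' : 3 * K * m ≤ 1 / 2 * d := by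
      have : K * m ≤ K ^ 3 * m :=
        mul_le_mul_of_nonneg_right (by simpa using hKp 1 3 (by norm_num)) hm0
      have h2 : 0 ≤ K ^ 3 * (ε * d) := by positivity
      have h3 : 0 ≤ K ^ 3 * m := by positivity
      linarith
    have hr : 0 ≤ 1 / 2 * d := by positivity
    have goal : dist (T z) (T w) ≤ 1 / 2 * d := by
      refine max_le ((dist_pi_le_iff hr).2 fun e => ?_)
        (max_le ((dist_pi_le_iff hr).2 fun e => ?_) ((dist_pi_le_iff hr).2 fun e => ?_))
      · rw [Real.dist_eq]; exact (hA e).trans hfin'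
      · rw [Real.dist_eq]; exact (hB e).trans hfin'
      · refine (BoundedContinuousFunction.dist_le hr).2 fun x => ?_
        have hx := clamp_mem (G.len_pos e).le x
        have := (D e).abs_sol_le (a := A z e - A w e) (b := B z e - B w e) (hd3 e) (hL e) hx.1 hx.2
        rw [(D e).sol_sub (hNc z e) (hNc w e)] at this
        rw [Real.dist_eq]
        exact this.trans ((hcomb m _ _ _ (hA e) (hB e)).trans hfin)
    simpa using goal
  have hT : ContractingWith (1 / 2) T := ⟨by
    rw [← NNReal.coe_lt_coe]; norm_num, hTlip⟩
  let z : X := hT.fixedPoint T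
  have hz : T z = z := hT.fixedPoint_isFixedPt
  have hN0 : ∀ e x, |N 0 e x| ≤ (0 : ℝ) := fun e x => by
    simpa using hNb 0 e x
  -- A `1 / 2`-contraction has its fixed point within twice the distance from `0` to `T 0`, and only
  -- the offsets contribute to `T 0`.
  have hz0 : ‖z‖ ≤ 12 * K ^ 3 * O := by
    have hA : ∀ e, |A 0 e| ≤ 3 * K * O := fun e => by
      have := abs_newSrc_le (G := G) (D := D) (a := 0) (b := 0) hK hℓ hL le_rfl le_rfl hO
        (fun e => by simp) (fun e => by simp) hN0 ho ho' e₁ e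
      refine this.trans ?_
      simp only [mul_zero, zero_mul, zero_add]
      gcongr; linarith
    have hB : ∀ e, |B 0 e| ≤ 3 * K * O := fun e => by
      have := abs_newTgt_le (G := G) (D := D) (a := 0) (b := 0) hK hℓ hL le_rfl le_rfl hO
        (fun e => by simp) (fun e => by simp) hN0 ho ho' e
      refine this.trans ?_
      simp only [mul_zero, zero_mul, zero_add]
      gcongr; linarith
    have h1 : 3 * K * O ≤ 6 * K ^ 3 * O := by
      have : K * O ≤ K ^ 3 * O :=
        mul_le_mul_of_nonneg_right (by simpa using hKp 1 3 (by norm_num)) hO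
      have h3 : 0 ≤ K ^ 3 * O := by positivity
      linarith
    have hr : 0 ≤ 6 * K ^ 3 * O := by positivity
    have hT0 : dist 0 (T 0) ≤ 6 * K ^ 3 * O := by
      rw [dist_comm]
      refine max_le ((dist_pi_le_iff hr).2 fun e => ?_)
        (max_le ((dist_pi_le_iff hr).2 fun e => ?_) ((dist_pi_le_iff hr).2 fun e => ?_))
      · rw [Real.dist_eq]; simpa using (hA e).trans h1
      · rw [Real.dist_eq]; simpa using (hB e).trans h1
      · refine (BoundedContinuousFunction.dist_le hr).2 fun x => ?_
        have hx := clamp_mem (G.len_pos e).le x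
        have := (D e).abs_sol_le (a := A 0 e) (b := B 0 e) (hN0 e) (hL e) hx.1 hx.2
        have h2 := this.trans (hcomb O _ _ _ (hA e) (hB e))
        rw [mul_zero, add_zero] at h2
        rw [Real.dist_eq]
        change |(D e).sol _ _ _ _ _ - 0| ≤ _
        rwa [sub_zero]
    have := hT.dist_fixedPoint_le 0
    rw [dist_zero_left] at this
    refine this.trans ?_
    have hhalf : (1 : ℝ) - ((1 / 2 : NNReal) : ℝ) = 1 / 2 := by norm_num
    rw [hhalf, div_le_iff₀ (by norm_num)]
    linarith
  set r := 12 * K ^ 3 * O with hr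
  have hr0 : 0 ≤ r := by positivity
  have hA : A z = z.1 := congrArg Prod.fst hz
  have hB : B z = z.2.1 := congrArg (fun y : X => y.2.1) hz
  have hS : S z = z.2.2 := congrArg (fun y : X => y.2.2) hz
  have hSx : ∀ e, ∀ x ∈ Icc 0 (G.len e),
      (D e).sol (G.len e) (z.1 e) (z.2.1 e) (N z e) x = z.2.2 e x := fun e x hx => by
    have : S z e x = z.2.2 e x := by rw [hS]
    rw [← this, ← hA, ← hB]
    change _ = (D e).sol (G.len e) (A z e) (B z e) (N z e) (clamp (G.len e) x)
    rw [clamp_eq hx]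
  have hz1 : ∀ e, |z.1 e| ≤ r := fun e => ((norm_le_pi_norm z.1 e).trans (norm_fst_le z)).trans hz0
  have hz2 : ‖z.2‖ ≤ r := (norm_snd_le z).trans hz0
  have hz3 : ∀ e, |z.2.1 e| ≤ r := fun e =>
    ((norm_le_pi_norm z.2.1 e).trans (norm_fst_le z.2)).trans hz2
  have hz4 : ‖z.2.2‖ ≤ r := (norm_snd_le z.2).trans hz2
  refine ⟨z.1, z.2.1, N z, hNc z, fun e => (congrFun hA e).symm, fun e => (congrFun hB e).symm,
    fun e x hx => ?_, fun e x hx => ?_, fun e x hx => ?_⟩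
  · rw [hSx e x hx]
  · rw [hSx e x hx]
    exact ((z.2.2 e).norm_coe_le_norm x).trans ((norm_le_pi_norm z.2.2 e).trans hz4)
  · refine ((D e).abs_solDeriv_le (M := ε * r) (fun y => (hNb z e y).trans ?_) (hL e) hx.1
      hx.2).trans ?_
    · gcongr
    have h1 : K * |z.1 e| ≤ K ^ 2 * r :=
      mul_le_mul (by simpa using hKp 1 2 (by norm_num)) (hz1 e) (abs_nonneg _) (by positivity)
    have h2 : K ^ 2 * |z.2.1 e| ≤ K ^ 2 * r := by gcongr; exact hz3 e
    have h3 : 2 * K ^ 3 * (ε * r) ≤ K ^ 2 * r := by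
      have hE := Real.exp_pos (-ℓ)
      have h4 : K ^ 3 * ε ≤ K ^ 6 * ε := mul_le_mul_of_nonneg_right (hKp 3 6 (by norm_num)) hε
      have h5 : 0 ≤ K ^ 6 * Real.exp (-ℓ) := by positivity
      have h6 : 2 * K ^ 3 * ε ≤ K ^ 2 := by
        have := one_le_pow₀ hK (n := 2)
        have h7 : 0 ≤ K ^ 3 * ε := by positivity
        nlinarith
      calc 2 * K ^ 3 * (ε * r) = 2 * K ^ 3 * ε * r := by ring
        _ ≤ _ := by gcongr
    have : 36 * K ^ 5 * O = 3 * (K ^ 2 * r) := by rw [hr]; ring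
    linarith

end MetricGraph

/-! ### The solution near the soliton on a graph with long edges. -/

namespace MetricGraph

variable {V E : Type*}

open Classical in
/-- The soliton on the edge `e₁`, extended by `0`. -/
def solitonOn (p : ℝ) (e₁ e : E) (x : ℝ) : ℝ := if e = e₁ then soliton p x else 0

open Classical in
/-- The derivative of `solitonOn`. -/
def solitonOnDeriv (p : ℝ) (e₁ e : E) (x : ℝ) : ℝ := if e = e₁ then solitonDeriv p x else 0

theorem hasDerivAt_solitonOn {p : ℝ} (hp : 1 < p) (e₁ e : E) (x : ℝ) :
    HasDerivAt (solitonOn p e₁ e) (solitonOnDeriv p e₁ e x) x := by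
  by_cases he : e = e₁
  · have h : solitonOn p e₁ e = soliton p := funext fun x => if_pos he
    rw [h, solitonOnDeriv, if_pos he]
    exact hasDerivAt_soliton hp x
  · have h : solitonOn p e₁ e = fun _ => 0 := funext fun x => if_neg he
    rw [h, solitonOnDeriv, if_neg he]
    exact hasDerivAt_const x 0

theorem hasDerivAt_solitonOnDeriv {p : ℝ} (hp : 1 < p) (e₁ e : E) (x : ℝ) :
    HasDerivAt (solitonOnDeriv p e₁ e) (solitonOn p e₁ e x - solitonOn p e₁ e x ^ p) x := by
  by_cases he : e = e₁
  · have h : solitonOnDeriv p e₁ e = solitonDeriv p := funext fun x => if_pos he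
    rw [h, solitonOn, if_pos he]
    exact hasDerivAt_solitonDeriv hp x
  · have h : solitonOnDeriv p e₁ e = fun _ => 0 := funext fun x => if_neg he
    rw [h, solitonOn, if_neg he, Real.zero_rpow (by linarith), sub_zero]
    exact hasDerivAt_const x 0

theorem continuous_solitonOn {p : ℝ} (hp : 1 < p) (e₁ e : E) : Continuous (solitonOn p e₁ e) :=
  continuous_iff_continuousAt.2 fun x => (hasDerivAt_solitonOn hp e₁ e x).continuousAt

variable [Fintype E]

open Classical in
/-- `v`, with derivatives `v'` and `v''` along the edges, solves `v'' = v - (max v 0) ^ p` on `G`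
with Kirchhoff conditions. -/
structure IsTransmissionSolution (G : MetricGraph V E) (p : ℝ) (v v' v'' : E → ℝ → ℝ) :
    Prop where
  hasDerivAt : ∀ e x, HasDerivAt (v e) (v' e x) x
  hasDerivAt' : ∀ e x, HasDerivAt (v' e) (v'' e x) x
  continuous'' : ∀ e, Continuous (v'' e)
  equation : ∀ e, ∀ x ∈ Icc 0 (G.len e), v'' e x = v e x - max (v e x) 0 ^ p
  vertex : ∃ val : V → ℝ, ∀ e, v e 0 = val (G.src e) ∧ v e (G.len e) = val (G.tgt e)
  kirchhoff : ∀ w, (∑ e with G.src e = w, v' e 0) + ∑ e with G.tgt e = w, -v' e (G.len e) = 0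

/-- On a graph with long edges and a pendant edge `e₁` there is a solution exponentially close to
the soliton on `e₁`. -/
theorem exists_solution_near_soliton (V E : Type*) [Fintype E] {p : ℝ} (hp : 1 < p) :
    ∃ L C : ℝ, 0 < C ∧ ∀ (G : MetricGraph V E) (e₁ : E), (∀ e, L ≤ G.len e) →
      (∀ e, G.src e = G.src e₁ → e = e₁) → (∀ e, G.tgt e ≠ G.src e₁) →
      ∃ v v' v'' : E → ℝ → ℝ, G.IsTransmissionSolution p v v' v'' ∧
        ∀ e, ∀ x ∈ Icc 0 (G.len e), |v e x - solitonOn p e₁ e x| ≤ C * Real.exp (-G.len e₁) ∧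
          |v' e x - solitonOnDeriv p e₁ e x| ≤ C * Real.exp (-G.len e₁) := by
  classical
  obtain ⟨K₀, L₀, hsys⟩ := exists_solitonSystem (show 0 < (p - 1) / 2 by linarith)
  obtain ⟨K₁, hK₁, hU⟩ := exists_soliton_bound hp
  set K := max (max K₀ K₁) 1 with hKdef
  have hK : 1 ≤ K := le_max_right _ _
  have hK0 : 0 < K := by linarith
  have hK₁K : K₁ ≤ K := (le_max_right _ _).trans (le_max_left _ _)
  obtain ⟨D₁, hq, hQ'⟩ := hsys K ((le_max_left _ _).trans (le_max_left _ _))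
  set ε := 1 / (32 * K ^ 6) with hε
  have hε0 : 0 < ε := by positivity
  obtain ⟨δ, hδ, hLip⟩ := exists_powRemainder_lipschitz hp (soliton p 0) hε0
  have hexp : Tendsto (fun x : ℝ => Real.exp (-x)) atTop (𝓝 0) :=
    Real.tendsto_exp_neg_atTop_nhds_zero
  -- The bound by `ε` gives the contraction, since `16 * K ^ 6 * (ε + ε) = 1`. The bound by `δ / (12
  -- * K ^ 4)` makes the correction, at most `12 * K ^ 3 * (K * η)`, smaller than `δ`. The
  -- thresholds are fixed before the graph, so they apply to all its rescalings simultaneously.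
  obtain ⟨L₁, hL₁⟩ := (hexp.eventually (Iic_mem_nhds
    (show (0 : ℝ) < min ε (δ / (12 * K ^ 4)) by positivity))).exists
  refine ⟨max L₀ L₁, 36 * K ^ 6, by positivity, fun G e₁ hlen hsrc htgt => ?_⟩
  have hlen0 : ∀ e, L₀ ≤ G.len e := fun e => (le_max_left _ _).trans (hlen e)
  have hlen1 : ∀ e, L₁ ≤ G.len e := fun e => (le_max_right _ _).trans (hlen e)
  let D : E → FundamentalSystem K L₀ := fun e => if e = e₁ then D₁ else expSystem hK L₀
  have hD₁ : D e₁ = D₁ := if_pos rfl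
  have hD : ∀ e, e ≠ e₁ → D e = expSystem hK L₀ := fun e he => if_neg he
  let B := solitonOn p e₁
  let B' := solitonOnDeriv p e₁
  have hB0 : ∀ e x, 0 ≤ B e x := fun e x => by
    simp only [B, solitonOn]; split_ifs
    exacts [(soliton_pos hp x).le, le_rfl]
  have hBle : ∀ e x, B e x ≤ soliton p 0 := fun e x => by
    simp only [B, solitonOn]; split_ifs
    exacts [soliton_le_soliton_zero hp x, (soliton_pos hp 0).le]
  have hBd : ∀ e x, HasDerivAt (B e) (B' e x) x := hasDerivAt_solitonOn hp e₁
  have hBd' : ∀ e x, HasDerivAt (B' e) (B e x - B e x ^ p) x := hasDerivAt_solitonOnDeriv hp e₁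
  have hBc : ∀ e, Continuous (B e) := continuous_solitonOn hp e₁
  have hqB : ∀ e x, (D e).q x = 1 - p * B e x ^ (p - 1) := fun e x => by
    by_cases he : e = e₁
    · subst he
      simp only [hD₁, hq, B, solitonOn, if_true, solitonPotential_eq hp]
    · simp only [hD e he, B, solitonOn, if_neg he, Real.zero_rpow (show p - 1 ≠ 0 by linarith)]
      simp [expSystem]
  -- Truncation makes the small Lipschitz constant global, as the contraction requires; the size
  -- bound on the solution later shows that the truncation is inactive.
  let F : E → ℝ → ℝ → ℝ := fun e x t => powRemainder p (B e x) (truncate δ t)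
  -- The offsets are the value and the outgoing slope of the soliton at the far end of `e₁`: the
  -- only defect of the approximate solution.
  let o : E → ℝ := fun e => B e (G.len e)
  let o' : E → ℝ := fun e => -B' e (G.len e)
  set η := Real.exp (-G.len e₁) with hη
  have hη0 : 0 < η := Real.exp_pos _
  have hO : 0 ≤ K * η := by positivity
  have ho : ∀ e, |o e| ≤ K * η := fun e => by
    simp only [o, B, solitonOn]
    split_ifs with he
    · rw [he, abs_of_pos (soliton_pos hp _)]
      exact (hU _).1.trans (mul_le_mul_of_nonneg_right hK₁K hη0.le)
    · simpa using hO
  have ho' : ∀ e, |o' e| ≤ K * η := fun e => by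
    simp only [o', B', solitonOnDeriv, abs_neg]
    split_ifs with he
    · rw [he]
      exact (hU _).2.trans (mul_le_mul_of_nonneg_right hK₁K hη0.le)
    · simpa using hO
  have hηL : η ≤ Real.exp (-L₁) := Real.exp_le_exp.2 (neg_le_neg (hlen1 e₁))
  obtain ⟨a, b, f, hfc, ha, hb, hf, hs, hs'⟩ := G.exists_transmission_solution D hK hlen1 hlen0
    hε0.le (by
      have h1 : Real.exp (-L₁) ≤ ε := hL₁.trans (min_le_left _ _)
      have h2 : 32 * K ^ 6 * ε = 1 := by rw [hε]; field_simp
      have h3 : 0 ≤ K ^ 6 := by positivity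
      nlinarith) F
    (fun e ψ hψ => continuous_powRemainder hp (hBc e) ((continuous_truncate δ).comp hψ))
    (fun e x => by
      simp only [F]
      rw [truncate_eq (by simpa using hδ.le), powRemainder_zero (hB0 e x)])
    (fun e x s t => (hLip _ (hB0 e x) (hBle e x) _ (truncate_mem hδ.le s) _
      (truncate_mem hδ.le t)).trans (mul_le_mul_of_nonneg_left (abs_truncate_sub_le _ _ _) hε0.le))
    e₁ hO ho ho'
  let S : E → ℝ → ℝ := fun e => (D e).sol (G.len e) (a e) (b e) (f e)
  let S' : E → ℝ → ℝ := fun e => (D e).solDeriv (G.len e) (a e) (b e) (f e)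
  have hSδ : ∀ e, ∀ x ∈ Icc 0 (G.len e), |S e x| ≤ δ := fun e x hx => by
    refine (hs e x hx).trans ?_
    have h1 : η ≤ δ / (12 * K ^ 4) := hηL.trans (hL₁.trans (min_le_right _ _))
    rw [le_div_iff₀ (by positivity)] at h1
    calc _ = η * (12 * K ^ 4) := by ring
      _ ≤ δ := h1
  refine ⟨fun e x => B e x + S e x, fun e x => B' e x + S' e x,
    fun e x => (B e x - B e x ^ p) + ((D e).q x * S e x - f e x),
    ⟨fun e x => (hBd e x).add ((D e).hasDerivAt_sol (hfc e) _ _ x),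
     fun e x => (hBd' e x).add ((D e).hasDerivAt_solDeriv (hfc e) _ _ x), fun e => ?_,
     fun e x hx => ?_, ?_, fun w => ?_⟩, fun e x hx => ⟨?_, ?_⟩⟩
  · have h1 : Continuous fun x => B e x ^ p := (hBc e).rpow_const fun _ => Or.inr (by linarith)
    exact ((hBc e).sub h1).add (((D e).continuous_q.mul
      ((D e).continuous_sol (hfc e) _ _)).sub (hfc e))
  · have h1 : f e x = powRemainder p (B e x) (S e x) := by
      rw [hf e x hx]
      change powRemainder p (B e x) (truncate δ (S e x)) = _
      rw [truncate_eq (hSδ e x hx)]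
    simp only [h1, hqB, powRemainder]
    ring
  · refine ⟨fun w => if w = G.src e₁ then B e₁ 0 + S e₁ 0 else G.vertexVal D a b f o o' w,
      fun e => ⟨?_, ?_⟩⟩
    · by_cases he : e = e₁
      · subst he; simp
      · have hne : G.src e ≠ G.src e₁ := fun h => he (hsrc e h)
        have h1 : B e 0 = 0 := if_neg he
        have h2 := sol_zero_of_newSrc (G := G) (D := D) he (by simp [hD e he, expSystem])
          (by simp [hD e he, expSystem]) (ha e)
        simp only [if_neg hne, h1, zero_add]
        exact h2
    · simp only [if_neg (htgt e)]
      rw [← sol_len_of_newTgt hlen0 (hb e), add_comm]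
  · by_cases hw : w = G.src e₁
    · subst hw
      have h1 : Finset.univ.filter (fun e => G.src e = G.src e₁) = {e₁} := by
        ext e; simp only [Finset.mem_filter, Finset.mem_univ, true_and, Finset.mem_singleton]
        exact ⟨hsrc e, fun h => by rw [h]⟩
      have h2 : Finset.univ.filter (fun e => G.tgt e = G.src e₁) = ∅ := by
        ext e; simp [htgt e]
      rw [h1, h2, Finset.sum_singleton, Finset.sum_empty, add_zero]
      have h3 : B' e₁ 0 = 0 := by simp [B', solitonOnDeriv, solitonDeriv_zero]
      -- At the pendant vertex both the soliton and the growing solution have zero slope, so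
      -- Kirchhoff's condition amounts to the vanishing of this amplitude.
      have h4 : a e₁ = 0 := by rw [ha, newSrc, if_pos rfl]
      have h5 : (D e₁).Q' 0 = 0 := by rw [hD₁, hQ']
      have h6 : (D e₁).intQ (f e₁) 0 = 0 := by simp [FundamentalSystem.intQ]
      simp only [h3, S', FundamentalSystem.solDeriv, h4, h5, h6]
      simp
    · have h1 := kirchhoff_of_new (G := G) (D := D) hlen0 hw
        (fun e he => by simp [hD e he, expSystem])
        (fun e he => by simp [hD e he, expSystem]) ha hb
      refine Eq.trans ?_ h1
      congr 1
      · refine Finset.sum_congr rfl fun e he => ?_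
        have hne : e ≠ e₁ := fun h => hw (by rw [← (Finset.mem_filter.1 he).2, h])
        have h3 : B' e 0 = 0 := if_neg hne
        rw [h3, zero_add]
      · refine Finset.sum_congr rfl fun e _ => ?_
        simp only [o', S']
        ring
  · have h1 : B e x + S e x - solitonOn p e₁ e x = S e x := add_sub_cancel_left _ _
    rw [h1]
    refine (hs e x hx).trans ?_
    have : K ^ 4 ≤ K ^ 6 := pow_le_pow_right₀ hK (by norm_num)
    have h2 : K ^ 4 * η ≤ K ^ 6 * η := by gcongr
    have h3 : 0 ≤ K ^ 6 * η := by positivity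
    linarith
  · have h1 : B' e x + S' e x - solitonOnDeriv p e₁ e x = S' e x := add_sub_cancel_left _ _
    rw [h1]
    refine (hs' e x hx).trans (le_of_eq ?_)
    ring

end MetricGraph

/-! ### Positivity and the single peak -/

theorem eventually_lt_of_hasDerivAt_neg {v : ℝ → ℝ} {d x : ℝ} (hv : HasDerivAt v d x)
    (hd : d < 0) : ∀ᶠ z in 𝓝[>] x, v z < v x := by
  have h := (hasDerivAt_iff_tendsto_slope.1 hv).mono_left
    (nhdsWithin_mono x fun z (hz : x < z) => hz.ne')
  filter_upwards [h.eventually (gt_mem_nhds hd), self_mem_nhdsWithin] with z hz hxz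
  rw [slope_def_field, div_lt_iff₀ (sub_pos.2 hxz)] at hz
  linarith

/-- A one-sided second derivative test: at a minimum with negative second derivative the slope into
the edge must be strictly positive, also when the minimum is an endpoint. -/
theorem exists_lt_right {v v' : ℝ → ℝ} {c x y : ℝ} (hv : ∀ z, HasDerivAt v (v' z) z)
    (hv' : HasDerivAt v' c x) (h0 : v' x ≤ 0) (hc : c < 0) (hxy : x < y) :
    ∃ z ∈ Ioo x y, v z < v x := by
  obtain ⟨u, hu, hlt⟩ := mem_nhdsGT_iff_exists_Ioo_subset.1 (eventually_lt_of_hasDerivAt_neg hv' hc)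
  obtain ⟨z, hz⟩ := exists_between (lt_min hu hxy)
  refine ⟨z, ⟨hz.1, hz.2.trans_le (min_le_right _ _)⟩, ?_⟩
  obtain ⟨t, ht, hslope⟩ := exists_hasDerivAt_eq_slope v v' hz.1
    (fun w _ => (hv w).continuousAt.continuousWithinAt) (fun w _ => hv w)
  have h1 : v' t < v' x := hlt ⟨ht.1, ht.2.trans (hz.2.trans_le (min_le_left _ _))⟩
  have h2 : (v z - v x) / (z - x) < 0 := hslope ▸ h1.trans_le h0
  rw [div_lt_iff₀ (sub_pos.2 hz.1)] at h2
  linarith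

theorem hasDerivAt_comp_neg {v : ℝ → ℝ} {d x : ℝ} (hv : HasDerivAt v d (-x)) :
    HasDerivAt (fun z => v (-z)) (-d) x := by
  have h := hv.comp x (hasDerivAt_neg x)
  rwa [mul_neg_one] at h

theorem exists_lt_left {v v' : ℝ → ℝ} {c x y : ℝ} (hv : ∀ z, HasDerivAt v (v' z) z)
    (hv' : HasDerivAt v' c x) (h0 : 0 ≤ v' x) (hc : c < 0) (hyx : y < x) :
    ∃ z ∈ Ioo y x, v z < v x := by
  obtain ⟨z, hz, hlt⟩ := exists_lt_right (v := fun z => v (-z)) (v' := fun z => -v' (-z)) (c := c)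
    (x := -x) (y := -y) (fun z => hasDerivAt_comp_neg (hv (-z)))
    (by simpa using (hasDerivAt_comp_neg (x := -x) (by simpa using hv')).fun_neg)
    (by simpa using h0) hc (by linarith)
  exact ⟨-z, ⟨by linarith [hz.2], by linarith [hz.1]⟩, by simpa using hlt⟩

theorem deriv_nonneg_of_min_right {v : ℝ → ℝ} {d x y : ℝ} (hv : HasDerivAt v d x) (hxy : x < y)
    (hmin : ∀ z ∈ Icc x y, v x ≤ v z) : 0 ≤ d := by
  by_contra! hd
  obtain ⟨z, hz1, hz2⟩ := ((eventually_lt_of_hasDerivAt_neg hv hd).and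
    (Ioo_mem_nhdsGT hxy)).exists
  exact (hmin z ⟨hz2.1.le, hz2.2.le⟩).not_gt hz1

theorem deriv_nonpos_of_min_left {v : ℝ → ℝ} {d x y : ℝ} (hv : HasDerivAt v d x) (hyx : y < x)
    (hmin : ∀ z ∈ Icc y x, v x ≤ v z) : d ≤ 0 := by
  have := deriv_nonneg_of_min_right (v := fun z => v (-z)) (d := -d) (x := -x) (y := -y)
    (hasDerivAt_comp_neg (by simpa using hv)) (by linarith)
    (fun z hz => by simpa using hmin (-z) ⟨by linarith [hz.2], by linarith [hz.1]⟩)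
  linarith

/-- A subsolution of `v'' ≤ v` with vanishing Cauchy data stays nonpositive. -/
theorem nonpos_right_of_deriv_le {v v' v'' : ℝ → ℝ} {x y : ℝ} (hv : ∀ z, HasDerivAt v (v' z) z)
    (hv' : ∀ z, HasDerivAt v' (v'' z) z) (h : ∀ z ∈ Icc x y, v'' z ≤ v z) (h0 : v x = 0)
    (h1 : v' x = 0) {z : ℝ} (hz : z ∈ Icc x y) : v z ≤ 0 := by
  have hx : x ∈ Icc x y := ⟨le_rfl, hz.1.trans hz.2⟩
  have he : ∀ z, HasDerivAt (fun z => Real.exp (-z)) (-Real.exp (-z)) z := fun z =>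
    hasDerivAt_comp_neg (Real.hasDerivAt_exp _)
  -- The factorisation of `v'' - v` as `(d/dx - 1)(d/dx + 1) v`, each factor with its integrating
  -- factor, replaces ODE uniqueness by two monotonicity statements.
  have hd1 : ∀ z, HasDerivAt (fun z => (v' z + v z) * Real.exp (-z))
      ((v'' z - v z) * Real.exp (-z)) z := fun z =>
    (((hv' z).add (hv z)).mul (he z)).congr_deriv (by simp only [Pi.add_apply]; ring)
  have hd2 : ∀ z, HasDerivAt (fun z => v z * Real.exp z) ((v' z + v z) * Real.exp z) z := fun z =>
    ((hv z).mul (Real.hasDerivAt_exp z)).congr_deriv (by ring)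
  have ha1 : AntitoneOn (fun z => (v' z + v z) * Real.exp (-z)) (Icc x y) := by
    refine antitoneOn_of_deriv_nonpos (convex_Icc x y)
      (fun z _ => (hd1 z).continuousAt.continuousWithinAt)
      (fun z _ => (hd1 z).differentiableAt.differentiableWithinAt) fun w hw => ?_
    rw [(hd1 w).deriv]
    have := h w (interior_subset hw)
    exact mul_nonpos_of_nonpos_of_nonneg (by linarith) (Real.exp_pos _).le
  have ha2 : AntitoneOn (fun z => v z * Real.exp z) (Icc x y) := by
    refine antitoneOn_of_deriv_nonpos (convex_Icc x y)
      (fun z _ => (hd2 z).continuousAt.continuousWithinAt)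
      (fun z _ => (hd2 z).differentiableAt.differentiableWithinAt) fun w hw => ?_
    rw [(hd2 w).deriv]
    have hw := interior_subset hw
    have h2 : (v' w + v w) * Real.exp (-w) ≤ (v' x + v x) * Real.exp (-x) := ha1 hx hw hw.1
    rw [h0, h1, add_zero, zero_mul] at h2
    have h3 : v' w + v w ≤ 0 := nonpos_of_mul_nonpos_left h2 (Real.exp_pos _)
    exact mul_nonpos_of_nonpos_of_nonneg h3 (Real.exp_pos _).le
  have h4 : v z * Real.exp z ≤ v x * Real.exp x := ha2 hx hz hz.1
  rw [h0, zero_mul] at h4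
  exact nonpos_of_mul_nonpos_left h4 (Real.exp_pos _)

theorem nonpos_of_deriv_le {v v' v'' : ℝ → ℝ} {x L : ℝ} (hv : ∀ z, HasDerivAt v (v' z) z)
    (hv' : ∀ z, HasDerivAt v' (v'' z) z) (h : ∀ z ∈ Icc 0 L, v'' z ≤ v z) (hx : x ∈ Icc 0 L)
    (h0 : v x = 0) (h1 : v' x = 0) {z : ℝ} (hz : z ∈ Icc 0 L) : v z ≤ 0 := by
  rcases le_total x z with hxz | hxz
  · exact nonpos_right_of_deriv_le hv hv' (fun w hw => h w ⟨hx.1.trans hw.1, hw.2⟩) h0 h1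
      ⟨hxz, hz.2⟩
  · have := nonpos_right_of_deriv_le (v := fun z => v (-z)) (v' := fun z => -v' (-z))
      (v'' := fun z => v'' (-z)) (x := -x) (y := 0) (fun z => hasDerivAt_comp_neg (hv (-z)))
      (fun z => by simpa using (hasDerivAt_comp_neg (hv' (-z))).fun_neg)
      (fun w hw => h (-w) ⟨by linarith [hw.2], by linarith [hw.1, hx.2]⟩)
      (by simpa using h0) (by simpa using h1) (z := -z) ⟨by linarith, by linarith [hz.1]⟩
    simpa using this

namespace MetricGraph

variable {V E : Type*} [Fintype E] {G : MetricGraph V E} {p : ℝ} {v v' v'' : E → ℝ → ℝ}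

namespace IsTransmissionSolution

/-- At a negative global minimum the positive part vanishes and `v'' = v < 0`. An interior minimum
is then impossible, and at a vertex all outgoing slopes would be strictly positive, against
Kirchhoff's condition. -/
theorem nonneg (h : G.IsTransmissionSolution p v v' v'') (hp : 1 < p) {e : E} {x : ℝ}
    (hx : x ∈ Icc 0 (G.len e)) : 0 ≤ v e x := by
  classical
  have hmin : ∀ e, ∃ y ∈ Icc 0 (G.len e), ∀ z ∈ Icc 0 (G.len e), v e y ≤ v e z := fun e => by
    obtain ⟨y, hy, hy'⟩ := (isCompact_Icc (a := 0) (b := G.len e)).exists_isMinOn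
      ⟨0, le_rfl, (G.len_pos e).le⟩
      (fun z _ => (h.hasDerivAt e z).continuousAt.continuousWithinAt)
    exact ⟨y, hy, fun z hz => hy' hz⟩
  choose y hy hymin using hmin
  have : Nonempty E := ⟨e⟩
  obtain ⟨e₀, he₀⟩ := Finite.exists_min fun e => v e (y e)
  have hglob : ∀ e, ∀ z ∈ Icc 0 (G.len e), v e₀ (y e₀) ≤ v e z := fun e z hz =>
    (he₀ e).trans (hymin e z hz)
  set m := v e₀ (y e₀) with hm
  refine le_trans ?_ (hglob e x hx)
  by_contra! hneg
  obtain ⟨val, hval⟩ := h.vertex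
  have hv'' : ∀ e, ∀ z ∈ Icc 0 (G.len e), v e z = m → v'' e z < 0 := fun e z hz hzm => by
    rw [h.equation e z hz, hzm, max_eq_right hneg.le, Real.zero_rpow (by linarith), sub_zero]
    exact hneg
  have hright : ∀ e, ∀ z ∈ Icc 0 (G.len e), z < G.len e → v e z = m → 0 < v' e z := by
    intro e z hz hzl hzm
    by_contra! h0
    obtain ⟨t, ht, hlt⟩ := exists_lt_right (h.hasDerivAt e) (h.hasDerivAt' e z) h0
      (hv'' e z hz hzm) hzl
    exact (hglob e t ⟨hz.1.trans ht.1.le, ht.2.le⟩).not_gt (hzm ▸ hlt)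
  have hleft : ∀ e, ∀ z ∈ Icc 0 (G.len e), 0 < z → v e z = m → v' e z < 0 := by
    intro e z hz hzl hzm
    by_contra! h0
    obtain ⟨t, ht, hlt⟩ := exists_lt_left (h.hasDerivAt e) (h.hasDerivAt' e z) h0
      (hv'' e z hz hzm) hzl
    exact (hglob e t ⟨ht.1.le, ht.2.le.trans hz.2⟩).not_gt (hzm ▸ hlt)
  have hvert : ∀ w, val w = m → ∀ e, G.src e ≠ w ∧ G.tgt e ≠ w := by
    intro w hw
    have hs : ∀ e ∈ Finset.univ.filter (fun e => G.src e = w), 0 < v' e 0 := fun e he =>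
      hright e 0 ⟨le_rfl, (G.len_pos e).le⟩ (G.len_pos e)
        (by rw [(hval e).1, (Finset.mem_filter.1 he).2, hw])
    have ht : ∀ e ∈ Finset.univ.filter (fun e => G.tgt e = w), 0 < -v' e (G.len e) := fun e he =>
      neg_pos.2 (hleft e _ ⟨(G.len_pos e).le, le_rfl⟩ (G.len_pos e)
        (by rw [(hval e).2, (Finset.mem_filter.1 he).2, hw]))
    have hk := h.kirchhoff w
    have hs0 := Finset.sum_nonneg fun e he => (hs e he).le
    have ht0 := Finset.sum_nonneg fun e he => (ht e he).le
    intro e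
    constructor
    · intro he
      have := (Finset.sum_eq_zero_iff_of_nonneg fun e he => (hs e he).le).1
        (show ∑ e with G.src e = w, v' e 0 = 0 by linarith) e (by simp [he])
      exact (hs e (by simp [he])).ne' this
    · intro he
      have := (Finset.sum_eq_zero_iff_of_nonneg fun e he => (ht e he).le).1
        (show ∑ e with G.tgt e = w, -v' e (G.len e) = 0 by linarith) e (by simp [he])
      exact (ht e (by simp [he])).ne' this
  rcases (hy e₀).1.eq_or_lt with h0 | h0
  · exact (hvert (G.src e₀) (by rw [← (hval e₀).1, hm, ← h0]) e₀).1 rfl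
  rcases (hy e₀).2.eq_or_lt with h1 | h1
  · exact (hvert (G.tgt e₀) (by rw [← (hval e₀).2, hm, h1]) e₀).2 rfl
  exact lt_asymm (hright e₀ _ (hy e₀) h1 rfl) (hleft e₀ _ (hy e₀) h0 rfl)

/-- At a zero of a nonnegative solution the slopes vanish too: in the interior because it is a
minimum, at a vertex because nonnegative outgoing slopes sum to zero. The inequality `v'' ≤ v` then
forces `v = 0` on the whole edge, and connectedness carries the zero to the initial vertex of `e₁`.
-/
theorem pos (h : G.IsTransmissionSolution p v v' v'') (hp : 1 < p) (hconn : G.IsConnected)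
    {e₁ : E} (h₁ : v e₁ 0 ≠ 0) {e : E} {x : ℝ} (hx : x ∈ Icc 0 (G.len e)) : 0 < v e x := by
  classical
  refine (h.nonneg hp hx).lt_of_ne' fun hzero => h₁ ?_
  obtain ⟨val, hval⟩ := h.vertex
  have hle : ∀ e, ∀ z ∈ Icc 0 (G.len e), v'' e z ≤ v e z := fun e z hz => by
    rw [h.equation e z hz]
    have : 0 ≤ max (v e z) 0 ^ p := Real.rpow_nonneg (le_max_right _ _) _
    linarith
  have hedge : ∀ e, ∀ y ∈ Icc 0 (G.len e), v e y = 0 → v' e y = 0 →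
      ∀ z ∈ Icc 0 (G.len e), v e z = 0 := fun e y hy h0 h1 z hz =>
    le_antisymm (nonpos_of_deriv_le (h.hasDerivAt e) (h.hasDerivAt' e) (hle e) hy h0 h1 hz)
      (h.nonneg hp hz)
  have hI0 : ∀ e, (0 : ℝ) ∈ Icc 0 (G.len e) := fun e => ⟨le_rfl, (G.len_pos e).le⟩
  have hIL : ∀ e, G.len e ∈ Icc 0 (G.len e) := fun e => ⟨(G.len_pos e).le, le_rfl⟩
  have hvert : ∀ w, val w = 0 → ∀ e, (G.src e = w → val (G.tgt e) = 0) ∧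
      (G.tgt e = w → val (G.src e) = 0) := by
    intro w hw
    have hs : ∀ e ∈ Finset.univ.filter (fun e => G.src e = w), 0 ≤ v' e 0 := fun e he => by
      have h0 : v e 0 = 0 := by rw [(hval e).1, (Finset.mem_filter.1 he).2, hw]
      exact deriv_nonneg_of_min_right (h.hasDerivAt e 0) (G.len_pos e) fun z hz => by
        rw [h0]; exact h.nonneg hp hz
    have ht : ∀ e ∈ Finset.univ.filter (fun e => G.tgt e = w), 0 ≤ -v' e (G.len e) :=
      fun e he => by
      have h0 : v e (G.len e) = 0 := by rw [(hval e).2, (Finset.mem_filter.1 he).2, hw]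
      exact neg_nonneg.2 (deriv_nonpos_of_min_left (h.hasDerivAt e _) (G.len_pos e) fun z hz => by
        rw [h0]; exact h.nonneg hp hz)
    have hk := h.kirchhoff w
    have hs0 := Finset.sum_nonneg hs
    have ht0 := Finset.sum_nonneg ht
    intro e
    constructor
    · intro he
      have h1 := (Finset.sum_eq_zero_iff_of_nonneg hs).1 (by linarith) e (by simp [he])
      rw [← (hval e).2]
      exact hedge e 0 (hI0 e) (by rw [(hval e).1, he, hw]) h1 _ (hIL e)
    · intro he
      have h1 := (Finset.sum_eq_zero_iff_of_nonneg ht).1 (by linarith) e (by simp [he])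
      rw [← (hval e).1]
      exact hedge e _ (hIL e) (by rw [(hval e).2, he, hw]) (by linarith) _ (hI0 e)
  have hstart : val (G.src e) = 0 := by
    rcases hx.1.eq_or_lt with h0 | h0
    · exact (hval e).1.symm.trans ((congrArg (v e) h0).trans hzero)
    rcases hx.2.eq_or_lt with h2 | h2
    · exact (hvert (G.tgt e) (by rw [← (hval e).2, ← h2, hzero]) e).2 rfl
    rw [← (hval e).1]
    refine hedge e x hx hzero (le_antisymm ?_ ?_) 0 (hI0 e)
    · exact deriv_nonpos_of_min_left (h.hasDerivAt e x) h0 fun z hz => by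
        rw [hzero]; exact h.nonneg hp ⟨hz.1, hz.2.trans hx.2⟩
    · exact deriv_nonneg_of_min_right (h.hasDerivAt e x) h2 fun z hz => by
        rw [hzero]; exact h.nonneg hp ⟨hx.1.trans hz.1, hz.2⟩
  have hwalk : ∀ {u w : V}, (SimpleGraph.fromRel fun v w => ∃ e, G.src e = v ∧ G.tgt e = w).Walk
      u w → val u = 0 → val w = 0 := by
    intro u w q
    induction q with
    | nil => exact id
    | cons hadj _ ih =>
      intro hu
      refine ih ?_
      rcases ((SimpleGraph.fromRel_adj _ _ _).1 hadj).2 with ⟨e, rfl, rfl⟩ | ⟨e, rfl, rfl⟩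
      · exact (hvert _ hu e).1 rfl
      · exact (hvert _ hu e).2 rfl
  obtain ⟨q⟩ := hconn.preconnected (G.src e) (G.src e₁)
  rw [(hval e₁).1]
  exact hwalk q hstart

end IsTransmissionSolution

/-- A solution close to the soliton on `e₁` has its maximum exactly at the initial point of
`e₁`. -/
theorem exists_peak_threshold (V E : Type*) [Fintype E] {p : ℝ} (hp : 1 < p) :
    ∃ η > 0, ∀ (G : MetricGraph V E) (e₁ : E), (∀ e, G.src e = G.src e₁ → e = e₁) →
      (∀ e, G.tgt e ≠ G.src e₁) → ∀ v v' v'' : E → ℝ → ℝ, G.IsTransmissionSolution p v v' v'' →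
      (∀ e, ∀ x ∈ Icc 0 (G.len e), |v e x - solitonOn p e₁ e x| ≤ η) →
      v e₁ 0 ≠ 0 ∧ ∀ e, ∀ x ∈ Icc 0 (G.len e), (e, x) ≠ (e₁, 0) → v e x < v e₁ 0 := by
  classical
  obtain ⟨x₀, hx₀, hU₀⟩ : ∃ x₀ > 0, 1 < soliton p x₀ := by
    have h1 := (continuous_soliton hp).continuousAt.eventually
      (lt_mem_nhds (one_lt_soliton_zero hp))
    have h2 : ∀ᶠ x in 𝓝[>] (0 : ℝ), 1 < soliton p x := nhdsWithin_le_nhds h1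
    obtain ⟨x, hx1, hx2⟩ := (h2.and self_mem_nhdsWithin).exists
    exact ⟨x, hx2, hx1⟩
  have hlt : soliton p x₀ < soliton p 0 := soliton_strictAntiOn hp (by simp) hx₀.le hx₀
  -- The first bound keeps `v > 1` on `[0, x₀]`; the second separates `v e₁ 0` from all values
  -- beyond `x₀` and on the other edges.
  refine ⟨min ((soliton p x₀ - 1) / 2) ((soliton p 0 - soliton p x₀) / 3),
    lt_min (by linarith) (by linarith), fun G e₁ hsrc htgt v v' v'' h hclose => ?_⟩
  set η := min ((soliton p x₀ - 1) / 2) ((soliton p 0 - soliton p x₀) / 3) with hη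
  have hη1 : η ≤ (soliton p x₀ - 1) / 2 := min_le_left _ _
  have hη2 : η ≤ (soliton p 0 - soliton p x₀) / 3 := min_le_right _ _
  have h₁ : ∀ x ∈ Icc 0 (G.len e₁), |v e₁ x - soliton p x| ≤ η := fun x hx => by
    simpa [solitonOn] using hclose e₁ x hx
  have h0 := (abs_le.1 (h₁ 0 ⟨le_rfl, (G.len_pos e₁).le⟩)).1
  refine ⟨by intro hz; rw [hz] at h0; linarith, fun e x hx hne => ?_⟩
  by_cases he : e = e₁
  swap
  · have := (abs_le.1 (hclose e x hx)).2
    rw [solitonOn, if_neg he, sub_zero] at this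
    linarith
  subst he
  have hx0 : 0 < x := hx.1.lt_of_ne' fun h => hne (by rw [h])
  rcases le_total x₀ x with hxx | hxx
  · have h3 := (abs_le.1 (h₁ x hx)).2
    have h4 : soliton p x ≤ soliton p x₀ :=
      (soliton_strictAntiOn hp).antitoneOn hx₀.le hx.1 hxx
    linarith
  have hk : v' e 0 = 0 := by
    have := h.kirchhoff (G.src e)
    have h1 : Finset.univ.filter (fun e' => G.src e' = G.src e) = {e} := by
      ext e'; simp only [Finset.mem_filter, Finset.mem_univ, true_and, Finset.mem_singleton]
      exact ⟨hsrc e', fun h => by rw [h]⟩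
    have h2 : Finset.univ.filter (fun e' => G.tgt e' = G.src e) = ∅ := by
      ext e'; simp [htgt e']
    rwa [h1, h2, Finset.sum_singleton, Finset.sum_empty, add_zero] at this
  -- Closeness alone cannot locate the maximum near `0`. There `v > 1` gives `v'' = v - v ^ p < 0`,
  -- so the slope, zero at the vertex, becomes negative at once.
  have hanti' : StrictAntiOn (v' e) (Icc 0 x) := by
    refine strictAntiOn_of_deriv_neg (convex_Icc 0 x)
      (fun z _ => (h.hasDerivAt' e z).continuousAt.continuousWithinAt) fun z hz => ?_
    have hz := interior_subset hz
    have hzI : z ∈ Icc 0 (G.len e) := ⟨hz.1, hz.2.trans hx.2⟩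
    rw [(h.hasDerivAt' e z).deriv, h.equation e z hzI]
    have h3 := (abs_le.1 (h₁ z hzI)).1
    have h4 : soliton p x₀ ≤ soliton p z :=
      (soliton_strictAntiOn hp).antitoneOn hz.1 hx₀.le (hz.2.trans hxx)
    have h5 : 1 < v e z := by linarith
    rw [max_eq_left (by linarith), sub_neg]
    simpa using Real.rpow_lt_rpow_of_exponent_lt h5 hp
  have hanti : StrictAntiOn (v e) (Icc 0 x) := by
    refine strictAntiOn_of_deriv_neg (convex_Icc 0 x)
      (fun z _ => (h.hasDerivAt e z).continuousAt.continuousWithinAt) fun z hz => ?_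
    rw [interior_Icc] at hz
    rw [(h.hasDerivAt e z).deriv, ← hk]
    exact hanti' ⟨le_rfl, hx0.le⟩ ⟨hz.1.le, hz.2.le⟩ hz.1
  exact hanti ⟨le_rfl, hx0.le⟩ ⟨hx0.le, le_rfl⟩ hx0

end MetricGraph

/-! ### Weak derivatives of continuously differentiable functions -/

theorem memLp_restrict_Ioo {f : ℝ → ℝ} (hf : Continuous f) (l : ℝ) (q : ENNReal) :
    MemLp f q (volume.restrict (Ioo 0 l)) := by
  obtain ⟨C, hC⟩ := (isCompact_Icc (a := 0) (b := l)).exists_bound_of_continuousOn hf.continuousOn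
  refine MemLp.of_bound hf.aestronglyMeasurable C ?_
  filter_upwards [ae_restrict_mem measurableSet_Ioo] with x hx
  exact hC x (Ioo_subset_Icc_self hx)

theorem setIntegral_Ioo_eq {f : ℝ → ℝ} {l : ℝ} (hl : 0 ≤ l) :
    ∫ x in Ioo 0 l, f x = ∫ x in (0 : ℝ)..l, f x := by
  rw [intervalIntegral.integral_of_le hl, integral_Ioc_eq_integral_Ioo]

theorem isWeakDerivL2_of_hasDerivAt {l : ℝ} (hl : 0 ≤ l) {f f' : ℝ → ℝ}
    (hf : ∀ x, HasDerivAt f (f' x) x) (hf' : Continuous f') : IsWeakDerivL2 l f f' := by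
  refine ⟨memLp_restrict_Ioo hf' l 2, fun ψ hψ _ hs => ?_⟩
  rw [setIntegral_Ioo_eq hl, setIntegral_Ioo_eq hl]
  have h0 : ψ 0 = 0 := image_eq_zero_of_notMem_tsupport fun h => (hs h).1.false
  have h1 : ψ l = 0 := image_eq_zero_of_notMem_tsupport fun h => (hs h).2.false
  have hd : Differentiable ℝ ψ := hψ.differentiable (by simp)
  rw [intervalIntegral.integral_mul_deriv_eq_deriv_mul (fun x _ => hf x)
    (fun x _ => (hd x).hasDerivAt) (hf'.intervalIntegrable _ _)
    ((hψ.continuous_deriv (by simp)).intervalIntegrable _ _), h0, h1]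
  simp

theorem memH1Interval_of_hasDerivAt {l : ℝ} (hl : 0 ≤ l) {f f' : ℝ → ℝ}
    (hf : ∀ x, HasDerivAt f (f' x) x) (hf' : Continuous f') : MemH1Interval l f :=
  ⟨memLp_restrict_Ioo (continuous_iff_continuousAt.2 fun x => (hf x).continuousAt) l 2, f',
    isWeakDerivL2_of_hasDerivAt hl hf hf'⟩

/-- Square-integrable weak derivatives are unique almost everywhere. -/
theorem IsWeakDerivL2.ae_eq {l : ℝ} {f g h : ℝ → ℝ} (hg : IsWeakDerivL2 l f g)
    (hh : IsWeakDerivL2 l f h) : g =ᵐ[volume.restrict (Ioo 0 l)] h := by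
  have hsub : MemLp (g - h) 2 (volume.restrict (Ioo 0 l)) := hg.1.sub hh.1
  have hloc : LocallyIntegrableOn (g - h) (Ioo 0 l) volume :=
    IntegrableOn.locallyIntegrableOn (hsub.integrable (by norm_num))
  have key := isOpen_Ioo.ae_eq_zero_of_integral_contDiff_smul_eq_zero hloc
    fun ψ hψ hψc hψs => by
      have hzero : ∀ x, x ∉ Ioo 0 l → ψ x • (g - h) x = 0 := fun x hx => by
        rw [image_eq_zero_of_notMem_tsupport fun h => hx (hψs h), zero_smul]
      rw [← setIntegral_eq_integral_of_forall_compl_eq_zero hzero]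
      have hψ2 := memLp_restrict_Ioo hψ.continuous l 2
      have i1 : Integrable (fun x => g x * ψ x) (volume.restrict (Ioo 0 l)) :=
        hg.1.integrable_mul hψ2
      have i2 : Integrable (fun x => h x * ψ x) (volume.restrict (Ioo 0 l)) :=
        hh.1.integrable_mul hψ2
      have e1 := hg.2 ψ hψ hψc hψs
      have e2 := hh.2 ψ hψ hψc hψs
      have e3 : ∀ x, ψ x • (g - h) x = g x * ψ x - h x * ψ x := fun x => by
        simp only [smul_eq_mul, Pi.sub_apply]; ring
      simp only [e3]
      rw [integral_sub i1 i2]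
      linarith
  rw [EventuallyEq, ae_restrict_iff' measurableSet_Ioo]
  filter_upwards [key] with x hx hxI
  exact sub_eq_zero.1 (hx hxI)

/-- Since `weakDeriv` is an arbitrary choice, almost everywhere uniqueness is what lets `lamNorm` be
computed with classical derivatives. -/
theorem weakDeriv_ae_eq {l : ℝ} {f g : ℝ → ℝ} (hg : IsWeakDerivL2 l f g) :
    weakDeriv l f =ᵐ[volume.restrict (Ioo 0 l)] g := by
  have hex : ∃ g, IsWeakDerivL2 l f g := ⟨g, hg⟩
  rw [weakDeriv, dif_pos hex]
  exact hex.choose_spec.ae_eq hg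

/-! ### Twice continuously differentiable functions -/

theorem contDiff_two_of_hasDerivAt {f f' f'' : ℝ → ℝ} (hf : ∀ x, HasDerivAt f (f' x) x)
    (hf' : ∀ x, HasDerivAt f' (f'' x) x) (hf'' : Continuous f'') : ContDiff ℝ 2 f := by
  have e1 : deriv f = f' := funext fun x => (hf x).deriv
  have e2 : deriv f' = f'' := funext fun x => (hf' x).deriv
  rw [show (2 : WithTop ℕ∞) = 1 + 1 by norm_num, contDiff_succ_iff_deriv]
  refine ⟨fun x => (hf x).differentiableAt, by simp, ?_⟩
  rw [e1, contDiff_one_iff_deriv, e2]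
  exact ⟨fun x => (hf' x).differentiableAt, hf''⟩

theorem iteratedDerivWithin_two_of_hasDerivAt {f f' f'' : ℝ → ℝ}
    (hf : ∀ x, HasDerivAt f (f' x) x) (hf' : ∀ x, HasDerivAt f' (f'' x) x)
    (hf'' : Continuous f'') {l : ℝ} (hl : 0 < l) {x : ℝ} (hx : x ∈ Icc 0 l) :
    iteratedDerivWithin 2 f (Icc 0 l) x = f'' x := by
  rw [iteratedDerivWithin_eq_iteratedDeriv (uniqueDiffOn_Icc hl)
    (contDiff_two_of_hasDerivAt hf hf' hf'').contDiffAt hx, iteratedDeriv_succ, iteratedDeriv_one,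
    show deriv f = f' from funext fun x => (hf x).deriv, (hf' x).deriv]

/-! ### Rescaling to the original equation. -/

namespace MetricGraph

variable {V E : Type*} (G : MetricGraph V E)

/-- The graph with all lengths multiplied by `s`. -/
@[simps]
def scale {s : ℝ} (hs : 0 < s) : MetricGraph V E where
  src := G.src
  tgt := G.tgt
  len e := s * G.len e
  len_pos e := mul_pos hs (G.len_pos e)

variable [Fintype E] {G}

theorem l2Norm_pos [Nonempty E] {u : E → ℝ → ℝ} (hc : ∀ e, Continuous (u e))
    (hpos : ∀ e, ∀ x ∈ G.edge e, 0 < u e x) : 0 < G.l2Norm u := by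
  refine Real.sqrt_pos.2 (Finset.sum_pos (fun e _ => ?_) Finset.univ_nonempty)
  rw [setIntegral_Ioo_eq (G.len_pos e).le]
  exact intervalIntegral.intervalIntegral_pos_of_pos_on (((hc e).pow 2).intervalIntegrable _ _)
    (fun x hx => pow_pos (hpos e x (Ioo_subset_Icc_self hx)) 2) (G.len_pos e)

/-- Rescaling a positive solution of the normalised equation. -/
theorem IsTransmissionSolution.isPositiveSolution {p s : ℝ} (hs : 0 < s)
    {v v' v'' : E → ℝ → ℝ} (h : (G.scale hs).IsTransmissionSolution p v v' v'')
    (hpos : ∀ e, ∀ x ∈ Icc 0 (s * G.len e), 0 < v e x) {μ : ℝ} (hμ : 0 < μ)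
    (hμp : μ ^ (p - 1) = s ^ 2) :
    G.IsPositiveSolution p (s ^ 2) (G.l2Norm fun e x => μ * v e (s * x))
      (fun e x => μ * v e (s * x)) := by
  have hmul : ∀ x : ℝ, HasDerivAt (fun y : ℝ => s * y) s x := fun x => by
    simpa using (hasDerivAt_id x).const_mul s
  have hd : ∀ e x, HasDerivAt (fun x => μ * v e (s * x)) (μ * s * v' e (s * x)) x := fun e x =>
    (((h.hasDerivAt e (s * x)).comp x (hmul x)).const_mul μ).congr_deriv (by ring)
  have hd' : ∀ e x, HasDerivAt (fun x => μ * s * v' e (s * x)) (μ * s ^ 2 * v'' e (s * x)) x :=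
    fun e x => (((h.hasDerivAt' e (s * x)).comp x (hmul x)).const_mul (μ * s)).congr_deriv (by ring)
  have hc'' : ∀ e, Continuous fun x => μ * s ^ 2 * v'' e (s * x) := fun e =>
    continuous_const.mul ((h.continuous'' e).comp (continuous_const.mul continuous_id))
  have hc' : ∀ e, Continuous fun x => μ * s * v' e (s * x) := fun e =>
    continuous_iff_continuousAt.2 fun x => (hd' e x).continuousAt
  have hscale : ∀ e, ∀ x ∈ G.edge e, s * x ∈ Icc 0 (s * G.len e) := fun e x hx =>
    ⟨mul_nonneg hs.le hx.1, mul_le_mul_of_nonneg_left hx.2 hs.le⟩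
  have hud : ∀ e, UniqueDiffOn ℝ (G.edge e) := fun e => uniqueDiffOn_Icc (G.len_pos e)
  have hI0 : ∀ e, (0 : ℝ) ∈ G.edge e := fun e => ⟨le_rfl, (G.len_pos e).le⟩
  have hIL : ∀ e, G.len e ∈ G.edge e := fun e => ⟨(G.len_pos e).le, le_rfl⟩
  obtain ⟨val, hval⟩ := h.vertex
  refine ⟨⟨⟨fun e x _ => (hd e x).continuousAt.continuousWithinAt, fun w => μ * val w,
      fun e => ⟨?_, ?_⟩⟩, fun e => memH1Interval_of_hasDerivAt (G.len_pos e).le (hd e) (hc' e)⟩,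
    fun e => (contDiff_two_of_hasDerivAt (hd e) (hd' e) (hc'' e)).contDiffOn,
    fun e x hx => ?_, fun w => ?_, rfl, fun e x hx => mul_pos hμ (hpos e _ (hscale e x hx))⟩
  · change μ * v e (s * 0) = _
    rw [mul_zero, (hval e).1]; rfl
  · exact congrArg (μ * ·) (hval e).2
  · have hv := hpos e _ (hscale e x hx)
    rw [edge, iteratedDerivWithin_two_of_hasDerivAt (hd e) (hd' e) (hc'' e) (G.len_pos e) hx,
      h.equation e _ (hscale e x hx), max_eq_left hv.le, abs_of_pos (mul_pos hμ hv),
      Real.mul_rpow hμ.le hv.le, hμp, Real.rpow_sub_one hv.ne']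
    field_simp
    ring
  · have h1 := congrArg (fun t => μ * s * t) (h.kirchhoff w)
    simp only [mul_add, Finset.mul_sum, mul_zero] at h1
    unfold KirchhoffAt
    refine Eq.trans ?_ h1
    congr 1
    · refine Finset.sum_congr rfl fun e _ => ?_
      rw [outDerivSrc, (hd e 0).hasDerivWithinAt.derivWithin
        (hud e 0 (hI0 e)), mul_zero]
    · refine Finset.sum_congr rfl fun e _ => ?_
      rw [outDerivTgt, (hd e _).hasDerivWithinAt.derivWithin
        (hud e _ (hIL e)), scale_len]
      ring

end MetricGraph

/-! ### Peaked solutions for large `lam` and their mass. -/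

namespace MetricGraph

variable {V E : Type*} {G : MetricGraph V E}

theorem eq_of_src_eq_of_degree_eq_one [Finite E] {e₁ : E} (h : G.degree (G.src e₁) = 1) :
    (∀ e, G.src e = G.src e₁ → e = e₁) ∧ ∀ e, G.tgt e ≠ G.src e₁ := by
  have hpos : 0 < {e | G.src e = G.src e₁}.ncard :=
    (Set.ncard_pos (Set.toFinite _)).2 ⟨e₁, rfl⟩
  unfold degree at h
  refine ⟨fun e he => ?_, fun e he => ?_⟩
  · obtain ⟨a, ha⟩ := Set.ncard_eq_one.1 (show {e | G.src e = G.src e₁}.ncard = 1 by omega)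
    have h1 : e ∈ ({a} : Set E) := ha ▸ he
    have h2 : e₁ ∈ ({a} : Set E) := ha ▸ (rfl : G.src e₁ = G.src e₁)
    rw [mem_singleton_iff] at h1 h2
    rw [h1, h2]
  · have h1 : 0 < {e | G.tgt e = G.src e₁}.ncard := (Set.ncard_pos (Set.toFinite _)).2 ⟨e, he⟩
    omega

variable [Fintype E]

/-- For large `lam` there is a positive solution peaked at the pendant vertex of `e₁` and
exponentially close to the rescaled soliton. -/
theorem exists_peaked_solution (G : MetricGraph V E) (hconn : G.IsConnected) {p : ℝ} (hp : 1 < p)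
    {e₁ : E} (hsrc : ∀ e, G.src e = G.src e₁ → e = e₁) (htgt : ∀ e, G.tgt e ≠ G.src e₁) :
    ∃ lam₀ C : ℝ, 1 ≤ lam₀ ∧ 0 < C ∧ ∀ lam, lam₀ < lam → ∃ u u' : E → ℝ → ℝ,
      G.IsPositiveSolution p lam (G.l2Norm u) u ∧ 0 < G.l2Norm u ∧
      (∀ e x, HasDerivAt (u e) (u' e x) x) ∧ (∀ e, Continuous (u' e)) ∧
      (∀ e, ∀ x ∈ G.edge e, (e, x) ≠ (e₁, 0) → u e x < u e₁ 0) ∧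
      ∀ e, ∀ x ∈ G.edge e,
        |u e x - lam ^ (1 / (p - 1)) * solitonOn p e₁ e (√lam * x)| ≤
          lam ^ (1 / (p - 1)) * (C * Real.exp (-(√lam * G.len e₁))) ∧
        |u' e x - lam ^ (1 / (p - 1)) * √lam * solitonOnDeriv p e₁ e (√lam * x)| ≤
          lam ^ (1 / (p - 1)) * √lam * (C * Real.exp (-(√lam * G.len e₁))) := by
  obtain ⟨L, C, hC, hex⟩ := exists_solution_near_soliton V E hp
  obtain ⟨η, hη, hpeak⟩ := exists_peak_threshold V E hp
  have hsqrt : Tendsto (fun lam : ℝ => √lam) atTop atTop := Real.tendsto_sqrt_atTop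
  have h1 : ∀ᶠ lam : ℝ in atTop, ∀ e, L ≤ √lam * G.len e := eventually_all.2 fun e =>
    (hsqrt.atTop_mul_const (G.len_pos e)).eventually_ge_atTop L
  have h2 : ∀ᶠ lam : ℝ in atTop, C * Real.exp (-(√lam * G.len e₁)) < η := by
    have : Tendsto (fun lam : ℝ => C * Real.exp (-(√lam * G.len e₁))) atTop (𝓝 (C * 0)) :=
      (Real.tendsto_exp_neg_atTop_nhds_zero.comp
        (hsqrt.atTop_mul_const (G.len_pos e₁))).const_mul C
    exact this.eventually (gt_mem_nhds (by simpa using hη))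
  obtain ⟨M, hM⟩ := eventually_atTop.1 (h1.and h2)
  refine ⟨max M 1, C, le_max_right _ _, hC, fun lam hlam => ?_⟩
  have hlam0 : 0 < lam := by linarith [le_max_right M 1]
  obtain ⟨hL, hsmall⟩ := hM lam ((le_max_left _ _).trans hlam.le)
  set s := √lam with hsdef
  have hs : 0 < s := Real.sqrt_pos.2 hlam0
  have hs2 : s ^ 2 = lam := Real.sq_sqrt hlam0.le
  -- Rescaling changes only the lengths, so the constants `L`, `C` and `η`, independent of the
  -- graph, serve every `lam`, and connectedness is inherited.
  obtain ⟨v, v', v'', hsol, hclose⟩ := hex (G.scale hs) e₁ hL hsrc htgt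
  obtain ⟨hv0, hmax⟩ := hpeak (G.scale hs) e₁ hsrc htgt v v' v'' hsol
    fun e x hx => (hclose e x hx).1.trans hsmall.le
  have hpos : ∀ e, ∀ x ∈ Icc 0 (s * G.len e), 0 < v e x := fun e x hx =>
    hsol.pos hp (G := G.scale hs) hconn hv0 hx
  set μ := lam ^ (1 / (p - 1)) with hμdef
  have hμ : 0 < μ := Real.rpow_pos_of_pos hlam0 _
  have hμp : μ ^ (p - 1) = s ^ 2 := by
    rw [hμdef, ← Real.rpow_mul hlam0.le, one_div_mul_cancel (by linarith), Real.rpow_one, hs2]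
  have hps := hsol.isPositiveSolution hs hpos hμ hμp
  have hmul : ∀ x : ℝ, HasDerivAt (fun y : ℝ => s * y) s x := fun x => by
    simpa using (hasDerivAt_id x).const_mul s
  have hd : ∀ e x, HasDerivAt (fun x => μ * v e (s * x)) (μ * s * v' e (s * x)) x := fun e x =>
    (((hsol.hasDerivAt e (s * x)).comp x (hmul x)).const_mul μ).congr_deriv (by ring)
  have hc' : ∀ e, Continuous fun x => μ * s * v' e (s * x) := fun e =>
    continuous_const.mul ((continuous_iff_continuousAt.2 fun x =>
      (hsol.hasDerivAt' e x).continuousAt).comp (continuous_const.mul continuous_id))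
  have hscale : ∀ e, ∀ x ∈ G.edge e, s * x ∈ Icc 0 (s * G.len e) := fun e x hx =>
    ⟨mul_nonneg hs.le hx.1, mul_le_mul_of_nonneg_left hx.2 hs.le⟩
  rw [hs2] at hps
  have : Nonempty E := ⟨e₁⟩
  refine ⟨fun e x => μ * v e (s * x), fun e x => μ * s * v' e (s * x), hps,
    l2Norm_pos (fun e => continuous_iff_continuousAt.2 fun x => (hd e x).continuousAt) hps.pos,
    hd, hc', fun e x hx hne => ?_, fun e x hx => ⟨?_, ?_⟩⟩
  · have := hmax e (s * x) (hscale e x hx) fun h => hne (by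
      obtain ⟨he, hx0⟩ := Prod.mk.inj h
      rw [he, (mul_eq_zero.1 hx0).resolve_left hs.ne'])
    simp only [mul_zero]
    gcongr
  · rw [← mul_sub, abs_mul, abs_of_pos hμ]
    exact mul_le_mul_of_nonneg_left (hclose e _ (hscale e x hx)).1 hμ.le
  · rw [← mul_sub, abs_mul, abs_of_pos (mul_pos hμ hs)]
    exact mul_le_mul_of_nonneg_left (hclose e _ (hscale e x hx)).2 (mul_pos hμ hs).le

/-! ### The mass -/

theorem l2Norm_sq (u : E → ℝ → ℝ) : G.l2Norm u ^ 2 = ∑ e, ∫ x in (0 : ℝ)..G.len e, u e x ^ 2 := by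
  rw [l2Norm, Real.sq_sqrt (Finset.sum_nonneg fun e _ => integral_nonneg fun x => sq_nonneg _)]
  exact Finset.sum_congr rfl fun e _ => setIntegral_Ioo_eq (G.len_pos e).le

theorem abs_l2Norm_sq_sub_le {u w : E → ℝ → ℝ} {a b : ℝ} (hu : ∀ e, Continuous (u e))
    (hw : ∀ e, Continuous (w e)) (hd : ∀ e, ∀ x ∈ G.edge e, |u e x - w e x| ≤ a)
    (hb : ∀ e, ∀ x ∈ G.edge e, |w e x| ≤ b) :
    |G.l2Norm u ^ 2 - G.l2Norm w ^ 2| ≤ (∑ e, G.len e) * (a * (a + 2 * b)) := by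
  rw [l2Norm_sq, l2Norm_sq, ← Finset.sum_sub_distrib, Finset.sum_mul]
  refine (Finset.abs_sum_le_sum_abs _ _).trans (Finset.sum_le_sum fun e _ => ?_)
  rw [← intervalIntegral.integral_sub (f := fun x => u e x ^ 2) (g := fun x => w e x ^ 2)
    (((hu e).pow 2).intervalIntegrable _ _) (((hw e).pow 2).intervalIntegrable _ _)]
  have := intervalIntegral.norm_integral_le_of_norm_le_const (a := 0) (b := G.len e)
    (C := a * (a + 2 * b)) (f := fun x => u e x ^ 2 - w e x ^ 2) fun x hx => ?_
  · rw [sub_zero, abs_of_pos (G.len_pos e)] at this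
    rw [mul_comm]
    exact this
  · rw [uIoc_of_le (G.len_pos e).le] at hx
    have hx : x ∈ G.edge e := ⟨hx.1.le, hx.2⟩
    have h1 := hd e x hx
    have h2 := hb e x hx
    have h3 : |u e x + w e x| ≤ a + 2 * b := by
      have : u e x + w e x = (u e x - w e x) + 2 * w e x := by ring
      rw [this]
      refine (abs_add_le _ _).trans ?_
      rw [abs_mul, abs_two]
      linarith
    rw [Real.norm_eq_abs, sq_sub_sq, abs_mul, mul_comm]
    exact mul_le_mul h1 h3 (abs_nonneg _) ((abs_nonneg _).trans h1)

theorem l2Norm_sq_soliton (p : ℝ) (e₁ : E) {s : ℝ} (hs : 0 < s) (μ : ℝ) :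
    G.l2Norm (fun e x => μ * solitonOn p e₁ e (s * x)) ^ 2 =
      μ ^ 2 / s * ∫ x in (0 : ℝ)..s * G.len e₁, soliton p x ^ 2 := by
  rw [l2Norm_sq, Finset.sum_eq_single e₁]
  · have h : ∀ x : ℝ, (μ * solitonOn p e₁ e₁ (s * x)) ^ 2 = μ ^ 2 * soliton p (s * x) ^ 2 :=
      fun x => by rw [solitonOn, if_pos rfl, mul_pow]
    simp only [h]
    rw [intervalIntegral.integral_const_mul,
      intervalIntegral.integral_comp_mul_left (fun x => soliton p x ^ 2) hs.ne', mul_zero,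
      smul_eq_mul]
    ring
  · intro e _ he
    simp [solitonOn, he]
  · simp

theorem integrableOn_soliton_sq {p : ℝ} (hp : 1 < p) :
    IntegrableOn (fun x => soliton p x ^ 2) (Ioi 0) := by
  obtain ⟨K, hK, hU⟩ := exists_soliton_bound hp
  have h1 : IntegrableOn (fun x : ℝ => K ^ 2 * Real.exp (-2 * x)) (Ioi 0) :=
    (integrableOn_exp_mul_Ioi (by norm_num) 0).const_mul _
  refine Integrable.mono' h1 ((continuous_soliton hp).pow 2).aestronglyMeasurable
    (.of_forall fun x => ?_)
  rw [Real.norm_eq_abs, abs_of_nonneg (sq_nonneg _)]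
  calc soliton p x ^ 2 ≤ (K * Real.exp (-x)) ^ 2 :=
        pow_le_pow_left₀ (soliton_pos hp x).le (hU x).1 2
    _ = K ^ 2 * Real.exp (-2 * x) := by
        rw [mul_pow, ← Real.exp_nat_mul]; congr 2; push_cast; ring

/-- The rescaled soliton has mass `μ ^ 2 / s` times an integral tending to that over the half line,
and `μ ^ 2 / s` is exactly the stated power because `2 / (p - 1) - 1 / 2 = (5 - p) / (2 * (p - 1))`.
The correction costs a relative error of order `s * exp (-(s * len e₁))`. -/
theorem mass_asymptotics {p : ℝ} (hp : 1 < p) (e₁ : E) {lam₀ C : ℝ} (hlam₀ : 1 ≤ lam₀) (hC : 0 < C)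
    {u : ℝ → E → ℝ → ℝ} (hu : ∀ lam, lam₀ < lam → ∀ e, Continuous (u lam e))
    (hclose : ∀ lam, lam₀ < lam → ∀ e, ∀ x ∈ G.edge e,
        |u lam e x - lam ^ (1 / (p - 1)) * solitonOn p e₁ e (√lam * x)| ≤
          lam ^ (1 / (p - 1)) * (C * Real.exp (-(√lam * G.len e₁)))) :
    (fun lam : ℝ => G.l2Norm (u lam) ^ 2
        - (∫ x in Ioi (0 : ℝ), soliton p x ^ 2) * lam ^ ((5 - p) / (2 * (p - 1))))
      =o[atTop] (fun lam : ℝ => lam ^ ((5 - p) / (2 * (p - 1)))) := by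
  set I := ∫ x in Ioi (0 : ℝ), soliton p x ^ 2 with hI
  set A := soliton p 0 with hA
  have hA0 : 0 < A := soliton_pos hp 0
  set T := ∑ e, G.len e with hT
  have hT0 : 0 ≤ T := Finset.sum_nonneg fun e _ => (G.len_pos e).le
  have hlen := G.len_pos e₁
  have hsqrt : Tendsto (fun lam : ℝ => √lam) atTop atTop := Real.tendsto_sqrt_atTop
  let R : ℝ → ℝ := fun lam => T * (C * (C + 2 * A)) * (√lam * Real.exp (-(√lam * G.len e₁))) +
    |(∫ x in (0 : ℝ)..√lam * G.len e₁, soliton p x ^ 2) - I|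
  have hR : Tendsto R atTop (𝓝 0) := by
    have h1 : Tendsto (fun s : ℝ => s * Real.exp (-(s * G.len e₁))) atTop (𝓝 0) := by
      have h := Real.tendsto_pow_mul_exp_neg_atTop_nhds_zero 1 |>.comp
        (tendsto_id.atTop_mul_const hlen) |>.const_mul (G.len e₁)⁻¹
      rw [mul_zero] at h
      refine h.congr fun s => ?_
      simp only [Function.comp, id, pow_one]
      field_simp
    have h2 := intervalIntegral_tendsto_integral_Ioi 0 (integrableOn_soliton_sq hp)
      (hsqrt.atTop_mul_const hlen)
    have h3 : Tendsto (fun lam : ℝ => |(∫ x in (0 : ℝ)..√lam * G.len e₁, soliton p x ^ 2) - I|)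
        atTop (𝓝 0) := by
      have h := (h2.sub_const I).abs
      rwa [← hI, sub_self, abs_zero] at h
    have := ((h1.comp hsqrt).const_mul (T * (C * (C + 2 * A)))).add h3
    simpa using this
  have hlo : (fun lam : ℝ => lam ^ ((5 - p) / (2 * (p - 1))) * R lam) =o[atTop]
      fun lam : ℝ => lam ^ ((5 - p) / (2 * (p - 1))) := by
    have h := (Asymptotics.isBigO_refl (fun lam : ℝ => lam ^ ((5 - p) / (2 * (p - 1)))) atTop
      ).mul_isLittleO ((Asymptotics.isLittleO_one_iff ℝ).2 hR)
    simpa using h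
  refine Asymptotics.IsBigO.trans_isLittleO (.of_bound 1 ?_) hlo
  filter_upwards [eventually_gt_atTop lam₀] with lam hlam
  have hlam0 : 0 < lam := by linarith
  set s := √lam with hs
  have hs0 : 0 < s := Real.sqrt_pos.2 hlam0
  set μ := lam ^ (1 / (p - 1)) with hμ
  have hμ0 : 0 < μ := Real.rpow_pos_of_pos hlam0 _
  set g := lam ^ ((5 - p) / (2 * (p - 1))) with hg
  have hg0 : 0 < g := Real.rpow_pos_of_pos hlam0 _
  have hp1 : p - 1 ≠ 0 := by linarith
  have hμs : μ ^ 2 = g * s := by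
    rw [hμ, hg, hs, Real.sqrt_eq_rpow, ← Real.rpow_natCast, ← Real.rpow_mul hlam0.le,
      ← Real.rpow_add hlam0]
    congr 1
    push_cast
    field_simp
    ring
  set η := Real.exp (-(s * G.len e₁)) with hη
  have hη0 : 0 < η := Real.exp_pos _
  have hη1 : η ≤ 1 := Real.exp_le_one_iff.2 (by have := mul_pos hs0 hlen; linarith)
  have h1 := abs_l2Norm_sq_sub_le (G := G) (b := μ * A) (hu lam hlam)
    (w := fun e x => μ * solitonOn p e₁ e (s * x))
    (fun e => continuous_const.mul
      ((continuous_solitonOn hp e₁ e).comp (continuous_const.mul continuous_id)))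
    (hclose lam hlam) (fun e x _ => by
      rw [abs_mul, abs_of_pos hμ0]
      refine mul_le_mul_of_nonneg_left ?_ hμ0.le
      unfold solitonOn
      split_ifs
      · rw [abs_of_pos (soliton_pos hp _)]; exact soliton_le_soliton_zero hp _
      · rw [abs_zero]; exact hA0.le)
  rw [l2Norm_sq_soliton p e₁ hs0 μ, show μ ^ 2 / s = g by rw [hμs]; field_simp] at h1
  have h2 : T * (μ * (C * η) * (μ * (C * η) + 2 * (μ * A))) ≤
      g * (T * (C * (C + 2 * A)) * (s * η)) := by
    calc T * (μ * (C * η) * (μ * (C * η) + 2 * (μ * A)))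
        = T * (μ ^ 2 * (C * η) * (C * η + 2 * A)) := by ring
      _ ≤ T * (μ ^ 2 * (C * η) * (C * 1 + 2 * A)) := by gcongr
      _ = _ := by rw [hμs]; ring
  rw [one_mul, Real.norm_eq_abs, Real.norm_eq_abs, abs_of_nonneg (mul_nonneg hg0.le (by positivity))]
  set J := ∫ x in (0 : ℝ)..s * G.len e₁, soliton p x ^ 2 with hJ
  have h3 : G.l2Norm (u lam) ^ 2 - I * g = (G.l2Norm (u lam) ^ 2 - g * J) + g * (J - I) := by ring
  rw [h3]
  refine (abs_add_le _ _).trans ?_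
  rw [abs_mul, abs_of_pos hg0]
  calc _ ≤ g * (T * (C * (C + 2 * A)) * (s * η)) + g * |J - I| := by
        gcongr; exact h1.trans h2
    _ = g * R lam := by simp only [R]; ring

end MetricGraph

namespace MetricGraph

variable {V E : Type*} {G : MetricGraph V E}

/-! ### The remainder -/

theorem cutoffSoliton_eq (p lam : ℝ) (χ : ℝ → ℝ) (e₁ e : E) (x : ℝ) :
    cutoffSoliton p lam χ e₁ e x =
      χ x * (lam ^ (1 / (p - 1)) * solitonOn p e₁ e (√lam * x)) := by
  unfold cutoffSoliton rescaledSoliton solitonOn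
  split_ifs <;> simp

/-- The derivative of `cutoffSoliton`. -/
def cutoffSolitonDeriv (p lam : ℝ) (χ : ℝ → ℝ) (e₁ e : E) (x : ℝ) : ℝ :=
  deriv χ x * (lam ^ (1 / (p - 1)) * solitonOn p e₁ e (√lam * x)) +
    χ x * (lam ^ (1 / (p - 1)) * √lam * solitonOnDeriv p e₁ e (√lam * x))

theorem hasDerivAt_cutoffSoliton {p : ℝ} (hp : 1 < p) (lam : ℝ) {χ : ℝ → ℝ}
    (hχ : ContDiff ℝ ∞ χ) (e₁ e : E) (x : ℝ) :
    HasDerivAt (cutoffSoliton p lam χ e₁ e) (cutoffSolitonDeriv p lam χ e₁ e x) x := by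
  have h : cutoffSoliton p lam χ e₁ e =
      fun x => χ x * (lam ^ (1 / (p - 1)) * solitonOn p e₁ e (√lam * x)) :=
    funext (cutoffSoliton_eq p lam χ e₁ e)
  have hmul : HasDerivAt (fun y : ℝ => √lam * y) √lam x := by
    simpa using (hasDerivAt_id x).const_mul √lam
  have hd : Differentiable ℝ χ := hχ.differentiable (by simp)
  rw [h]
  refine ((hd x).hasDerivAt.mul (((hasDerivAt_solitonOn hp e₁ e (√lam * x)).comp x
    hmul).const_mul _)).congr_deriv ?_
  simp only [cutoffSolitonDeriv, Function.comp]
  ring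

theorem continuous_cutoffSolitonDeriv {p : ℝ} (hp : 1 < p) (lam : ℝ) {χ : ℝ → ℝ}
    (hχ : ContDiff ℝ ∞ χ) (e₁ e : E) : Continuous (cutoffSolitonDeriv p lam χ e₁ e) := by
  have hmul : Continuous fun y : ℝ => √lam * y := continuous_const.mul continuous_id
  have h1 : Continuous (solitonOnDeriv p e₁ e) :=
    continuous_iff_continuousAt.2 fun x => (hasDerivAt_solitonOnDeriv hp e₁ e x).continuousAt
  exact ((hχ.continuous_deriv (by simp)).mul (continuous_const.mul
    ((continuous_solitonOn hp e₁ e).comp hmul))).add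
    (hχ.continuous.mul (continuous_const.mul (h1.comp hmul)))

/-- Cutting off the rescaled soliton changes it by an exponentially small amount. -/
theorem exists_cutoff_bound {p : ℝ} (hp : 1 < p) {l : ℝ} {χ : ℝ → ℝ}
    (hχ : IsCutoff l χ) (e₁ : E) : ∃ C > 0, ∀ s, 0 < s → ∀ e, ∀ x ∈ Ioo 0 (G.len e),
      |(1 - χ x) * solitonOn p e₁ e (s * x)| ≤ C * Real.exp (-(s * (l / 2))) ∧
      |(1 - χ x) * solitonOnDeriv p e₁ e (s * x)| ≤ C * Real.exp (-(s * (l / 2))) ∧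
      |deriv χ x * solitonOn p e₁ e (s * x)| ≤ C * Real.exp (-(s * (l / 2))) := by
  obtain ⟨K, hK, hU⟩ := exists_soliton_bound hp
  have hdχ : Continuous (deriv χ) := hχ.smooth.continuous_deriv (by simp)
  obtain ⟨M, hM⟩ := (isCompact_Icc (a := 0) (b := G.len e₁)).exists_bound_of_continuousOn
    (continuous_const.sub hχ.smooth.continuous (f := fun _ => (1 : ℝ))).continuousOn
  obtain ⟨N, hN⟩ := (isCompact_Icc (a := 0) (b := G.len e₁)).exists_bound_of_continuousOn
    hdχ.continuousOn
  have h0 : (0 : ℝ) ∈ Icc 0 (G.len e₁) := ⟨le_rfl, (G.len_pos e₁).le⟩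
  have hM0 : 0 ≤ M := (norm_nonneg _).trans (hM 0 h0)
  have hN0 : 0 ≤ N := (norm_nonneg _).trans (hN 0 h0)
  refine ⟨(M + N + 1) * K, by positivity, fun s hs e x hx => ?_⟩
  have hE := Real.exp_pos (-(s * (l / 2)))
  have hr : 0 ≤ (M + N + 1) * K * Real.exp (-(s * (l / 2))) := by positivity
  by_cases he : e = e₁
  swap
  · simp [solitonOn, solitonOnDeriv, he, hr]
  subst he
  simp only [solitonOn, solitonOnDeriv, if_true]
  have hxI := Ioo_subset_Icc_self hx
  rcases lt_or_ge x (l / 2) with hxl | hxl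
  -- Below `l / 2` both `1 - χ` and `deriv χ` vanish; from `l / 2` on, the decay of the soliton
  -- takes over.
  · have h1 : χ x = 1 := hχ.eq_one x hx.1.le hxl.le
    have h2 : deriv χ x = 0 := by
      have : χ =ᶠ[𝓝 x] fun _ => 1 := by
        filter_upwards [Ioo_mem_nhds hx.1 hxl] with y hy
        exact hχ.eq_one y hy.1.le hy.2.le
      rw [this.deriv_eq, deriv_const]
    simp [h1, h2, hr]
  · have hE' : Real.exp (-(s * x)) ≤ Real.exp (-(s * (l / 2))) :=
      Real.exp_le_exp.2 (neg_le_neg (mul_le_mul_of_nonneg_left hxl hs.le))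
    have key : ∀ a b : ℝ, |a| ≤ M + N + 1 → |b| ≤ K * Real.exp (-(s * x)) →
        |a * b| ≤ (M + N + 1) * K * Real.exp (-(s * (l / 2))) := fun a b ha hb => by
      rw [abs_mul, mul_assoc]
      exact mul_le_mul ha (hb.trans (mul_le_mul_of_nonneg_left hE' hK.le)) (abs_nonneg _)
        (by positivity)
    have hMx : |1 - χ x| ≤ M + N + 1 := (hM x hxI).trans (by linarith)
    have hNx : |deriv χ x| ≤ M + N + 1 := (hN x hxI).trans (by linarith)
    have hb : |soliton p (s * x)| ≤ K * Real.exp (-(s * x)) := by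
      rw [abs_of_pos (soliton_pos hp _)]; exact (hU _).1
    exact ⟨key _ _ hMx hb, key _ _ hMx (hU _).2, key _ _ hNx hb⟩

/-- The condition `l < len e₁` makes the cut-off soliton vanish at the far vertex, and at the
pendant vertex no other edge has to match, so it is continuous on the graph. -/
theorem memH1_sub_cutoffSoliton {p : ℝ} (hp : 1 < p) {e₁ : E}
    (hsrc : ∀ e, G.src e = G.src e₁ → e = e₁) (htgt : ∀ e, G.tgt e ≠ G.src e₁) {l : ℝ}
    (hl : l < G.len e₁) {χ : ℝ → ℝ} (hχ : IsCutoff l χ) (lam : ℝ) {u u' : E → ℝ → ℝ}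
    (hu : G.MemH1 u) (hd : ∀ e x, HasDerivAt (u e) (u' e x) x) (hc : ∀ e, Continuous (u' e)) :
    G.MemH1 (u - cutoffSoliton p lam χ e₁) := by
  classical
  have hd' : ∀ e x, HasDerivAt ((u - cutoffSoliton p lam χ e₁) e)
      (u' e x - cutoffSolitonDeriv p lam χ e₁ e x) x := fun e x =>
    (hd e x).sub (hasDerivAt_cutoffSoliton hp lam hχ.smooth e₁ e x)
  obtain ⟨⟨-, val, hval⟩, -⟩ := hu
  refine ⟨⟨fun e x _ => (hd' e x).continuousAt.continuousWithinAt, fun w =>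
      val w - if w = G.src e₁ then cutoffSoliton p lam χ e₁ e₁ 0 else 0, fun e => ⟨?_, ?_⟩⟩,
    fun e => memH1Interval_of_hasDerivAt (G.len_pos e).le (hd' e)
      ((hc e).sub (continuous_cutoffSolitonDeriv hp lam hχ.smooth e₁ e))⟩
  · by_cases he : e = e₁
    · subst he; simp [(hval e).1]
    · have hne : G.src e ≠ G.src e₁ := fun h => he (hsrc e h)
      simp [(hval e).1, hne, cutoffSoliton, rescaledSoliton, he]
  · have h0 : cutoffSoliton p lam χ e₁ e (G.len e) = 0 := by
      by_cases he : e = e₁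
      · subst he; simp [cutoffSoliton, hχ.eq_zero _ hl.le]
      · simp [cutoffSoliton, rescaledSoliton, he]
    simp [(hval e).2, htgt e, h0]

theorem integral_sq_le {f : ℝ → ℝ} {l c : ℝ} (hl : 0 ≤ l) (hf : ∀ x ∈ Ioo 0 l, |f x| ≤ c) :
    ∫ x in Ioo 0 l, f x ^ 2 ≤ l * c ^ 2 := by
  have h := norm_setIntegral_le_of_norm_le_const (μ := volume) (s := Ioo 0 l)
    (f := fun x => f x ^ 2) (C := c ^ 2) (by simp) (fun x hx => by
      rw [Real.norm_eq_abs, abs_pow]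
      exact pow_le_pow_left₀ (abs_nonneg _) (hf x hx) 2)
  rw [Real.volume_real_Ioo_of_le hl, sub_zero, mul_comm] at h
  exact (le_abs_self _).trans h

variable [Fintype E]

theorem lamNorm_le {lam a : ℝ} (hlam : 0 ≤ lam) (ha : 0 ≤ a) {φ φ' : E → ℝ → ℝ}
    (hd : ∀ e x, HasDerivAt (φ e) (φ' e x) x) (hc : ∀ e, Continuous (φ' e))
    (hφ : ∀ e, ∀ x ∈ Ioo 0 (G.len e), |φ e x| ≤ a)
    (hφ' : ∀ e, ∀ x ∈ Ioo 0 (G.len e), |φ' e x| ≤ √lam * a) :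
    G.lamNorm lam φ ≤ √(2 * ∑ e, G.len e) * (√lam * a) := by
  have h1 : ∑ e, ∫ x in Ioo 0 (G.len e), weakDeriv (G.len e) (φ e) x ^ 2 ≤
      (∑ e, G.len e) * (√lam * a) ^ 2 := by
    rw [Finset.sum_mul]
    refine Finset.sum_le_sum fun e _ => ?_
    have h := weakDeriv_ae_eq (isWeakDerivL2_of_hasDerivAt (G.len_pos e).le (hd e) (hc e))
    have h' : ∫ x in Ioo 0 (G.len e), weakDeriv (G.len e) (φ e) x ^ 2 =
        ∫ x in Ioo 0 (G.len e), φ' e x ^ 2 :=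
      integral_congr_ae (h.mono fun x hx => by simp only [hx])
    rw [h']
    exact integral_sq_le (G.len_pos e).le (hφ' e)
  have h2 : ∑ e, ∫ x in Ioo 0 (G.len e), φ e x ^ 2 ≤ (∑ e, G.len e) * a ^ 2 := by
    rw [Finset.sum_mul]
    exact Finset.sum_le_sum fun e _ => integral_sq_le (G.len_pos e).le (hφ e)
  have hT : 0 ≤ ∑ e, G.len e := Finset.sum_nonneg fun e _ => (G.len_pos e).le
  rw [lamNorm, ← Real.sqrt_sq (show 0 ≤ √lam * a by positivity), ← Real.sqrt_mul (by positivity)]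
  refine Real.sqrt_le_sqrt ?_
  have h3 := mul_le_mul_of_nonneg_left h2 hlam
  have h4 : (√lam * a) ^ 2 = lam * a ^ 2 := by rw [mul_pow, Real.sq_sqrt hlam]
  rw [h4] at h1 ⊢
  nlinarith

/-- The difference between a solution close to the soliton and the cut-off soliton is smaller than
any power. -/
theorem lamNorm_sub_cutoffSoliton_isBigO {p : ℝ} (hp : 1 < p) (e₁ : E) {l : ℝ} (hl : 0 < l)
    {χ : ℝ → ℝ} (hχ : IsCutoff l χ) {lam₀ C : ℝ} (hlam₀ : 1 ≤ lam₀) (hC : 0 < C)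
    {u u' : ℝ → E → ℝ → ℝ}
    (hd : ∀ lam, lam₀ < lam → ∀ e x, HasDerivAt (u lam e) (u' lam e x) x)
    (hc : ∀ lam, lam₀ < lam → ∀ e, Continuous (u' lam e))
    (hclose : ∀ lam, lam₀ < lam → ∀ e, ∀ x ∈ G.edge e,
        |u lam e x - lam ^ (1 / (p - 1)) * solitonOn p e₁ e (√lam * x)| ≤
          lam ^ (1 / (p - 1)) * (C * Real.exp (-(√lam * G.len e₁))) ∧
        |u' lam e x - lam ^ (1 / (p - 1)) * √lam * solitonOnDeriv p e₁ e (√lam * x)| ≤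
          lam ^ (1 / (p - 1)) * √lam * (C * Real.exp (-(√lam * G.len e₁)))) (α : ℝ) :
    (fun lam : ℝ => G.lamNorm lam (u lam - cutoffSoliton p lam χ e₁)) =O[atTop]
      fun lam : ℝ => lam ^ (-α) := by
  obtain ⟨B, hB, hcut⟩ := exists_cutoff_bound (G := G) hp hχ e₁
  -- There are two exponential errors: the correction, with rate `len e₁`, and the cut-off, with
  -- rate `l / 2`.
  set m := min (G.len e₁) (l / 2) with hm
  have hm0 : 0 < m := lt_min (G.len_pos e₁) (by linarith)
  have hbound : ∀ᶠ lam in atTop, ‖G.lamNorm lam (u lam - cutoffSoliton p lam χ e₁)‖ ≤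
      (√(2 * ∑ e, G.len e) * (C + 2 * B)) *
        ‖lam ^ (1 / (p - 1) + 1 / 2) * Real.exp (-m * √lam)‖ := by
    filter_upwards [eventually_gt_atTop lam₀] with lam hlam
    have hlam1 : 1 ≤ lam := hlam₀.trans hlam.le
    have hlam0 : 0 < lam := by linarith
    set s := √lam with hs
    have hs1 : 1 ≤ s := Real.one_le_sqrt.2 hlam1
    have hs0 : 0 < s := by linarith
    set μ := lam ^ (1 / (p - 1)) with hμ
    have hμ0 : 0 < μ := Real.rpow_pos_of_pos hlam0 _
    set η := Real.exp (-m * s) with hη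
    have hη0 : 0 < η := Real.exp_pos _
    have hη1 : Real.exp (-(s * G.len e₁)) ≤ η := Real.exp_le_exp.2 (by
      have := mul_le_mul_of_nonneg_left (min_le_left (G.len e₁) (l / 2)) hs0.le
      rw [← hm] at this; linarith)
    have hη2 : Real.exp (-(s * (l / 2))) ≤ η := Real.exp_le_exp.2 (by
      have := mul_le_mul_of_nonneg_left (min_le_right (G.len e₁) (l / 2)) hs0.le
      rw [← hm] at this; linarith)
    have hBη : B * Real.exp (-(s * (l / 2))) ≤ B * η := by gcongr
    have hCη : C * Real.exp (-(s * G.len e₁)) ≤ C * η := by gcongr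
    have hle := lamNorm_le (G := G) (φ := u lam - cutoffSoliton p lam χ e₁)
      (φ' := fun e x => u' lam e x - cutoffSolitonDeriv p lam χ e₁ e x)
      (a := μ * ((C + 2 * B) * η)) hlam0.le (by positivity)
      (fun e x => (hd lam hlam e x).sub (hasDerivAt_cutoffSoliton hp lam hχ.smooth e₁ e x))
      (fun e => (hc lam hlam e).sub (continuous_cutoffSolitonDeriv hp lam hχ.smooth e₁ e))
      (fun e x hx => by
        have h1 := (hclose lam hlam e x (Ioo_subset_Icc_self hx)).1
        have h2 := (hcut s hs0 e x hx).1
        have e1 : (u lam - cutoffSoliton p lam χ e₁) e x =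
            (u lam e x - μ * solitonOn p e₁ e (s * x)) +
              μ * ((1 - χ x) * solitonOn p e₁ e (s * x)) := by
          simp only [Pi.sub_apply, cutoffSoliton_eq]; ring
        rw [e1]
        refine (abs_add_le _ _).trans ?_
        rw [abs_mul, abs_of_pos hμ0]
        calc _ ≤ μ * (C * η) + μ * (B * η) :=
              add_le_add (h1.trans (by gcongr)) (by gcongr; exact h2.trans hBη)
          _ = μ * ((C + B) * η) := by ring
          _ ≤ _ := by gcongr; linarith)
      (fun e x hx => by
        have h1 := (hclose lam hlam e x (Ioo_subset_Icc_self hx)).2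
        have h2 := (hcut s hs0 e x hx).2.1
        have h3 := (hcut s hs0 e x hx).2.2
        have e1 : u' lam e x - cutoffSolitonDeriv p lam χ e₁ e x =
            (u' lam e x - μ * s * solitonOnDeriv p e₁ e (s * x)) +
              μ * s * ((1 - χ x) * solitonOnDeriv p e₁ e (s * x)) -
              μ * (deriv χ x * solitonOn p e₁ e (s * x)) := by
          simp only [cutoffSolitonDeriv]; ring
        rw [e1]
        refine (abs_sub _ _).trans ((add_le_add_left (abs_add_le _ _) _).trans ?_)
        rw [abs_mul (μ * s), abs_mul μ (deriv χ x * _), abs_of_pos hμ0, abs_of_pos (mul_pos hμ0 hs0)]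
        -- The term in which the cut-off is differentiated carries no factor `s`; as `1 ≤ s` it is
        -- absorbed into the others, whence `2 * B`.
        have h4 : μ * (B * η) ≤ s * (μ * (B * η)) :=
          le_mul_of_one_le_left (by positivity) hs1
        calc _ ≤ μ * s * (C * η) + μ * s * (B * η) + μ * (B * η) :=
              add_le_add (add_le_add (h1.trans (by gcongr)) (by gcongr; exact h2.trans hBη))
                (by gcongr; exact h3.trans hBη)
          _ ≤ μ * s * (C * η) + μ * s * (B * η) + s * (μ * (B * η)) := by gcongr
          _ = _ := by ring)
    have hpow : lam ^ (1 / (p - 1) + 1 / 2) = μ * s := by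
      rw [Real.rpow_add hlam0, hs, Real.sqrt_eq_rpow]
    rw [Real.norm_eq_abs, abs_of_nonneg (show 0 ≤ G.lamNorm lam _ from Real.sqrt_nonneg _), hpow, Real.norm_eq_abs,
      abs_of_pos (by positivity)]
    refine hle.trans (le_of_eq ?_)
    ring
  -- The comparison is made in the variable `√lam`, so the exponent is doubled; it is chosen so that
  -- multiplying by the prefactor `lam ^ (1 / (p - 1) + 1 / 2)` leaves `lam ^ (-α)`.
  have hlo := (isLittleO_exp_neg_mul_rpow_atTop hm0 (2 * (-α - (1 / (p - 1) + 1 / 2)))).comp_tendsto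
    Real.tendsto_sqrt_atTop
  have hmul := (Asymptotics.isBigO_refl (fun lam : ℝ => lam ^ (1 / (p - 1) + 1 / 2)) atTop).mul
    hlo.isBigO
  refine (Asymptotics.IsBigO.of_bound _ hbound).trans (hmul.congr' (.of_forall fun _ => rfl) ?_)
  filter_upwards [eventually_gt_atTop 0] with lam hlam
  simp only [Function.comp]
  rw [Real.sqrt_eq_rpow, ← Real.rpow_mul hlam.le, ← Real.rpow_add hlam]
  congr 1
  ring

end MetricGraph

end

/-! ### Assembly of the family of solutions. -/

theorem mainTheorem3 {V E : Type*} [Finite V] [Fintype E] (G : MetricGraph V E)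
    (hconn : G.IsConnected) (p : ℝ) (hp : 1 < p)
    (v₁ : V) (hdeg : G.degree v₁ = 1) (e₁ : E) (he₁ : G.src e₁ = v₁)
    (l : ℝ) (hl : 0 < l) (hl₁ : l < G.len e₁) (χ : ℝ → ℝ) (hχ : IsCutoff l χ) :
    ∃ (lam₀ : ℝ) (u φ : ℝ → E → ℝ → ℝ) (ρ : ℝ → ℝ),
      0 < lam₀ ∧
      (∀ lam : ℝ, lam₀ < lam →
        0 < ρ lam ∧
        G.IsPositiveSolution p lam (ρ lam) (u lam) ∧
        G.MemH1 (φ lam) ∧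
        u lam = cutoffSoliton p lam χ e₁ + φ lam ∧
        -- the maximum over the graph is attained at `v₁` only
        (∀ e, ∀ x ∈ G.edge e, (e, x) ≠ (e₁, 0) → u lam e x < u lam e₁ 0)) ∧
      (∀ α : ℝ, 0 < α →
        (fun lam : ℝ => G.lamNorm lam (φ lam)) =O[atTop] (fun lam : ℝ => lam ^ (-α))) ∧
      (fun lam : ℝ => ρ lam ^ 2
          - (∫ x in Ioi (0 : ℝ), soliton p x ^ 2) * lam ^ ((5 - p) / (2 * (p - 1))))
        =o[atTop] (fun lam : ℝ => lam ^ ((5 - p) / (2 * (p - 1)))) := by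
  subst he₁
  obtain ⟨hsrc, htgt⟩ := MetricGraph.eq_of_src_eq_of_degree_eq_one hdeg
  obtain ⟨lam₀, C, hlam₀, hC, hex⟩ := G.exists_peaked_solution hconn hp hsrc htgt
  -- For `lam ≤ lam₀` the chosen functions are arbitrary; both asymptotic statements concern `lam →
  -- ∞` only.
  choose! u u' hsol hρ hd hc hmax hclose using hex
  have hcu : ∀ lam, lam₀ < lam → ∀ e, Continuous (u lam e) := fun lam hlam e =>
    continuous_iff_continuousAt.2 fun x => (hd lam hlam e x).continuousAt
  refine ⟨lam₀, u, fun lam => u lam - cutoffSoliton p lam χ e₁, fun lam => G.l2Norm (u lam),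
    by linarith, fun lam hlam => ⟨hρ lam hlam, hsol lam hlam, ?_, ?_, hmax lam hlam⟩,
    fun α _ => ?_, ?_⟩
  · exact MetricGraph.memH1_sub_cutoffSoliton hp hsrc htgt hl₁ hχ lam (hsol lam hlam).memH1
      (hd lam hlam) (hc lam hlam)
  · exact (add_sub_cancel _ _).symm
  · exact MetricGraph.lamNorm_sub_cutoffSoliton_isBigO hp e₁ hl hχ hlam₀ hC hd hc hclose α
  · exact MetricGraph.mass_asymptotics hp e₁ hlam₀ hC hcu
      fun lam hlam e x hx => (hclose lam hlam e x hx).1
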